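/- Let $K=K_1\times\cdots\times K_m$ be a finite product of number fields, and let $\mathcal O\subseteq K$ be an order, i.e. a subring that is finitely generated as a $\mathbb Z$-module and satisfies $\mathbb Q\mathcal O=K$. Let $r_1$ be the number of ring homomorphisms $K\to\mathbb R$, and $2r_2$ the number of ring homomorphisms $K\to\mathbb C$ with image not contained in $\mathbb R$. Let $h(\mathcal O)=\#\operatorname{Pic}\mathcal O$, let $w(\mathcal O)$ be the order of the torsion subgroup of $\mathcal O^\times$, and let $\operatorname{Disc}\mathcal O=\det(\operatorname{Tr}_{K/\mathbb Q}(e_ie_j))_{i,j}$ for a $\mathbb Z$-basis $(e_i)$ of $\mathcal O$. Choose an infinite place $v_i$ of each $K_i$, and map $u=(u_1,\dots,u_m)\in\mathcal O^\times$ to the vector with coordinates $\log|u_i|_v$ ($v$ real) and $2\log|u_i|_v$ ($v$ complex), where $1\le i\le m$ and $v$ runs over the infinite places of $K_i$ other than $v_i$. The image of $\mathcal O^\times$ is a full lattice in $\mathbb R^{r_1+r_2-m}$; the regulator $R(\mathcal O)$ is its covolume, which does not depend on the choice of the $v_i$. Finally, for $\operatorname{Re}s>1$ let $$\zeta_{\mathcal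 O}(s)=\prod_{\mathfrak p}\bigl(1-(\#\mathcal O/\mathfrak p)^{-s}\bigr)^{-1},$$ where $\mathfrak p$ runs over the maximal ideals of $\mathcal O$. Then the product converges for $\operatorname{Re}s>1$ (unconditionally), $\zeta_{\mathcal O}$ extends to a function meromorphic at $s=1$, and this extension (again denoted $\zeta_{\mathcal O}$) satisfies $$\lim_{s\to1}(s-1)^m\zeta_{\mathcal O}(s)=\frac{2^{r_1}(2\pi)^{r_2}}{w(\mathcal O)\sqrt{|\operatorname{Disc}\mathcal O|}}\,h(\mathcal O)\,R(\mathcal O),$$ where $s\to1$ through complex values $s\ne1$. -/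

import Mathlib

open Filter Topology

namespace OrderCNF

noncomputable section

/-- A subring `O` of a `ℚ`-algebra `A` is an order in `A` if it is finitely generated as a
`ℤ`-module and `ℚ O = A`. -/
class IsOrder {A : Type*} [CommRing A] [Algebra ℚ A] (O : Subring A) : Prop where
  finite : Module.Finite ℤ O
  span_eq_top : Submodule.span ℚ (O : Set A) = ⊤

/-- The number `r₁` of ring homomorphisms `A → ℝ`. -/
def r₁ (A : Type*) [CommRing A] : ℕ := Nat.card (A →+* ℝ)

/-- The number `r₂` of pairs of conjugate ring homomorphisms `A → ℂ` whose image is not contained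
in `ℝ`. -/
def r₂ (A : Type*) [CommRing A] : ℕ :=
  Nat.card {f : A →+* ℂ // ¬ Set.range f ⊆ Set.range ((↑) : ℝ → ℂ)} / 2

/-- The class number `h(R)`: the order of the Picard group. -/
def classNumber (R : Type*) [CommRing R] : ℕ := Nat.card (CommRing.Pic R)

/-- The number `w(R)` of roots of unity in `R`: the order of the torsion subgroup of `Rˣ`. -/
def torsionOrder (R : Type*) [CommRing R] : ℕ := Nat.card (CommGroup.torsion Rˣ)

/-- The factor `(1 - N𝔭⁻ˢ)⁻¹` at a maximal ideal `𝔭`, where `N𝔭 = #(R/𝔭)`. -/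
def eulerFactor (R : Type*) [CommRing R] (s : ℂ) (p : MaximalSpectrum R) : ℂ :=
  (1 - (Nat.card (R ⧸ p.asIdeal) : ℂ) ^ (-s))⁻¹

/-- The Euler product `ζ_R(s) = ∏ (1 - N𝔭⁻ˢ)⁻¹` over the maximal ideals of `R`
(meaningful where the product converges). -/
def zeta (R : Type*) [CommRing R] (s : ℂ) : ℂ :=
  ∏' p : MaximalSpectrum R, eulerFactor R s p

instance {A : Type*} [CommRing A] [Algebra ℚ A] (O : Subring A) [IsOrder O] :
    Module.Finite ℤ O := IsOrder.finite

instance {A : Type*} [CommRing A] [Algebra ℚ A] (O : Subring A) [IsOrder O] :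
    Module.Free ℤ O := by
  have : Module.IsTorsionFree ℤ A := Module.IsTorsionFree.trans_faithfulSMul ℤ ℚ A
  have : Module.IsTorsionFree ℤ O :=
    Function.Injective.moduleIsTorsionFree (Subtype.val : O → A) Subtype.val_injective
      (fun _ _ => rfl)
  infer_instance

/-- The discriminant `det (Tr_{A/ℚ}(eᵢ eⱼ))` for a `ℤ`-basis `e` of the order `O`; it does not
depend on the basis. -/
def disc {A : Type*} [CommRing A] [Algebra ℚ A] (O : Subring A) [IsOrder O] : ℚ :=
  Algebra.discr ℚ (fun j => ((Module.Free.chooseBasis ℤ O j : O) : A))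

section Regulator

open NumberField NumberField.Units.dirichletUnitTheorem

variable {m : ℕ} (K : Fin m → Type*) [∀ i, Field (K i)] [∀ i, NumberField (K i)]

/-- The index set of the coordinates of `∏ i, ℝ ^ r(K i)`: all the infinite places of the
factors `K i`, except one chosen place `w₀` of each factor. -/
abbrev LogIndex : Type _ := Σ i, {w : InfinitePlace (K i) // w ≠ w₀}

open scoped Classical in
instance : Fintype (LogIndex K) := inferInstance

variable {K}

/-- The logarithmic embedding of `Oˣ`, with one coordinate forgotten for each factor of `∏ i, K i`.
The coordinate at an infinite place `w` of `K i` is `mult w * log |uᵢ|_w`, that is `log |·|` at a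
real place and `2 log |·|` at a complex place. -/
def logEmbedding (O : Subring (∀ i, K i)) : Additive Oˣ →+ (LogIndex K → ℝ) where
  toFun u := fun j => (j.2.1.mult : ℝ) * Real.log (j.2.1 (((u.toMul : Oˣ) : O).1 j.1))
  map_zero' := by ext; simp
  map_add' u v := by
    have hne (x : Oˣ) (i : Fin m) : ((x : O) : ∀ i, K i) i ≠ 0 := fun h => by
      have h1 : ((x : O) : ∀ i, K i) i * ((x⁻¹ : Oˣ) : O).1 i = 1 :=
        congrFun (congrArg Subtype.val x.mul_inv) i
      rw [h, zero_mul] at h1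
      exact zero_ne_one h1
    ext j
    simp only [toMul_add, Units.val_mul, Subring.coe_mul, Pi.mul_apply, map_mul, Pi.add_apply]
    rw [Real.log_mul, mul_add]
    · exact (map_ne_zero _).mpr (hne _ _)
    · exact (map_ne_zero _).mpr (hne _ _)

/-- The lattice `L(O)`, the image of the unit group under the logarithmic embedding. -/
def unitLattice (O : Subring (∀ i, K i)) : Submodule ℤ (LogIndex K → ℝ) :=
  Submodule.map (logEmbedding O).toIntLinearMap ⊤

/-- The regulator `R(O)`: the covolume of `L(O)`. -/
def regulator (O : Subring (∀ i, K i)) : ℝ := ZLattice.covolume (unitLattice O)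

end Regulator

end

end OrderCNF

/-! Write `S` for the product of the rings of integers of the `K i`, and choose a positive integer
`N` with `N S ⊆ O`. The ideal `f = N S` of `S` lies in `O`. The formula is known for each number
field, at least as a limit along the reals from the right; it is transported from `S` to `O` by
comparing both sides.

Analytic side. Away from `N`, the maximal ideals of `O` and `S` correspond, with the same residue
fields. So the Euler product of `O` is the product of the Dedekind zeta functions times a finite
product `C(s)` of Euler factors and their inverses. A finite ring `A` has `#A * ∏ (1 - 1/N𝔪)` units,
hence `C(1) = #(S/f)ˣ / (#(O/f)ˣ * [S : O])` (`exists_comparison_factor`).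

Arithmetic side. The sequence `Oˣ → Sˣ → Inv → Pic O → Pic S → 1` is exact, where `Inv` is the group
of invertible `O`-submodules of `S`. Reduction modulo `f` identifies `Inv` with `(S/f)ˣ / (O/f)ˣ`,
so `h(O) * [Sˣ : Oˣ] * #(O/f)ˣ = h(S) * #(S/f)ˣ` (`card_pic_mul_index_mul_card_units`). The
logarithmic embedding gives `R(O) * w(S) = R(S) * [Sˣ : Oˣ] * w(O)` (`regulator_mul_torsionOrder`),
where `R(S)` and `w(S)` are products over the fields. Also `|Disc O| = [S : O]² * |Disc S|`
(`abs_disc_eq`). The unit index cancels, and the right-hand side changes by exactly `C(1)`.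

A limit through complex `s` needs the Dedekind zeta functions to be meromorphic at `1`; then the
one-sided real limit determines the complex one. A partial zeta function is a sum over an ideal `Λ`
modulo units. Instead of a fundamental domain, a weight `g` is used: a partition of unity in
logarithmic coordinates, of degree `0`, whose sum over each unit orbit is the number of roots of
unity. Let `Z(s)` be the sum of `g(x) * |N x| ^ (-s)` over `Λ`, of rank `n`. Splitting `Λ` into the
`2 ^ n` cosets of `2 Λ` and comparing `2 x + e` with `2 x` expresses `(1 - 2 ^ (n - n s)) * Z(s)` as
a sum of differences. As `g` and `log |N x|` vary slowly, these differences are summable beyond `Re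
s = 1` (`HomogeneousData.exists_meromorphicAt`). -/

namespace OrderCNF

/-! ### Invertible submodules and their reduction modulo an ideal. -/

section PicardGroup

open Submodule CommRing

variable {R S R' S' : Type*} [CommRing R] [CommRing S] [CommRing R'] [CommRing S']
  [Algebra R S] [Algebra R' S'] {σ : R →+* R'} [RingHomSurjective σ]

/-- The monoid homomorphism `J ↦ π J` on submodules of algebras, induced by a surjective
semilinear ring homomorphism `π`. -/
def submoduleMapHom (π : S →+* S') (h : ∀ r, π (algebraMap R S r) = algebraMap R' S' (σ r)) :
    Submodule R S →* Submodule R' S' where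
  toFun J := J.map ({ π with map_smul' := fun r x => by simp [Algebra.smul_def, h] } : S →ₛₗ[σ] S')
  map_one' := by
    ext x
    simp only [Submodule.mem_map, Submodule.mem_one]
    constructor
    · rintro ⟨_, ⟨r, rfl⟩, rfl⟩
      exact ⟨σ r, (h r).symm⟩
    · rintro ⟨r', rfl⟩
      obtain ⟨r, rfl⟩ := RingHomSurjective.is_surjective (σ := σ) r'
      exact ⟨_, ⟨r, rfl⟩, h r⟩
  map_mul' I J := by
    apply le_antisymm
    · rintro _ ⟨x, hx, rfl⟩
      refine Submodule.mul_induction_on (C := fun x => π x ∈ I.map _ * J.map _) hx ?_ ?_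
      · intro a ha b hb
        rw [map_mul]
        exact Submodule.mul_mem_mul ⟨a, ha, rfl⟩ ⟨b, hb, rfl⟩
      · intro x y hx hy
        rw [map_add]
        exact Submodule.add_mem _ hx hy
    · rw [Submodule.mul_le]
      rintro _ ⟨a, ha, rfl⟩ _ ⟨b, hb, rfl⟩
      exact ⟨a * b, Submodule.mul_mem_mul ha hb, map_mul π a b⟩

theorem mem_submoduleMapHom {π : S →+* S'}
    {h : ∀ r, π (algebraMap R S r) = algebraMap R' S' (σ r)} {J : Submodule R S} {y : S'} :
    y ∈ submoduleMapHom π h J ↔ ∃ x ∈ J, π x = y := Iff.rfl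

/-- An invertible submodule contains every ideal of the algebra that is contained in the
base ring. -/
theorem le_of_mul_eq_one {N J J' : Submodule R S} (hN : N ≤ 1) (hN' : N * J' ≤ N)
    (hJ : J * J' = 1) : N ≤ J :=
  calc N = N * J' * J := by rw [mul_assoc, mul_comm J', hJ, mul_one]
    _ ≤ 1 * J := mul_le_mul' (hN'.trans hN) le_rfl
    _ = J := one_mul J

/-- The kernel of `π` is an ideal of `S` lying in the image of `R`, so by `le_of_mul_eq_one` every
invertible submodule contains it. Such submodules are recovered from their images, and the inverse
map is the preimage `C`. -/
theorem submoduleMapHom_bijective {π : S →+* S'}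
    (h : ∀ r, π (algebraMap R S r) = algebraMap R' S' (σ r))
    (hπ : Function.Surjective π) (hker : ∀ x, π x = 0 → x ∈ (algebraMap R S).range) :
    Function.Bijective (Units.map (submoduleMapHom π h)) := by
  let N : Submodule R S := { (RingHom.ker π).toAddSubmonoid with
    smul_mem' := fun r x hx => by
      simp only [AddSubsemigroup.mem_carrier, AddSubmonoid.mem_toSubsemigroup,
        Submodule.mem_toAddSubmonoid, RingHom.mem_ker] at hx ⊢
      simp [Algebra.smul_def, hx] }
  have memN {x} : x ∈ N ↔ π x = 0 := Iff.rfl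
  have hN : N ≤ 1 := fun x hx => by
    obtain ⟨r, hr⟩ := hker x (memN.1 hx)
    exact Submodule.mem_one.2 ⟨r, hr⟩
  have hNM (M : Submodule R S) : N * M ≤ N := by
    rw [Submodule.mul_le]
    intro a ha b _
    rw [memN] at ha ⊢
    simp [ha]
  have mem_of {J : Submodule R S} (hJ : N ≤ J) {x : S} (hx : π x ∈ submoduleMapHom π h J) :
      x ∈ J := by
    obtain ⟨y, hy, hxy⟩ := mem_submoduleMapHom.1 hx
    have : x - y ∈ J := hJ (memN.2 (by simp [hxy]))
    simpa using J.add_mem this hy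
  constructor
  · intro I J hIJ
    have key : ∀ I J : (Submodule R S)ˣ, Units.map (submoduleMapHom π h) I =
        Units.map (submoduleMapHom π h) J → (I : Submodule R S) ≤ J := by
      intro I J hIJ x hx
      refine mem_of (le_of_mul_eq_one hN (hNM _) J.mul_inv) ?_
      have : (submoduleMapHom π h (I : Submodule R S)) = submoduleMapHom π h J :=
        congrArg Units.val hIJ
      rw [← this]
      exact ⟨x, hx, rfl⟩
    exact Units.ext (le_antisymm (key I J hIJ) (key J I hIJ.symm))
  · intro L
    let C (L : Submodule R' S') : Submodule R S :=
      { L.toAddSubmonoid.comap (π : S →+ S') with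
        smul_mem' := fun r x hx => by
          simp only [AddSubsemigroup.mem_carrier, AddSubmonoid.mem_toSubsemigroup,
            AddSubmonoid.mem_comap, Submodule.mem_toAddSubmonoid] at hx ⊢
          rw [Algebra.smul_def, AddMonoidHom.coe_coe, map_mul, h, ← Algebra.smul_def]
          exact L.smul_mem _ hx }
    have memC {L : Submodule R' S'} {x} : x ∈ C L ↔ π x ∈ L := Iff.rfl
    have hNC (L) : N ≤ C L := fun x hx => memC.2 (by rw [memN.1 hx]; exact L.zero_mem)
    have mapC (L) : submoduleMapHom π h (C L) = L := by
      ext y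
      rw [mem_submoduleMapHom]
      constructor
      · rintro ⟨x, hx, rfl⟩; exact hx
      · intro hy
        obtain ⟨x, rfl⟩ := hπ y
        exact ⟨x, hy, rfl⟩
    have hmul : ∀ L L' : Submodule R' S', L * L' = 1 → C L * C L' = 1 := by
      intro L L' hL
      have hmap : submoduleMapHom π h (C L * C L') = 1 := by rw [map_mul, mapC, mapC, hL]
      have h1 : (1 : Submodule R S) ≤ C L * C L' ⊔ N := by
        intro x hx
        have : π x ∈ submoduleMapHom π h (C L * C L') := by
          rw [hmap, ← map_one (submoduleMapHom π h)]; exact ⟨x, hx, rfl⟩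
        obtain ⟨y, hy, hxy⟩ := mem_submoduleMapHom.1 this
        have : y + (x - y) ∈ C L * C L' ⊔ N :=
          Submodule.add_mem_sup hy (memN.2 (by simp [hxy]))
        simpa using this
      -- The product is `1` up to an error in `N`. Multiplying `h1` by `N` absorbs the error,
      -- because `N * C L` and `N` are contained in `C L` and `N` is contained in `C L'`.
      have h2 : N ≤ C L * C L' := by
        calc N = N * 1 := (mul_one N).symm
          _ ≤ N * (C L * C L' ⊔ N) := mul_le_mul' le_rfl h1
          _ = N * C L * C L' ⊔ N * N := by rw [Submodule.mul_sup, mul_assoc]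
          _ ≤ C L * C L' := sup_le
            (mul_le_mul' ((hNM _).trans (hNC L)) le_rfl)
            (mul_le_mul' (hNC L) (hNC L'))
      apply le_antisymm
      · intro x hx
        refine mem_of hN ?_
        rw [map_one, ← hmap]
        exact ⟨x, hx, rfl⟩
      · exact h1.trans (sup_le le_rfl h2)
    refine ⟨⟨C L, C (L⁻¹ : (Submodule R' S')ˣ), hmul _ _ L.mul_inv, hmul _ _ L.inv_mul⟩, ?_⟩
    exact Units.ext (mapC L)

/-- When `Pic R` is trivial, every invertible submodule is generated by a unit of `S`, which is
unique up to units of `R`. -/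
theorem card_submodule_units_mul [FaithfulSMul R S] [Subsingleton (Pic R)] :
    Nat.card (Submodule R S)ˣ * Nat.card Rˣ = Nat.card Sˣ := by
  have h1 := ker_unitsToPic R S
  have h2 : (unitsToPic R S).ker = ⊤ := by
    ext; simpa using Subsingleton.elim _ _
  rw [h2] at h1
  have h3 := ker_unitsMap_spanSingleton (R := R) (A := S)
  have h4 := (Units.map (spanSingleton R (A := S)).toMonoidHom).ker.index_mul_card
  rw [Subgroup.index_ker, ← h1, Subgroup.card_top] at h4
  rw [← h4]
  congr 1
  have h5 : (Units.map (spanSingleton R (A := S)).toMonoidHom).ker =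
    (Units.map (algebraMap R S).toMonoidHom).range := h3
  rw [h5]
  exact Nat.card_congr (MonoidHom.ofInjective
    (Units.map_injective (FaithfulSMul.algebraMap_injective R S))).toEquiv

/-- Exactness of `Rˣ → Sˣ → (Submodule R S)ˣ → Pic R → Pic S`, read off on orders. -/
theorem card_submodule_units_eq [FaithfulSMul R S] :
    Nat.card (Submodule R S)ˣ =
      (Units.map (algebraMap R S : R →* S)).range.index * Nat.card (Pic.mapAlgebra R S).ker := by
  have h1 := ker_unitsToPic R S
  have h2 := range_unitsToPic R S
  have h3 := ker_unitsMap_spanSingleton (R := R) (A := S)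
  have h4 := (unitsToPic R S).ker.index_mul_card
  rw [Subgroup.index_ker, h2, h1, ← Subgroup.index_ker] at h4
  rw [← h4, mul_comm]
  congr 2

end PicardGroup

/-! ### Class number of a subring in terms of that of the overring. -/

section PicardSurjective

open Submodule CommRing TensorProduct

variable {R S A : Type*} [CommRing R] [CommRing S] [CommRing A] [Algebra R S] [Algebra S A]

/-- An invertible submodule is principal modulo an ideal with finite quotient. -/
theorem exists_mul_sub_one_mem [FaithfulSMul S A] (f : Ideal S) [Finite (S ⧸ f)]
    (I : (Submodule S A)ˣ) :
    ∃ a ∈ (I : Submodule S A), ∃ b ∈ ((I⁻¹ : (Submodule S A)ˣ) : Submodule S A),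
      ∃ t ∈ f, a * b + algebraMap S A t = 1 ∧
      (I : Submodule S A) = span S {a} ⊔
      Submodule.map (Algebra.linearMap S A) f * I := by
  -- Over the finite ring `S ⧸ f` an invertible module is free of rank one, so `I / f I` has a
  -- single generator; `a` lifts it.
  have : Module.Free (S ⧸ f) ((S ⧸ f) ⊗[S] I) := inferInstance
  obtain ⟨e⟩ := Module.Invertible.free_iff_linearEquiv.1 this
  let e' : (I ⧸ (f • (⊤ : Submodule S I))) ≃ₗ[S] (S ⧸ f) :=
    (quotTensorEquivQuotSMul I f).symm ≪≫ₗ e.restrictScalars S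
  obtain ⟨a, ha⟩ := Submodule.mkQ_surjective _ (e'.symm 1)
  have hI : (I : Submodule S A) = span S {(a : A)} ⊔
      Submodule.map (Algebra.linearMap S A) f * I := by
    apply le_antisymm
    · intro x hx
      obtain ⟨s, hs⟩ := Ideal.Quotient.mk_surjective (e' (Submodule.mkQ _ ⟨x, hx⟩))
      have h1 : Submodule.mkQ (f • (⊤ : Submodule S I)) (⟨x, hx⟩ - s • a) = 0 := by
        apply e'.injective
        rw [map_sub, map_smul, ha, map_sub, map_smul, e'.apply_symm_apply, map_zero, ← hs,
          sub_eq_zero, Algebra.smul_def, mul_one]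
        rfl
      rw [Submodule.mkQ_apply, Submodule.Quotient.mk_eq_zero] at h1
      have h2 : ((⟨x, hx⟩ - s • a : (I : Submodule S A)) : A) ∈
          Submodule.map (Algebra.linearMap S A) f * (I : Submodule S A) := by
        refine Submodule.smul_induction_on (p := fun (y : (I : Submodule S A)) =>
          (y : A) ∈ Submodule.map (Algebra.linearMap S A) f * (I : Submodule S A)) h1 ?_ ?_
        · intro r hr n _
          rw [Submodule.coe_smul, Algebra.smul_def]
          exact Submodule.mul_mem_mul ⟨r, hr, rfl⟩ n.2
        · intro y z hy hz
          exact Submodule.add_mem _ hy hz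
      have := Submodule.add_mem_sup
        (Submodule.smul_mem _ s (Submodule.mem_span_singleton_self (R := S) (a : A))) h2
      simpa using this
    · refine sup_le ?_ ?_
      · rw [Submodule.span_singleton_le_iff_mem]; exact a.2
      · rw [Submodule.mul_le]
        rintro _ ⟨s, _, rfl⟩ n hn
        rw [Algebra.linearMap_apply, ← Algebra.smul_def]
        exact Submodule.smul_mem _ _ hn
  -- Multiply `I = S a + f I` by the inverse of `I`.
  have h1 : (1 : A) ∈ span S {(a : A)} * ((I⁻¹ : (Submodule S A)ˣ) : Submodule S A) ⊔
      Submodule.map (Algebra.linearMap S A) f := by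
    have : (1 : A) ∈ (I : Submodule S A) * ((I⁻¹ : (Submodule S A)ˣ) : Submodule S A) := by
      rw [I.mul_inv]; exact (Submodule.mem_one.2 ⟨1, map_one _⟩)
    rw [hI, Submodule.sup_mul, mul_assoc, I.mul_inv, mul_one] at this
    exact this
  obtain ⟨y, hy, z, hz, hyz⟩ := Submodule.mem_sup.1 h1
  obtain ⟨b, hb, rfl⟩ := Submodule.mem_span_singleton_mul.1 hy
  obtain ⟨t, ht, rfl⟩ := hz
  exact ⟨a, a.2, b, hb, t, ht, hyz, hI⟩

variable [Algebra R A] [IsScalarTower R S A]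

/-- Since `Pic A` is trivial, a class of `Pic S` is represented by an invertible `I ⊆ A`. With `a`,
`b` as in `exists_mul_sub_one_mem`, the `R`-module `R a + f I` is invertible with inverse `R b + f
I⁻¹`, and it generates `I` over `S`. -/
theorem mapAlgebra_surjective [FaithfulSMul R S] [FaithfulSMul S A] [FaithfulSMul R A]
    [Subsingleton (Pic A)]
    (f : Ideal S) [Finite (S ⧸ f)] (hf : ∀ x ∈ f, x ∈ (algebraMap R S).range) :
    Function.Surjective (Pic.mapAlgebra R S) := by
  intro M
  have hM : M ∈ (unitsToPic S A).range := by
    rw [range_unitsToPic, relPic_eq_top]; trivial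
  obtain ⟨I, rfl⟩ := hM
  obtain ⟨a, ha, b, hb, t, ht, hab, hI⟩ := exists_mul_sub_one_mem f I
  set I' : Submodule S A := ((I⁻¹ : (Submodule S A)ˣ) : Submodule S A) with hI'
  set F : Submodule S A := Submodule.map (Algebra.linearMap S A) f with hF
  have hFR : F.restrictScalars R ≤ 1 := by
    rintro _ ⟨x, hx, rfl⟩
    obtain ⟨r, rfl⟩ := hf x hx
    exact Submodule.mem_one.2 ⟨r, by rw [Algebra.linearMap_apply, ← IsScalarTower.algebraMap_apply]⟩
  have hsp (x : A) (P : Submodule S A) (hx : x ∈ P) : span R {x} ≤ P.restrictScalars R := by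
    rw [Submodule.span_singleton_le_iff_mem]; exact hx
  have hF1 : F ≤ 1 := by
    rintro _ ⟨x, _, rfl⟩
    exact Submodule.mem_one.2 ⟨x, rfl⟩
  have hFF (P : Submodule S A) (hP : P ≤ 1) : F * P ≤ F :=
    (mul_le_mul' le_rfl hP).trans (mul_one F).le
  have hmul : (span R {a} ⊔ (F * I).restrictScalars R) *
      (span R {b} ⊔ (F * I').restrictScalars R) = 1 := by
    have hab1 : a * b ∈ (1 : Submodule R A) := by
      rw [eq_sub_of_add_eq hab]
      exact Submodule.sub_mem _ (Submodule.mem_one.2 ⟨1, map_one _⟩) (hFR ⟨t, ht, rfl⟩)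
    -- Here `F = I * (F * I')` with `I = S a + F I`; the scalars from `S` in `S a` are absorbed by
    -- the `S`-module `F * I'`.
    have h4 : F.restrictScalars R ≤ span R {a} * (F * I').restrictScalars R ⊔
        (F * I).restrictScalars R * (F * I').restrictScalars R := by
      have : F = span S {a} * (F * I') ⊔ (F * I) * (F * I') := by
        rw [← Submodule.sup_mul, ← hI, mul_left_comm, hI', I.mul_inv, mul_one]
      intro x hx
      rw [Submodule.restrictScalars_mem, this] at hx
      obtain ⟨y, hy, z, hz, rfl⟩ := Submodule.mem_sup.1 hx
      refine Submodule.add_mem_sup ?_ hz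
      obtain ⟨w, hw, rfl⟩ := Submodule.mem_span_singleton_mul.1 hy
      exact Submodule.mul_mem_mul (Submodule.mem_span_singleton_self a) hw
    have h5 : F.restrictScalars R ≤ (span R {a} ⊔ (F * I).restrictScalars R) *
        (span R {b} ⊔ (F * I').restrictScalars R) := by
      refine h4.trans (sup_le ?_ ?_)
      · exact mul_le_mul' le_sup_left le_sup_right
      · exact mul_le_mul' le_sup_right le_sup_right
    apply le_antisymm
    · rw [Submodule.sup_mul, Submodule.mul_sup, Submodule.mul_sup]
      refine sup_le (sup_le ?_ ?_) (sup_le ?_ ?_)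
      · rw [Submodule.span_mul_span, Set.singleton_mul_singleton,
          Submodule.span_singleton_le_iff_mem]
        exact hab1
      · refine le_trans ?_ hFR
        refine (mul_le_mul' (hsp a I ha) le_rfl).trans ?_
        rw [← Submodule.restrictScalars_mul, mul_left_comm, hI', I.mul_inv, mul_one]
      · refine le_trans ?_ hFR
        refine (mul_le_mul' le_rfl (hsp b I' hb)).trans ?_
        rw [← Submodule.restrictScalars_mul, mul_assoc, hI', I.mul_inv, mul_one]
      · refine le_trans ?_ hFR
        rw [← Submodule.restrictScalars_mul, mul_mul_mul_comm, hI', I.mul_inv, mul_one]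
        exact hFF F hF1
    · rw [Submodule.one_le, ← hab]
      refine Submodule.add_mem _ ?_ (h5 ⟨t, ht, rfl⟩)
      exact Submodule.mul_mem_mul (Submodule.mem_sup_left (Submodule.mem_span_singleton_self a))
        (Submodule.mem_sup_left (Submodule.mem_span_singleton_self b))
  obtain ⟨J, hJ⟩ : ∃ J : (Submodule R A)ˣ,
      (J : Submodule R A) = span R {a} ⊔ (F * I).restrictScalars R :=
    ⟨⟨_, _, hmul, by rw [mul_comm]; exact hmul⟩, rfl⟩
  have hJI : (J : Submodule R A) ≤ (I : Submodule S A).restrictScalars R := by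
    rw [hJ]
    refine sup_le (hsp a I ha) ?_
    intro x hx
    rw [Submodule.restrictScalars_mem] at hx ⊢
    rw [hI]
    exact Submodule.mem_sup_right hx
  refine ⟨unitsToPic R A J, ?_⟩
  let g : (J : Submodule R A) →ₗ[R] (I : Submodule S A) := Submodule.inclusion hJI
  -- Surjectivity suffices: a surjection between invertible modules is bijective.
  have hg : Function.Surjective (g.liftBaseChange S) := by
    rintro ⟨x, hx⟩
    have hx' := hx
    rw [hI] at hx'
    obtain ⟨y, hy, z, hz, rfl⟩ := Submodule.mem_sup.1 hx'
    obtain ⟨s, rfl⟩ := Submodule.mem_span_singleton.1 hy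
    refine ⟨s ⊗ₜ ⟨a, hJ ▸ Submodule.mem_sup_left (Submodule.mem_span_singleton_self a)⟩ +
      1 ⊗ₜ ⟨z, hJ ▸ Submodule.mem_sup_right hz⟩, ?_⟩
    rw [map_add, LinearMap.liftBaseChange_tmul, LinearMap.liftBaseChange_tmul, one_smul]
    rfl
  exact Pic.mk_eq_mk_iff.2 ⟨(AlgebraTensorModule.congr (.refl S S) (unitsToPicEquiv J)) ≪≫ₗ
    LinearEquiv.ofBijective _ (Module.Invertible.bijective_of_surjective hg)⟩

/-- The class number of an order in terms of the class number of an overring: the quotient is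
governed by the unit groups modulo an ideal contained in the conductor. -/
theorem card_pic_mul_index_mul_card_units [FaithfulSMul R S] [FaithfulSMul S A] [FaithfulSMul R A]
    [Subsingleton (Pic A)] (f : Ideal S) [Finite (S ⧸ f)]
    (hf : ∀ x ∈ f, x ∈ (algebraMap R S).range) :
    Nat.card (Pic R) * (Units.map (algebraMap R S : R →* S)).range.index *
      Nat.card (R ⧸ f.comap (algebraMap R S))ˣ = Nat.card (Pic S) * Nat.card (S ⧸ f)ˣ := by
  have hinj : Function.Injective (algebraMap (R ⧸ f.comap (algebraMap R S)) (S ⧸ f)) :=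
    Ideal.algebraMap_quotient_injective
  have : Finite (R ⧸ f.comap (algebraMap R S)) := Finite.of_injective _ hinj
  have : FaithfulSMul (R ⧸ f.comap (algebraMap R S)) (S ⧸ f) :=
    (faithfulSMul_iff_algebraMap_injective _ _).2 hinj
  have : RingHomSurjective (Ideal.Quotient.mk (f.comap (algebraMap R S))) :=
    ⟨Ideal.Quotient.mk_surjective⟩
  have h1 := Nat.card_congr (Equiv.ofBijective _ (submoduleMapHom_bijective
    (σ := Ideal.Quotient.mk (f.comap (algebraMap R S))) (π := Ideal.Quotient.mk f)
    (fun r => rfl) Ideal.Quotient.mk_surjective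
    (fun x hx => hf x (Ideal.Quotient.eq_zero_iff_mem.1 hx))))
  have h2 := card_submodule_units_mul (R := R ⧸ f.comap (algebraMap R S)) (S := S ⧸ f)
  have h3 := card_submodule_units_eq (R := R) (S := S)
  have h4 := (Pic.mapAlgebra R S).ker.index_mul_card
  rw [Subgroup.index_ker, MonoidHom.range_eq_top.2
    (mapAlgebra_surjective (A := A) f hf), Subgroup.card_top] at h4
  rw [← h2, ← h1, h3, ← h4]
  -- The order of `(Submodule R S)ˣ` has been computed twice: by reduction modulo `f`, and by the
  -- exact sequence with `Pic R → Pic S` surjective.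
  ring

end PicardSurjective

/-! ### Unit groups of finite rings and quotients. -/

section FiniteRing

theorem card_units_of_field (F : Type*) [Field F] [Finite F] :
    (Nat.card Fˣ : ℂ) = Nat.card F * (1 - (Nat.card F : ℂ)⁻¹) := by
  have h : 0 < Nat.card F := Nat.card_pos
  have h' : (Nat.card F : ℂ) ≠ 0 := by exact_mod_cast h.ne'
  rw [Nat.card_units, Nat.cast_sub h, mul_sub, mul_inv_cancel₀ h']
  simp

/-- The unit group of a monoid, as the subtype of units. -/
noncomputable def unitsEquivSubtype (M : Type*) [Monoid M] : Mˣ ≃ {x : M // IsUnit x} :=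
  Equiv.ofBijective (fun u => ⟨u, u.isUnit⟩)
    ⟨fun _ _ h => Units.ext (congrArg Subtype.val h), fun x => ⟨x.2.unit, rfl⟩⟩

/-- The order of the unit group of a finite commutative ring. -/
theorem card_units_of_finite (A : Type*) [CommRing A] [Finite A] [Fintype (MaximalSpectrum A)] :
    (Nat.card Aˣ : ℂ) =
      Nat.card A * ∏ m : MaximalSpectrum A, (1 - (Nat.card (A ⧸ m.asIdeal) : ℂ)⁻¹) := by
  let n := nilradical A
  have hn : IsNilpotent n := IsNoetherianRing.isNilpotent_nilradical A
  let e := (IsArtinianRing.quotNilradicalEquivPi A).toRingEquiv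
  have h1 : Nat.card A = Nat.card (A ⧸ n) * Nat.card n :=
    AddSubgroup.card_eq_card_quotient_mul_card_addSubgroup n.toAddSubgroup
  -- Being a unit depends only on the class modulo the nilpotent ideal `n`, so the units fill whole
  -- cosets. The quotient by `n` is a product of fields.
  have h2 : Nat.card Aˣ = Nat.card n * Nat.card (A ⧸ n)ˣ := by
    let t : Set (A ⧸ n.toAddSubgroup) := {x : A ⧸ n | IsUnit x}
    have e1 : Aˣ ≃ (QuotientAddGroup.mk ⁻¹' t : Set A) :=
      (unitsEquivSubtype A).trans (Equiv.subtypeEquivRight fun x =>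
        (hn.isUnit_quotient_mk_iff (x := x)).symm)
    have e2 : (A ⧸ n)ˣ ≃ t := unitsEquivSubtype (A ⧸ n)
    rw [Nat.card_congr e1, Nat.card_congr e2, ← Nat.card_prod]
    exact Nat.card_congr (QuotientAddGroup.preimageMkEquivAddSubgroupProdSet _ _)
  have h3 : Nat.card (A ⧸ n) = ∏ m : MaximalSpectrum A, Nat.card (A ⧸ m.asIdeal) := by
    rw [Nat.card_congr e.toEquiv, Nat.card_pi]
  have h4 : Nat.card (A ⧸ n)ˣ = ∏ m : MaximalSpectrum A, Nat.card (A ⧸ m.asIdeal)ˣ := by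
    rw [Nat.card_congr ((Units.mapEquiv e.toMulEquiv).trans MulEquiv.piUnits).toEquiv, Nat.card_pi]
  have h5 : ∀ m : MaximalSpectrum A, (Nat.card (A ⧸ m.asIdeal)ˣ : ℂ) =
      Nat.card (A ⧸ m.asIdeal) * (1 - (Nat.card (A ⧸ m.asIdeal) : ℂ)⁻¹) := fun m =>
    let _ := Ideal.Quotient.field m.asIdeal
    have : Finite (A ⧸ m.asIdeal) := Finite.of_surjective _ (Ideal.Quotient.mk_surjective)
    card_units_of_field _
  rw [h2, h1, h3, h4]
  push_cast
  simp_rw [h5]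
  rw [Finset.prod_mul_distrib]
  ring

/-- The maximal ideals of a quotient ring. -/
def maximalSpectrumQuotient {R : Type*} [CommRing R] (I : Ideal R) :
    MaximalSpectrum (R ⧸ I) ≃ {m : MaximalSpectrum R // I ≤ m.asIdeal} where
  toFun m := ⟨⟨m.asIdeal.comap (Ideal.Quotient.mk I),
    have := m.isMaximal
    Ideal.comap_isMaximal_of_surjective _ Ideal.Quotient.mk_surjective⟩, by
      exact Ideal.mk_ker.symm.le.trans (Ideal.comap_mono bot_le)⟩
  invFun m := ⟨m.1.asIdeal.map (Ideal.Quotient.mk I),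
    have := m.1.isMaximal
    Ideal.IsMaximal.map_of_surjective_of_ker_le Ideal.Quotient.mk_surjective
      (by rw [Ideal.mk_ker]; exact m.2)⟩
  left_inv m := MaximalSpectrum.ext
    (Ideal.map_comap_of_surjective _ Ideal.Quotient.mk_surjective _)
  right_inv m := Subtype.ext (MaximalSpectrum.ext (by
    simpa [Ideal.comap_map_of_surjective _ Ideal.Quotient.mk_surjective,
      ← RingHom.ker_eq_comap_bot] using m.2))

theorem card_quotient_maximalSpectrumQuotient {R : Type*} [CommRing R] (I : Ideal R)
    (m : MaximalSpectrum (R ⧸ I)) :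
    Nat.card (R ⧸ (maximalSpectrumQuotient I m).1.asIdeal) = Nat.card ((R ⧸ I) ⧸ m.asIdeal) := by
  have hs : Function.Surjective ((Ideal.Quotient.mk m.asIdeal).comp (Ideal.Quotient.mk I)) :=
    Ideal.Quotient.mk_surjective.comp Ideal.Quotient.mk_surjective
  rw [← Nat.card_congr (RingHom.quotientKerEquivOfSurjective hs).toEquiv]
  have : (maximalSpectrumQuotient I m).1.asIdeal =
      RingHom.ker ((Ideal.Quotient.mk m.asIdeal).comp (Ideal.Quotient.mk I)) := by
    ext x
    simp [maximalSpectrumQuotient, Ideal.Quotient.eq_zero_iff_mem]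
  rw [this]

theorem finite_maximalSpectrum_ge {R : Type*} [CommRing R] (I : Ideal R) [Finite (R ⧸ I)] :
    Finite {m : MaximalSpectrum R // I ≤ m.asIdeal} :=
  Finite.of_equiv _ (maximalSpectrumQuotient I)

theorem card_units_quotient {R : Type*} [CommRing R] (I : Ideal R) [Finite (R ⧸ I)]
    [Fintype {m : MaximalSpectrum R // I ≤ m.asIdeal}] :
    (Nat.card (R ⧸ I)ˣ : ℂ) = Nat.card (R ⧸ I) *
      ∏ m : {m : MaximalSpectrum R // I ≤ m.asIdeal},
        (1 - (Nat.card (R ⧸ m.1.asIdeal) : ℂ)⁻¹) := by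
  have := Fintype.ofFinite (MaximalSpectrum (R ⧸ I))
  rw [card_units_of_finite, ← Equiv.prod_comp (maximalSpectrumQuotient I)]
  simp_rw [card_quotient_maximalSpectrumQuotient]

theorem card_quotient_eq_mul_index {R S : Type*} [CommRing R] [CommRing S] [Algebra R S]
    (f : Ideal S) (hf : ∀ x ∈ f, x ∈ (algebraMap R S).range) :
    Nat.card (S ⧸ f) = Nat.card (R ⧸ f.comap (algebraMap R S)) *
      (algebraMap R S).range.toAddSubgroup.index := by
  have h1 : Nat.card (S ⧸ f) = f.toAddSubgroup.index := rfl
  have h2 : Nat.card (R ⧸ f.comap (algebraMap R S)) =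
      (f.toAddSubgroup.comap (algebraMap R S : R →+ S)).index := rfl
  have h3 : (algebraMap R S : R →+ S).range = (algebraMap R S).range.toAddSubgroup := rfl
  rw [h1, h2, AddSubgroup.index_comap, h3, AddSubgroup.relIndex_mul_index]
  exact hf

end FiniteRing

/-! ### Maximal ideals away from `N`. -/

section AwayFromConductor

variable {R S : Type*} [CommRing R] [CommRing S] [Algebra R S] {N : ℕ}

/-- As `N` is invertible modulo the maximal ideal `P ∩ R`, say with inverse `M`, each `x` is
congruent to `M * (N * x)`, which comes from `R`. -/
theorem mk_comp_algebraMap_surjective [Algebra.IsIntegral R S]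
    (hN : ∀ x : S, N * x ∈ (algebraMap R S).range)
    (P : Ideal S) [P.IsMaximal] (hP : (N : S) ∉ P) :
    Function.Surjective ((Ideal.Quotient.mk P).comp (algebraMap R S)) := by
  intro y
  obtain ⟨x, rfl⟩ := Ideal.Quotient.mk_surjective y
  have hm : (P.comap (algebraMap R S)).IsMaximal :=
    Ideal.isMaximal_comap_of_isIntegral_of_isMaximal P
  have hN' : (N : R) ∉ P.comap (algebraMap R S) := by simpa using hP
  obtain ⟨M, i, hi, hM⟩ := hm.exists_inv hN'
  obtain ⟨r, hr⟩ := hN x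
  refine ⟨M * r, ?_⟩
  rw [RingHom.comp_apply, map_mul, hr, Ideal.Quotient.eq]
  have h2 : algebraMap R S M * N + algebraMap R S i = 1 := by
    simpa using congrArg (algebraMap R S) hM
  have : algebraMap R S M * (N * x) - x = - (algebraMap R S i * x) := by
    linear_combination x * h2
  rw [this]
  exact P.neg_mem (P.mul_mem_right _ hi)

/-- Away from `N`, the maximal ideals of `R` and of an integral extension `S` with `N S ⊆ R`
agree. -/
noncomputable def maximalSpectrumAway [FaithfulSMul R S] [Algebra.IsIntegral R S]
    (hN : ∀ x : S, N * x ∈ (algebraMap R S).range) :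
    {m : MaximalSpectrum S // (N : S) ∉ m.asIdeal} ≃
      {m : MaximalSpectrum R // (N : R) ∉ m.asIdeal} :=
  Equiv.ofBijective
    (fun m => ⟨⟨m.1.asIdeal.comap (algebraMap R S),
      have := m.1.isMaximal
      Ideal.isMaximal_comap_of_isIntegral_of_isMaximal _⟩, by simpa using m.2⟩) <| by
  constructor
  · rintro ⟨P, hP⟩ ⟨Q, hQ⟩ h
    have h' : P.asIdeal.comap (algebraMap R S) = Q.asIdeal.comap (algebraMap R S) :=
      congrArg (fun m => m.1.asIdeal) h
    -- For `x ∈ P` the element `N * x` comes from `R`, hence lies in `Q`, while `N ∉ Q`.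
    -- Surjectivity below is lying over.
    have hle : P.asIdeal ≤ Q.asIdeal := by
      intro x hx
      obtain ⟨r, hr⟩ := hN x
      have : r ∈ Q.asIdeal.comap (algebraMap R S) := by
        rw [← h', Ideal.mem_comap, hr]
        exact P.asIdeal.mul_mem_left _ hx
      rw [Ideal.mem_comap, hr] at this
      exact (Q.isMaximal.isPrime.mem_or_mem this).resolve_left hQ
    exact Subtype.ext (MaximalSpectrum.ext (P.isMaximal.eq_of_le Q.isMaximal.ne_top hle))
  · rintro ⟨p, hp⟩
    have := p.isMaximal
    obtain ⟨Q, hQ, hQp⟩ := Ideal.exists_ideal_over_maximal_of_isIntegral (S := S) p.asIdeal (by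
      rw [(RingHom.injective_iff_ker_eq_bot _).1 (FaithfulSMul.algebraMap_injective R S)]
      exact bot_le)
    refine ⟨⟨⟨Q, hQ⟩, fun h => hp ?_⟩, Subtype.ext (MaximalSpectrum.ext hQp)⟩
    rw [← hQp]
    simpa using h

theorem card_quotient_maximalSpectrumAway [FaithfulSMul R S] [Algebra.IsIntegral R S]
    (hN : ∀ x : S, N * x ∈ (algebraMap R S).range)
    (m : {m : MaximalSpectrum S // (N : S) ∉ m.asIdeal}) :
    Nat.card (R ⧸ (maximalSpectrumAway hN m).1.asIdeal) = Nat.card (S ⧸ m.1.asIdeal) := by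
  have := m.1.isMaximal
  rw [← Nat.card_congr (RingHom.quotientKerEquivOfSurjective
    (mk_comp_algebraMap_surjective hN m.1.asIdeal m.2)).toEquiv]
  have : (maximalSpectrumAway hN m).1.asIdeal =
      RingHom.ker ((Ideal.Quotient.mk m.1.asIdeal).comp (algebraMap R S)) := by
    ext x
    exact (Ideal.Quotient.eq_zero_iff_mem (I := m.1.asIdeal)).symm
  rw [this]

theorem span_natCast_le_iff (P : Ideal S) : Ideal.span {(N : S)} ≤ P ↔ (N : S) ∈ P :=
  P.span_singleton_le_iff_mem


/-- The ideal `N S ∩ R` can exceed `N R`, but the two have the same radical: if `x = y * N`, then `x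
* x = N * (N * y * y)` with `N * y * y` in `R`. -/
theorem comap_span_natCast_le_iff [FaithfulSMul R S]
    (hN : ∀ x : S, N * x ∈ (algebraMap R S).range) (p : Ideal R)
    [p.IsPrime] :
    (Ideal.span {(N : S)}).comap (algebraMap R S) ≤ p ↔ (N : R) ∈ p := by
  constructor
  · intro h
    apply h
    rw [Ideal.mem_comap, map_natCast]
    exact Ideal.mem_span_singleton_self _
  · intro h x hx
    rw [Ideal.mem_comap, Ideal.mem_span_singleton'] at hx
    obtain ⟨y, hy⟩ := hx
    obtain ⟨r, hr⟩ := hN (y * y)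
    have hx2 : x * x = r * N := by
      apply FaithfulSMul.algebraMap_injective R S
      rw [map_mul, map_mul, hr, ← hy, map_natCast]
      ring
    have : x * x ∈ p := hx2 ▸ p.mul_mem_left _ h
    exact (Ideal.IsPrime.mem_or_mem ‹_› this).elim id id

end AwayFromConductor

/-! ### Picard groups of finite products. -/

section PicPi

open Submodule CommRing TensorProduct

/-- The natural map from `R' ⊗ I` to `π I` is a surjection of invertible modules, hence an
isomorphism. It is applied below to the projections of a product. -/
theorem mapAlgebra_unitsToPic {R R' S S' : Type*} [CommRing R] [CommRing R'] [CommRing S]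
    [CommRing S'] [Algebra R S] [Algebra R' S'] [Algebra R R'] [Algebra R S']
    [IsScalarTower R R' S'] [FaithfulSMul R S] [FaithfulSMul R' S']
    [RingHomSurjective (algebraMap R R')] (π : S →ₐ[R] S')
    (h : ∀ r, (π : S →+* S') (algebraMap R S r) = algebraMap R' S' (algebraMap R R' r))
    (I : (Submodule R S)ˣ) :
    Pic.mapAlgebra R R' (unitsToPic R S I) =
      unitsToPic R' S' (Units.map (submoduleMapHom (π : S →+* S') h) I) := by
  set I' := Units.map (submoduleMapHom (π : S →+* S') h) I with hI'
  have mem {x : S} (hx : x ∈ (I : Submodule R S)) : π x ∈ (I' : Submodule R' S') :=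
    mem_submoduleMapHom.2 ⟨x, hx, rfl⟩
  let g : (I : Submodule R S) →ₗ[R] (I' : Submodule R' S') :=
    { toFun := fun x => ⟨π x, mem x.2⟩
      map_add' := fun x y => Subtype.ext (map_add π _ _)
      map_smul' := fun r x => Subtype.ext (map_smul π _ _) }
  have hg : Function.Surjective (g.liftBaseChange R') := by
    rintro ⟨y, hy⟩
    obtain ⟨x, hx, rfl⟩ := mem_submoduleMapHom.1 hy
    refine ⟨1 ⊗ₜ ⟨x, hx⟩, ?_⟩
    rw [LinearMap.liftBaseChange_tmul, one_smul]
    rfl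
  exact Pic.mk_eq_mk_iff.2 ⟨(AlgebraTensorModule.congr (.refl R' R') (unitsToPicEquiv I)) ≪≫ₗ
    LinearEquiv.ofBijective _ (Module.Invertible.bijective_of_surjective hg)⟩

variable {ι : Type*} (R A : ι → Type*) [∀ i, CommRing (R i)] [∀ i, CommRing (A i)]
  [∀ i, Algebra (R i) (A i)]

instance ringHomSurjective_evalRingHom (i : ι) : RingHomSurjective (Pi.evalRingHom R i) :=
  ⟨Function.surjective_eval i⟩

/-- The component of a submodule of a product of algebras. -/
noncomputable def submoduleEvalHom (i : ι) :
    Submodule (∀ i, R i) (∀ i, A i) →* Submodule (R i) (A i) :=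
  submoduleMapHom (σ := Pi.evalRingHom R i) (Pi.evalRingHom A i) (fun _ => rfl)

variable {R A} in
theorem mem_submoduleEvalHom {i : ι} {I : Submodule (∀ i, R i) (∀ i, A i)} {y : A i} :
    y ∈ submoduleEvalHom R A i I ↔ ∃ x ∈ I, x i = y := Iff.rfl

variable {R A} in
theorem mem_iff_forall_mem_submoduleEvalHom [Finite ι]
    {I : Submodule (∀ i, R i) (∀ i, A i)} {x : ∀ i, A i} :
    x ∈ I ↔ ∀ i, x i ∈ submoduleEvalHom R A i I := by
  classical
  have := Fintype.ofFinite ι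
  refine ⟨fun h i => ⟨x, h, rfl⟩, fun h => ?_⟩
  choose y hy hyx using fun i => mem_submoduleEvalHom.1 (h i)
  -- The idempotents of the product cut out the `i`-th component of each witness `y i`.
  have : x = ∑ i, (Pi.single i 1 : ∀ i, R i) • y i := by
    ext j
    rw [Finset.sum_apply, Finset.sum_eq_single j]
    · simp [Algebra.smul_def, hyx]
    · intro i _ hij
      simp [Algebra.smul_def, Pi.single_eq_of_ne' hij]
    · simp
  rw [this]
  exact Submodule.sum_mem _ fun i _ => Submodule.smul_mem _ _ (hy i)

theorem units_submoduleEvalHom_surjective [Finite ι]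
    (I : ∀ i, (Submodule (R i) (A i))ˣ) :
    ∃ J : (Submodule (∀ i, R i) (∀ i, A i))ˣ, ∀ i, Units.map (submoduleEvalHom R A i) J = I i := by
  classical
  let P (I : ∀ i, Submodule (R i) (A i)) : Submodule (∀ i, R i) (∀ i, A i) :=
    { carrier := {x | ∀ i, x i ∈ I i}
      add_mem' := fun ha hb i => Submodule.add_mem _ (ha i) (hb i)
      zero_mem' := fun i => Submodule.zero_mem _
      smul_mem' := fun r x hx i => Submodule.smul_mem _ (r i) (hx i) }
  have hP (I : ∀ i, Submodule (R i) (A i)) (i : ι) : submoduleEvalHom R A i (P I) = I i := by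
    ext y
    rw [mem_submoduleEvalHom]
    refine ⟨fun ⟨x, hx, hxy⟩ => hxy ▸ hx i, fun hy => ⟨Pi.single i y, fun j => ?_, by simp⟩⟩
    by_cases hj : j = i
    · subst hj; simpa using hy
    · simp [Pi.single_eq_of_ne hj]
  have hmul (I I' : ∀ i, Submodule (R i) (A i)) (h : ∀ i, I i * I' i = 1) : P I * P I' = 1 := by
    ext x
    rw [mem_iff_forall_mem_submoduleEvalHom,
      mem_iff_forall_mem_submoduleEvalHom (I := (1 : Submodule (∀ i, R i) (∀ i, A i)))]
    refine forall_congr' fun i => ?_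
    rw [map_mul, hP, hP, h, map_one]
  exact ⟨⟨P fun i => I i, P fun i => ((I i)⁻¹ : (Submodule (R i) (A i))ˣ),
    hmul _ _ fun i => (I i).mul_inv, hmul _ _ fun i => (I i).inv_mul⟩,
    fun i => Units.ext (hP _ i)⟩

/-- All the Picard groups involved are quotients of groups of invertible submodules by principal
ones, and both of these decompose into components. -/
theorem card_pic_pi [∀ i, FaithfulSMul (R i) (A i)] [∀ i, Subsingleton (Pic (A i))]
    [Subsingleton (Pic (∀ i, A i))] [Fintype ι] :
    Nat.card (Pic (∀ i, R i)) = ∏ i, Nat.card (Pic (R i)) := by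
  have : FaithfulSMul (∀ i, R i) (∀ i, A i) := by
    rw [faithfulSMul_iff_algebraMap_injective]
    intro x y h
    ext i
    exact FaithfulSMul.algebraMap_injective (R i) (A i) (congrFun h i)
  have hcomm (i : ι) (I : (Submodule (∀ i, R i) (∀ i, A i))ˣ) :
      Pic.mapRingHom (Pi.evalRingHom R i) (unitsToPic _ _ I) =
        unitsToPic (R i) (A i) (Units.map (submoduleEvalHom R A i) I) := by
    let _ : Algebra (∀ i, R i) (R i) := (Pi.evalRingHom R i).toAlgebra
    let _ : Algebra (∀ i, R i) (A i) :=
      ((algebraMap (R i) (A i)).comp (Pi.evalRingHom R i)).toAlgebra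
    have : IsScalarTower (∀ i, R i) (R i) (A i) := .of_algebraMap_eq fun _ => rfl
    have : RingHomSurjective (algebraMap (∀ i, R i) (R i)) :=
      ringHomSurjective_evalRingHom R i
    exact mapAlgebra_unitsToPic (R := ∀ i, R i) (R' := R i) (S := ∀ i, A i) (S' := A i)
      ⟨Pi.evalRingHom A i, fun _ => rfl⟩ (fun _ => rfl) I
  have hsurj (i : ι) : Function.Surjective (unitsToPic (R i) (A i)) := by
    rw [← MonoidHom.range_eq_top, range_unitsToPic, relPic_eq_top]
  have hsurj' : Function.Surjective (unitsToPic (∀ i, R i) (∀ i, A i)) := by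
    rw [← MonoidHom.range_eq_top, range_unitsToPic, relPic_eq_top]
  let Φ : Pic (∀ i, R i) →* ∀ i, Pic (R i) :=
    MonoidHom.pi fun i => Pic.mapRingHom (Pi.evalRingHom R i)
  have hΦ : Function.Bijective Φ := by
    constructor
    · rw [injective_iff_map_eq_one]
      intro M hM
      obtain ⟨I, rfl⟩ := hsurj' M
      have h1 (i : ι) : ∃ u : (A i)ˣ,
          span (R i) {(u : A i)} = submoduleEvalHom R A i (I : Submodule _ _) := by
        have h2 : unitsToPic (R i) (A i) (Units.map (submoduleEvalHom R A i) I) = 1 := by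
          rw [← hcomm]; exact congrFun hM i
        rw [← MonoidHom.mem_ker, ker_unitsToPic] at h2
        obtain ⟨u, hu⟩ := h2
        exact ⟨u, congrArg Units.val hu⟩
      choose u hu using h1
      rw [← MonoidHom.mem_ker, ker_unitsToPic]
      refine ⟨MulEquiv.piUnits.symm u, Units.ext ?_⟩
      ext x
      rw [mem_iff_forall_mem_submoduleEvalHom (I := (I : Submodule (∀ i, R i) (∀ i, A i)))]
      simp_rw [← hu, mem_span_singleton]
      change x ∈ span _ {_} ↔ _
      rw [mem_span_singleton]
      constructor
      · rintro ⟨r, rfl⟩ i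
        exact ⟨r i, rfl⟩
      · intro h
        choose r hr using h
        exact ⟨r, funext hr⟩
    · intro M
      choose I hI using fun i => hsurj i (M i)
      obtain ⟨J, hJ⟩ := units_submoduleEvalHom_surjective R A I
      refine ⟨unitsToPic _ _ J, funext fun i => ?_⟩
      change Pic.mapRingHom (Pi.evalRingHom R i) _ = _
      rw [hcomm, hJ, hI]
  rw [Nat.card_congr (Equiv.ofBijective Φ hΦ), Nat.card_pi]

end PicPi

/-! ### Maximal ideals of finite products. -/

section MaximalSpectrumPi

variable {ι : Type*} [Finite ι] (R : ι → Type*) [∀ i, CommRing (R i)]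

/-- The maximal ideals of a finite product of rings. -/
noncomputable def maximalSpectrumPi :
    (Σ i, MaximalSpectrum (R i)) ≃ MaximalSpectrum (∀ i, R i) :=
  Equiv.ofBijective (fun p => ⟨p.2.asIdeal.comap (Pi.evalRingHom R p.1),
    have := p.2.isMaximal
    Ideal.comap_isMaximal_of_surjective _ (Function.surjective_eval p.1)⟩) <| by
  constructor
  · rintro ⟨i, p⟩ ⟨j, q⟩ h
    have hp := p.isMaximal.isPrime
    have hq := q.isMaximal.isPrime
    have h' : PrimeSpectrum.sigmaToPi R ⟨i, ⟨p.asIdeal, hp⟩⟩ =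
        PrimeSpectrum.sigmaToPi R ⟨j, ⟨q.asIdeal, hq⟩⟩ :=
      PrimeSpectrum.ext (congrArg MaximalSpectrum.asIdeal h)
    have h2 := PrimeSpectrum.sigmaToPi_injective R h'
    obtain ⟨rfl, h3⟩ := Sigma.mk.inj_iff.1 h2
    congr 1
    exact MaximalSpectrum.ext (congrArg PrimeSpectrum.asIdeal (eq_of_heq h3))
  · intro m
    obtain ⟨i, q, hq⟩ := PrimeSpectrum.exists_comap_evalRingHom_eq ⟨m.asIdeal, m.isMaximal.isPrime⟩
    have hq' : q.asIdeal.comap (Pi.evalRingHom R i) = m.asIdeal :=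
      congrArg PrimeSpectrum.asIdeal hq
    have hqm : q.asIdeal.IsMaximal := by
      have h1 : (q.asIdeal.comap (Pi.evalRingHom R i)).IsMaximal := hq' ▸ m.isMaximal
      have h2 := Ideal.map_comap_of_surjective (Pi.evalRingHom R i) (Function.surjective_eval i)
        q.asIdeal
      rw [← h2]
      refine (Ideal.map_eq_top_or_isMaximal_of_surjective _ (Function.surjective_eval i) h1
        ).resolve_left fun h => ?_
      rw [h2] at h
      exact q.2.ne_top h
    exact ⟨⟨i, ⟨q.asIdeal, hqm⟩⟩, MaximalSpectrum.ext hq'⟩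

theorem card_quotient_maximalSpectrumPi (p : Σ i, MaximalSpectrum (R i)) :
    Nat.card ((∀ i, R i) ⧸ (maximalSpectrumPi R p).asIdeal) =
      Nat.card (R p.1 ⧸ p.2.asIdeal) := by
  have hs : Function.Surjective
      ((Ideal.Quotient.mk p.2.asIdeal).comp (Pi.evalRingHom R p.1)) :=
    Ideal.Quotient.mk_surjective.comp (Function.surjective_eval p.1)
  rw [← Nat.card_congr (RingHom.quotientKerEquivOfSurjective hs).toEquiv]
  have : (maximalSpectrumPi R p).asIdeal =
      RingHom.ker ((Ideal.Quotient.mk p.2.asIdeal).comp (Pi.evalRingHom R p.1)) := by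
    ext x
    exact (Ideal.Quotient.eq_zero_iff_mem (I := p.2.asIdeal)).symm
  rw [this]

end MaximalSpectrumPi

/-! ### Discriminant and index of an order in the maximal order. -/

open NumberField Module

theorem det_blockDiagonal_sigma {ι : Type*} [Fintype ι] [LinearOrder ι] {R : Type*} [CommRing R]
    {κ : ι → Type*} [∀ i, Fintype (κ i)] [∀ i, DecidableEq (κ i)]
    (M : ∀ i, Matrix (κ i) (κ i) R) :
    (Matrix.blockDiagonal' M).det = ∏ i, (M i).det := by
  rw [(Matrix.blockTriangular_blockDiagonal' M).det_fintype]
  refine Finset.prod_congr rfl fun i _ => ?_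
  rw [← Matrix.det_submatrix_equiv_self (Equiv.sigmaSubtype i).symm]
  congr 1
  ext k l
  exact Matrix.blockDiagonal'_apply_eq M i k l

section TracePi

variable {ι : Type*} [Fintype ι] [LinearOrder ι] {F : Type*} [Field F] {A : ι → Type*}
  [∀ i, CommRing (A i)] [∀ i, Algebra F (A i)]

theorem trace_pi_single {κ : ι → Type*} [∀ i, Fintype (κ i)] [∀ i, DecidableEq (κ i)]
    (b : ∀ i, Basis (κ i) F (A i)) (i : ι) (x : A i) :
    Algebra.trace F (∀ i, A i) (Pi.single i x) = Algebra.trace F (A i) x := by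
  rw [Algebra.trace_eq_matrix_trace (Pi.basis b), Algebra.trace_eq_matrix_trace (b i),
    Matrix.trace, Matrix.trace, Fintype.sum_sigma, Finset.sum_eq_single i]
  · refine Finset.sum_congr rfl fun k _ => ?_
    simp [Matrix.diag, Algebra.leftMulMatrix_eq_repr_mul, Pi.basis_repr]
  · intro j _ hj
    refine Finset.sum_eq_zero fun k _ => ?_
    simp [Matrix.diag, Algebra.leftMulMatrix_eq_repr_mul, Pi.basis_repr,
      Pi.single_eq_of_ne hj]
  · simp

/-- Basis vectors from different factors have product zero, so the trace matrix is block diagonal.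
-/
theorem discr_pi_basis {κ : ι → Type*} [∀ i, Fintype (κ i)] [∀ i, DecidableEq (κ i)]
    (b : ∀ i, Basis (κ i) F (A i)) :
    Algebra.discr F (Pi.basis b) = ∏ i, Algebra.discr F (b i) := by
  have : Algebra.traceMatrix F (Pi.basis b) =
      Matrix.blockDiagonal' fun i => Algebra.traceMatrix F (b i) := by
    ext ⟨i, k⟩ ⟨j, l⟩
    rw [Algebra.traceMatrix_apply, Algebra.traceForm_apply, Pi.basis_apply, Pi.basis_apply,
      Matrix.blockDiagonal'_apply]
    split_ifs with h
    · obtain rfl : i = j := h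
      rw [← Pi.single_mul, trace_pi_single b]
      simp [Algebra.traceMatrix_apply, Algebra.traceForm_apply]
    · have h0 : (Pi.single i ((b i) k) * Pi.single j ((b j) l) : ∀ i, A i) = 0 := by
        ext t
        by_cases ht : t = i
        · subst ht
          simp [Pi.single_eq_of_ne h]
        · simp [Pi.single_eq_of_ne ht]
      simp only [h0, map_zero]
  rw [Algebra.discr_def, this, det_blockDiagonal_sigma]
  rfl

end TracePi

variable {m : ℕ} {K : Fin m → Type*} [∀ i, Field (K i)] [∀ i, NumberField (K i)]

/-- The inclusion of an order in the maximal order. -/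
noncomputable def toMaximalOrder (O : Subring (∀ i, K i)) [IsOrder O] : O →+* ∀ i, 𝓞 (K i) :=
  RingHom.pi fun i =>
    ((Pi.evalRingHom K i).comp O.subtype).codRestrict (integralClosure ℤ (K i)) fun x =>
      (Algebra.IsIntegral.isIntegral (R := ℤ) x).map
        ((Pi.evalRingHom K i).comp O.subtype).toIntAlgHom

variable (O : Subring (∀ i, K i)) [IsOrder O]

noncomputable instance : Algebra O (∀ i, 𝓞 (K i)) := (toMaximalOrder O).toAlgebra

instance : IsScalarTower O (∀ i, 𝓞 (K i)) (∀ i, K i) := .of_algebraMap_eq fun _ => rfl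

instance : FaithfulSMul O (∀ i, 𝓞 (K i)) := by
  rw [faithfulSMul_iff_algebraMap_injective]
  intro x y h
  ext i
  exact congrArg (fun z => ((z i : 𝓞 (K i)) : K i)) h

instance : FaithfulSMul (∀ i, 𝓞 (K i)) (∀ i, K i) := by
  rw [faithfulSMul_iff_algebraMap_injective]
  intro x y h
  ext i
  exact congrFun h i

instance : Algebra.IsIntegral O (∀ i, 𝓞 (K i)) :=
  have : Algebra.IsIntegral ℤ (∀ i, 𝓞 (K i)) := Algebra.IsIntegral.of_finite ..
  Algebra.IsIntegral.tower_top ℤ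

section Index

theorem exists_nat_mul_mem (x : ∀ i, K i) : ∃ n : ℕ, 0 < n ∧ n • x ∈ O := by
  have hx : x ∈ Submodule.span ℚ (O : Set (∀ i, K i)) := by
    rw [IsOrder.span_eq_top]; trivial
  induction hx using Submodule.span_induction with
  | mem x hx => exact ⟨1, one_pos, by simpa using hx⟩
  | zero => exact ⟨1, one_pos, by simp⟩
  | add x y _ _ hx hy =>
    obtain ⟨a, ha, hax⟩ := hx
    obtain ⟨b, hb, hby⟩ := hy
    refine ⟨a * b, Nat.mul_pos ha hb, ?_⟩
    rw [smul_add]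
    refine O.add_mem ?_ ?_
    · rw [mul_comm, mul_smul]; exact O.nsmul_mem hax b
    · rw [mul_smul]; exact O.nsmul_mem hby a
  | smul q x _ hx =>
    obtain ⟨a, ha, hax⟩ := hx
    refine ⟨q.den * a, Nat.mul_pos q.den_pos ha, ?_⟩
    have : (q.den * a) • q • x = q.num • (a • x) := by
      rw [mul_comm, mul_smul, ← Nat.cast_smul_eq_nsmul ℚ q.den, smul_smul, Rat.den_mul_eq_num,
        Int.cast_smul_eq_zsmul, smul_comm]
    rw [this]
    exact O.zsmul_mem hax _

theorem mem_range_algebraMap_iff (x : ∀ i, 𝓞 (K i)) :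
    x ∈ (algebraMap O (∀ i, 𝓞 (K i))).range ↔ algebraMap _ (∀ i, K i) x ∈ O := by
  constructor
  · rintro ⟨y, rfl⟩
    exact y.2
  · intro h
    exact ⟨⟨_, h⟩, rfl⟩

-- The maximal order is finitely generated over `ℤ`; the product of denominators of the generators
-- works.
open scoped Classical in
theorem exists_conductor : ∃ N : ℕ, 0 < N ∧
    ∀ x : ∀ i, 𝓞 (K i), N * x ∈ (algebraMap O (∀ i, 𝓞 (K i))).range := by
  obtain ⟨T, hT⟩ := (Module.Finite.fg_top : (⊤ : Submodule ℤ (∀ i, 𝓞 (K i))).FG)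
  choose n hn hnO using fun x : ∀ i, 𝓞 (K i) => exists_nat_mul_mem O (algebraMap _ (∀ i, K i) x)
  refine ⟨∏ t ∈ T, n t, Finset.prod_pos fun t _ => hn t, fun x => ?_⟩
  have hx : x ∈ Submodule.span ℤ (T : Set (∀ i, 𝓞 (K i))) := by rw [hT]; trivial
  rw [← nsmul_eq_mul]
  induction hx using Submodule.span_induction with
  | mem x hx =>
    rw [← Finset.prod_erase_mul T n hx, mul_smul]
    refine nsmul_mem ?_ _
    rw [mem_range_algebraMap_iff, map_nsmul]
    exact hnO x
  | zero => rw [smul_zero]; exact Subring.zero_mem _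
  | add x y _ _ hx hy => rw [smul_add]; exact Subring.add_mem _ hx hy
  | smul z x _ hx => rw [smul_comm]; exact Subring.zsmul_mem _ hx z

/-- A `ℤ`-basis of an order is a `ℚ`-basis of the algebra. -/
noncomputable def ratBasis : Basis (Module.Free.ChooseBasisIndex ℤ O) ℚ (∀ i, K i) :=
  Basis.mk (v := fun j => ((Module.Free.chooseBasis ℤ O j : O) : ∀ i, K i))
    (by
      rw [← LinearIndependent.iff_fractionRing ℤ ℚ]
      exact (Module.Free.chooseBasis ℤ O).linearIndependent.map' (O.subtype.toIntAlgHom.toLinearMap)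
        (LinearMap.ker_eq_bot.2 Subtype.val_injective))
    (by
      rw [← IsOrder.span_eq_top (O := O), Submodule.span_le]
      intro x hx
      have h := (Module.Free.chooseBasis ℤ O).sum_repr ⟨x, hx⟩
      have h' := congrArg Subtype.val h
      rw [show x = _ from h'.symm, AddSubmonoidClass.coe_finsetSum]
      refine Submodule.sum_mem _ fun j _ => ?_
      rw [show (((Module.Free.chooseBasis ℤ O).repr ⟨x, hx⟩ j • Module.Free.chooseBasis ℤ O j : O) :
        ∀ i, K i) = ((Module.Free.chooseBasis ℤ O).repr ⟨x, hx⟩ j : ℚ) •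
          ((Module.Free.chooseBasis ℤ O j : O) : ∀ i, K i) by
        rw [Int.cast_smul_eq_zsmul]; rfl]
      exact Submodule.smul_mem _ _ (Submodule.subset_span ⟨j, rfl⟩))

theorem ratBasis_apply (j : Module.Free.ChooseBasisIndex ℤ O) :
    ratBasis O j = ((Module.Free.chooseBasis ℤ O j : O) : ∀ i, K i) := by
  simp [ratBasis]

theorem toAddSubgroup_eq_closure : O.toAddSubgroup = .closure (Set.range (ratBasis O)) := by
  have h := (Module.Free.chooseBasis ℤ O).span_eq
  have h2 : Set.range (ratBasis O) = (O.subtype : O →+ ∀ i, K i) ''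
      Set.range (Module.Free.chooseBasis ℤ O) := by
    rw [← Set.range_comp]
    congr 1
    ext1 j
    exact ratBasis_apply O j
  rw [h2, ← AddMonoidHom.map_closure, ← Submodule.span_int_eq_addSubgroupClosure, h]
  ext x
  exact ⟨fun hx => ⟨⟨x, hx⟩, trivial, rfl⟩, fun ⟨y, _, hy⟩ => hy ▸ y.2⟩

variable (K) in
/-- The product of the integral bases. -/
noncomputable def maximalBasis :
    Basis (Σ i, Module.Free.ChooseBasisIndex ℤ (𝓞 (K i))) ℚ (∀ i, K i) :=
  Pi.basis fun i => integralBasis (K i)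

variable (K) in
theorem range_algebraMap_eq_closure :
    (algebraMap (∀ i, 𝓞 (K i)) (∀ i, K i) : (∀ i, 𝓞 (K i)) →+ ∀ i, K i).range =
      .closure (Set.range (maximalBasis K)) := by
  let b : Basis (Σ i, Module.Free.ChooseBasisIndex ℤ (𝓞 (K i))) ℤ (∀ i, 𝓞 (K i)) :=
    Pi.basis fun i => RingOfIntegers.basis (K i)
  have h2 : Set.range (maximalBasis K) =
      (algebraMap (∀ i, 𝓞 (K i)) (∀ i, K i) : (∀ i, 𝓞 (K i)) →+ ∀ i, K i) '' Set.range b := by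
    rw [← Set.range_comp]
    congr 1
    ext1 ⟨i, k⟩
    ext j
    rw [maximalBasis, Pi.basis_apply, Function.comp_apply, Pi.basis_apply]
    change _ = algebraMap (𝓞 (K j)) (K j) (Pi.single (M := fun i => 𝓞 (K i)) i _ j)
    by_cases hj : j = i
    · subst hj
      simp [integralBasis_apply]
    · simp [Pi.single_eq_of_ne hj]
  rw [h2, ← AddMonoidHom.map_closure, ← Submodule.span_int_eq_addSubgroupClosure, b.span_eq]
  ext x
  exact ⟨fun ⟨y, hy⟩ => ⟨y, trivial, hy⟩, fun ⟨y, _, hy⟩ => ⟨y, hy⟩⟩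

/-- The index is the absolute value of the determinant of the base change, and the discriminant is
multiplied by the square of that determinant. -/
theorem abs_disc_eq : |disc O| = ((algebraMap O (∀ i, 𝓞 (K i))).range.toAddSubgroup.index : ℚ) ^ 2 *
    ∏ i, |(discr (K i) : ℚ)| := by
  classical
  let e := (ratBasis O).indexEquiv (maximalBasis K)
  let b₂ := (maximalBasis K).reindex e.symm
  have h1 := AddSubgroup.relIndex_eq_abs_det O.toAddSubgroup
    (algebraMap (∀ i, 𝓞 (K i)) (∀ i, K i) : (∀ i, 𝓞 (K i)) →+ ∀ i, K i).range
    (fun x hx => ⟨algebraMap O _ ⟨x, hx⟩, rfl⟩) (ratBasis O) b₂ (toAddSubgroup_eq_closure O)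
    (by rw [range_algebraMap_eq_closure, Basis.range_reindex])
  have h2 : O.toAddSubgroup.relIndex
      (algebraMap (∀ i, 𝓞 (K i)) (∀ i, K i) : (∀ i, 𝓞 (K i)) →+ ∀ i, K i).range =
      (algebraMap O (∀ i, 𝓞 (K i))).range.toAddSubgroup.index := by
    rw [← AddSubgroup.index_comap]
    congr 1
    ext x
    exact (mem_range_algebraMap_iff O x).symm
  have h3 : disc O = b₂.det (ratBasis O) ^ 2 * ∏ i, (discr (K i) : ℚ) := by
    have h4 : Algebra.discr ℚ b₂ = ∏ i, (discr (K i) : ℚ) := by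
      simp_rw [coe_discr]
      rw [← discr_pi_basis, Basis.coe_reindex, Equiv.symm_symm]
      exact Algebra.discr_reindex ℚ (maximalBasis K) e.symm
    rw [← h4, Basis.det_apply, ← Algebra.discr_of_matrix_vecMul, Basis.toMatrix_map_vecMul, disc]
    congr 1
    ext1 j
    exact (ratBasis_apply O j).symm
  rw [h3, abs_mul, Finset.abs_prod, abs_pow, ← h1, h2]

end Index

/-! ### Regulators, roots of unity and the unit index. -/

open NumberField Module NumberField.Units.dirichletUnitTheorem

/-- The first index equals `[G : H + ker f]`, and `[H + ker f : H] = [ker f : H ∩ ker f]`. For the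
logarithmic embedding of units this links regulators, unit index and roots of unity. -/
theorem relIndex_map_mul_card_ker {G G' : Type*} [AddCommGroup G] [AddCommGroup G']
    (H : AddSubgroup G) (f : G →+ G') :
    (H.map f).relIndex f.range * Nat.card f.ker = H.index * Nat.card (H.addSubgroupOf f.ker) := by
  have h1 : (H.map f).relIndex f.range = (H ⊔ f.ker).index := by
    rw [AddMonoidHom.range_eq_map, AddSubgroup.relIndex_map_map, top_sup_eq,
      AddSubgroup.relIndex_top_right]
  have h2 := AddSubgroup.relIndex_mul_index (le_sup_left : H ≤ H ⊔ f.ker)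
  rw [AddSubgroup.relIndex_sup_left] at h2
  have h3 := (H.addSubgroupOf f.ker).card_mul_index
  rw [h1, ← h3, ← h2, AddSubgroup.relIndex]
  ring

section ProductLattice

variable {m : ℕ} (K : Fin m → Type*) [∀ i, Field (K i)] [∀ i, NumberField (K i)]

open scoped Classical in
/-- The product of the bases of the unit lattices of the factors. -/
noncomputable def unitBasis : Basis (LogIndex K) ℝ (LogIndex K → ℝ) :=
  (Pi.basis fun i => ((Units.basisUnitLattice (K i)).reindex
    (Units.equivFinRank (K i))).ofZLatticeBasis ℝ (Units.unitLattice (K i))).map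
      (LinearEquiv.piCurry ℝ fun i (_ : {w : InfinitePlace (K i) // w ≠ w₀}) => ℝ).symm

open scoped Classical in
theorem unitBasis_apply (j k : LogIndex K) :
    unitBasis K j k = Matrix.blockDiagonal' (fun i => Matrix.of
      fun w => (((Units.basisUnitLattice (K i)).reindex (Units.equivFinRank (K i)) w :
        Units.unitLattice (K i)) : logSpace (K i))) j k := by
  obtain ⟨i, w⟩ := j
  obtain ⟨i', w'⟩ := k
  rw [unitBasis, Basis.map_apply, Pi.basis_apply, Basis.ofZLatticeBasis_apply,
    Matrix.blockDiagonal'_apply]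
  change Pi.single (M := fun i => logSpace (K i)) i _ i' w' = _
  split_ifs with h
  · obtain rfl : i = i' := h
    simp
  · have : i' ≠ i := fun h' => h h'.symm
    simp [Pi.single_eq_of_ne this]

open scoped Classical in
theorem covolume_span_unitBasis :
    ZLattice.covolume (Submodule.span ℤ (Set.range (unitBasis K))) =
      ∏ i, Units.regulator (K i) := by
  rw [ZLattice.covolume_eq_det _ ((unitBasis K).restrictScalars ℤ)]
  have : Matrix.of (((↑) : Submodule.span ℤ (Set.range (unitBasis K)) → LogIndex K → ℝ) ∘
      ((unitBasis K).restrictScalars ℤ)) =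
      Matrix.blockDiagonal' (fun i => Matrix.of
      fun w => (((Units.basisUnitLattice (K i)).reindex (Units.equivFinRank (K i)) w :
        Units.unitLattice (K i)) : logSpace (K i))) := by
    ext j k
    rw [← unitBasis_apply, Matrix.of_apply, Function.comp_apply, Basis.restrictScalars_apply]
  rw [this, det_blockDiagonal_sigma, Finset.abs_prod]
  refine Finset.prod_congr rfl fun i _ => ?_
  rw [Units.regulator, ZLattice.covolume_eq_det _
    ((Units.basisUnitLattice (K i)).reindex (Units.equivFinRank (K i)))]
  rfl

open scoped Classical in
theorem mem_span_unitBasis_iff (x : LogIndex K → ℝ) :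
    x ∈ Submodule.span ℤ (Set.range (unitBasis K)) ↔
      ∀ i, (fun w => x ⟨i, w⟩) ∈ Units.unitLattice (K i) := by
  rw [Basis.mem_span_iff_repr_mem]
  have h (i : Fin m) := Basis.ofZLatticeBasis_span ℝ (Units.unitLattice (K i))
    ((Units.basisUnitLattice (K i)).reindex (Units.equivFinRank (K i)))
  have h2 (i : Fin m) : (fun w => x ⟨i, w⟩) ∈ Units.unitLattice (K i) ↔
      ∀ w, (((Units.basisUnitLattice (K i)).reindex (Units.equivFinRank (K i))).ofZLatticeBasis ℝ
        (Units.unitLattice (K i))).repr (fun w => x ⟨i, w⟩) w ∈ Set.range (algebraMap ℤ ℝ) := by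
    rw [← Basis.mem_span_iff_repr_mem, h]
  simp_rw [h2]
  rw [Sigma.forall]
  refine forall_congr' fun i => forall_congr' fun w => ?_
  rw [unitBasis, Basis.map_repr, LinearEquiv.trans_apply, LinearEquiv.symm_symm, Pi.basis_repr]
  rfl

/-- The logarithmic embedding of the units of the maximal order. -/
noncomputable def maximalLogEmbedding :
    Additive (∀ i, 𝓞 (K i))ˣ →+ (LogIndex K → ℝ) where
  toFun u := fun j => Units.logEmbedding (K j.1)
    (Additive.ofMul (MulEquiv.piUnits (Additive.toMul u) j.1)) j.2
  map_zero' := by ext; simp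
  map_add' u v := by
    ext j
    simp only [toMul_add, map_mul, Pi.mul_apply, ofMul_mul, map_add, Pi.add_apply]

theorem range_maximalLogEmbedding :
    (maximalLogEmbedding K).range =
      (Submodule.span ℤ (Set.range (unitBasis K))).toAddSubgroup := by
  ext x
  rw [Submodule.mem_toAddSubgroup, mem_span_unitBasis_iff]
  constructor
  · rintro ⟨u, rfl⟩ i
    exact ⟨Additive.ofMul (MulEquiv.piUnits (Additive.toMul u) i), trivial, rfl⟩
  · intro h
    choose u _ hu using h
    refine ⟨Additive.ofMul (MulEquiv.piUnits.symm fun i => (u i).toMul), ?_⟩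
    ext ⟨i, w⟩
    exact congrFun (hu i) w

theorem mem_ker_maximalLogEmbedding (u : Additive (∀ i, 𝓞 (K i))ˣ) :
    u ∈ (maximalLogEmbedding K).ker ↔
      ∀ i, MulEquiv.piUnits (Additive.toMul u) i ∈ Units.torsion (K i) := by
  rw [AddMonoidHom.mem_ker]
  simp_rw [← logEmbedding_eq_zero_iff]
  constructor
  · intro h i
    ext w
    exact congrFun h ⟨i, w⟩
  · intro h
    ext ⟨i, w⟩
    exact congrFun (h i) w

theorem card_ker_maximalLogEmbedding :
    Nat.card (maximalLogEmbedding K).ker = ∏ i, Units.torsionOrder (K i) := by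
  let e : (maximalLogEmbedding K).ker ≃ ∀ i, Units.torsion (K i) :=
    { toFun := fun u i => ⟨_, (mem_ker_maximalLogEmbedding K u.1).1 u.2 i⟩
      invFun := fun t => ⟨Additive.ofMul (MulEquiv.piUnits.symm fun i => t i),
        (mem_ker_maximalLogEmbedding K _).2 fun i => by simp⟩
      left_inv := fun u => by ext; simp
      right_inv := fun t => by ext; simp }
  rw [Nat.card_congr e, Nat.card_pi]
  rfl

theorem mem_ker_maximalLogEmbedding_iff_isOfFinOrder (u : (∀ i, 𝓞 (K i))ˣ) :
    Additive.ofMul u ∈ (maximalLogEmbedding K).ker ↔ IsOfFinOrder u := by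
  rw [mem_ker_maximalLogEmbedding]
  constructor
  · intro h
    rw [isOfFinOrder_iff_pow_eq_one]
    choose n hn hn' using fun i => isOfFinOrder_iff_pow_eq_one.1 (h i)
    refine ⟨∏ i, n i, Finset.prod_pos fun i _ => hn i, ?_⟩
    apply MulEquiv.piUnits.injective
    ext1 i
    rw [map_pow, map_one, Pi.pow_apply, ← Finset.prod_erase_mul Finset.univ n (Finset.mem_univ i),
      pow_mul']
    have := hn' i
    simp only [toMul_ofMul] at this
    rw [this, one_pow, Pi.one_apply]
  · intro h i
    exact MonoidHom.isOfFinOrder (Units.map (Pi.evalMonoidHom (fun i => 𝓞 (K i)) i)) h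

end ProductLattice

section Regulator

variable {m : ℕ} {K : Fin m → Type*} [∀ i, Field (K i)] [∀ i, NumberField (K i)]
  (O : Subring (∀ i, K i)) [IsOrder O]

/-- The units of an order as a subgroup of the units of the maximal order. -/
noncomputable def orderUnits : Subgroup (∀ i, 𝓞 (K i))ˣ :=
  (Units.map (algebraMap O (∀ i, 𝓞 (K i)) : O →* ∀ i, 𝓞 (K i))).range

theorem unitLattice_toAddSubgroup :
    (unitLattice O).toAddSubgroup =
      (Subgroup.toAddSubgroup (orderUnits O)).map (maximalLogEmbedding K) := by
  ext x
  constructor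
  · rintro ⟨u, _, rfl⟩
    exact ⟨Additive.ofMul (Units.map (algebraMap O (∀ i, 𝓞 (K i)) : O →* ∀ i, 𝓞 (K i)) u.toMul),
      ⟨u.toMul, rfl⟩, rfl⟩
  · rintro ⟨_, ⟨u, rfl⟩, rfl⟩
    exact ⟨Additive.ofMul u, trivial, rfl⟩

/-- The kernel of the logarithmic embedding consists of the units of finite order, and finite order
can be tested in the subgroup. -/
theorem card_addSubgroupOf_ker :
    Nat.card ((Subgroup.toAddSubgroup (orderUnits O)).addSubgroupOf (maximalLogEmbedding K).ker) =
      torsionOrder O := by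
  let φ := Units.map (algebraMap O (∀ i, 𝓞 (K i)) : O →* ∀ i, 𝓞 (K i))
  have hφ : Function.Injective φ :=
    Units.map_injective (FaithfulSMul.algebraMap_injective O (∀ i, 𝓞 (K i)))
  have hT (u : Oˣ) : Additive.ofMul (φ u) ∈ (maximalLogEmbedding K).ker ↔
      u ∈ CommGroup.torsion Oˣ := by
    rw [mem_ker_maximalLogEmbedding_iff_isOfFinOrder, CommGroup.mem_torsion,
      hφ.isOfFinOrder_iff]
  refine (Nat.card_congr (Equiv.ofBijective
    (fun u : CommGroup.torsion Oˣ => ⟨⟨Additive.ofMul (φ u), (hT u).2 u.2⟩, ⟨u, rfl⟩⟩) ?_)).symm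
  constructor
  · intro u v h
    exact Subtype.ext (hφ (congrArg (fun x => Additive.toMul x.1.1) h))
  · rintro ⟨⟨x, hx⟩, ⟨u, hu⟩⟩
    have hu' : Additive.ofMul (φ u) = x := hu
    exact ⟨⟨u, (hT u).1 (hu' ▸ hx)⟩, Subtype.ext (Subtype.ext hu')⟩

theorem unitLattice_le :
    unitLattice O ≤ Submodule.span ℤ (Set.range (unitBasis K)) := by
  intro x hx
  have h : x ∈ (unitLattice O).toAddSubgroup := hx
  rw [unitLattice_toAddSubgroup] at h
  obtain ⟨u, _, rfl⟩ := h
  have : maximalLogEmbedding K u ∈ (maximalLogEmbedding K).range := ⟨u, rfl⟩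
  rwa [range_maximalLogEmbedding] at this

/-- The regulator of an order in terms of the regulators of the factors. -/
theorem regulator_mul_torsionOrder (hO : (orderUnits O).index ≠ 0) :
    regulator O * ∏ i, (Units.torsionOrder (K i) : ℝ) =
      (∏ i, Units.regulator (K i)) * (orderUnits O).index * torsionOrder O := by
  classical
  have hle := unitLattice_le O
  have hd : DiscreteTopology (unitLattice O) := by
    rw [← SetLike.isDiscrete_iff_discreteTopology]
    exact (inferInstance : DiscreteTopology
      (Submodule.span ℤ (Set.range (unitBasis K)))).isDiscrete.mono hle
  -- The finite unit index multiplies each vector of `unitBasis` into the lattice of `O`, which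
  -- therefore spans.
  have hz : IsZLattice ℝ (unitLattice O) := by
    refine ⟨?_⟩
    rw [eq_top_iff, ← (unitBasis K).span_eq, Submodule.span_le]
    rintro _ ⟨j, rfl⟩
    have h1 : unitBasis K j ∈ (maximalLogEmbedding K).range := by
      rw [range_maximalLogEmbedding]
      exact Submodule.subset_span ⟨j, rfl⟩
    obtain ⟨u, hu⟩ := h1
    have h2 : (orderUnits O).index • unitBasis K j ∈ unitLattice O := by
      rw [← Submodule.mem_toAddSubgroup, unitLattice_toAddSubgroup, ← hu, ← map_nsmul]
      exact ⟨_, (orderUnits O).pow_index_mem u.toMul, rfl⟩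
    have h3 := Submodule.smul_mem _ ((orderUnits O).index : ℝ)⁻¹
      (Submodule.subset_span (R := ℝ) h2)
    rwa [← Nat.cast_smul_eq_nsmul ℝ, smul_smul, inv_mul_cancel₀ (by exact_mod_cast hO),
      one_smul] at h3
  have h1 := ZLattice.covolume_div_covolume_eq_relIndex _ _ hle
  rw [unitLattice_toAddSubgroup, ← range_maximalLogEmbedding, covolume_span_unitBasis] at h1
  have h2 := relIndex_map_mul_card_ker (Subgroup.toAddSubgroup (orderUnits O))
    (maximalLogEmbedding K)
  rw [card_ker_maximalLogEmbedding, card_addSubgroupOf_ker, Subgroup.index_toAddSubgroup] at h2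
  have h3 : (∏ i, Units.regulator (K i)) ≠ 0 :=
    Finset.prod_ne_zero_iff.2 fun i _ => Units.regulator_ne_zero (K i)
  rw [div_eq_iff h3] at h1
  have h4 : regulator O = _ := h1
  rw [h4, mul_assoc (∏ i, Units.regulator (K i))]
  have h5 := congrArg (Nat.cast : ℕ → ℝ) h2
  push_cast at h5
  rw [← h5]
  ring

end Regulator

/-! ### The Euler product of the Dedekind zeta function. -/

section EulerProduct

/-- A sieve: let `S T` be the sum of `h` over the elements divisible by no `p i` with `i ∈ T`.
Removing the multiples of a new prime multiplies it by `1 - h (p j)`, and `S T` tends to `h 1 = 1`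
as `T` grows, by dominated convergence. Unique factorization is not needed. -/
theorem hasProd_one_sub_inv {M ι : Type*} [CommMonoid M] [IsLeftCancelMul M] (p : ι → M)
    (hp : ∀ i a b, p i ∣ a * b → p i ∣ a ∨ p i ∣ b) (hpq : ∀ i j, p i ∣ p j → i = j)
    (hp1 : ∀ i, ¬ p i ∣ 1) (hex : ∀ a, a ≠ 1 → ∃ i, p i ∣ a) (h : M →* ℂ)
    (hs : Summable fun a => ‖h a‖) (hlt : ∀ i, ‖h (p i)‖ < 1) :
    HasProd (fun i => (1 - h (p i))⁻¹) (∑' a, h a) := by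
  classical
  let C (T : Finset ι) : Set M := {a | ∀ i ∈ T, ¬ p i ∣ a}
  let S (T : Finset ι) : ℂ := ∑' a, (C T).indicator h a
  have hsum (A : Set M) : Summable (A.indicator h) := hs.of_norm.indicator A
  have hstep (T : Finset ι) (j : ι) (hj : j ∉ T) : S (insert j T) = (1 - h (p j)) * S T := by
    have h1 : S T = S (insert j T) + ∑' a, (C T ∩ {a | p j ∣ a}).indicator h a := by
      rw [← (hsum _).tsum_add (hsum _)]
      refine tsum_congr fun a => ?_
      by_cases ha : p j ∣ a <;> by_cases hT : ∀ i ∈ T, ¬ p i ∣ a <;>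
        simp [C, Set.indicator, ha, hT]
    have h2 : ∑' a, (C T ∩ {a | p j ∣ a}).indicator h a = h (p j) * S T := by
      have hinj : Function.Injective fun b => p j * b := fun a b hab => mul_left_cancel hab
      rw [← tsum_mul_left, ← hinj.tsum_eq]
      · refine tsum_congr fun b => ?_
        have : p j * b ∈ C T ↔ b ∈ C T := by
          refine forall₂_congr fun i hi => not_congr ⟨fun hd => ?_, fun hd => hd.mul_left _⟩
          refine (hp _ _ _ hd).resolve_left fun hij => hj ?_
          rwa [← hpq _ _ hij]
        by_cases hb : b ∈ C T
        · rw [Set.indicator_of_mem hb, Set.indicator_of_mem (show p j * b ∈ C T ∩ {a | p j ∣ a} from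
            ⟨this.2 hb, dvd_mul_right _ _⟩), map_mul]
        · rw [Set.indicator_of_notMem hb, Set.indicator_of_notMem fun hm => hb (this.1 hm.1),
            mul_zero]
      · intro a ha
        obtain ⟨b, rfl⟩ := (Set.mem_of_indicator_ne_zero ha).2
        exact ⟨b, rfl⟩
    rw [h2] at h1
    linear_combination -h1
  have hS (T : Finset ι) : S T = (∏ i ∈ T, (1 - h (p i))) * ∑' a, h a := by
    induction T using Finset.induction_on with
    | empty => simp [S, C]
    | insert j T hj ih => rw [hstep T j hj, ih, Finset.prod_insert hj, mul_assoc]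
  have hlim : Tendsto S atTop (𝓝 1) := by
    have h1 : ∑' a, ({1} : Set M).indicator h a = 1 := by
      rw [tsum_eq_single 1 (fun a ha => Set.indicator_of_notMem (by simpa using ha) _)]
      simp
    rw [← h1]
    refine tendsto_tsum_of_dominated_convergence hs (fun a => ?_)
      (Eventually.of_forall fun T a => norm_indicator_le_norm_self _ _)
    refine tendsto_const_nhds.congr' ?_
    by_cases ha : a = 1
    · subst ha
      refine Eventually.of_forall fun T => ?_
      beta_reduce
      rw [Set.indicator_of_mem (by simp), Set.indicator_of_mem (show 1 ∈ C T from fun i _ => hp1 i)]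
    · obtain ⟨i, hi⟩ := hex a ha
      filter_upwards [eventually_ge_atTop {i}] with T hT
      rw [Set.indicator_of_notMem (by simpa using ha),
        Set.indicator_of_notMem fun (hm : a ∈ C T) => hm i (hT (by simp)) hi]
  have h2 : Tendsto (fun T => (∑' a, h a) / S T) atTop (𝓝 (∑' a, h a)) := by
    simpa [Pi.div_def] using (tendsto_const_nhds (x := ∑' a, h a)).div hlim one_ne_zero
  rw [HasProd, SummationFilter.unconditional_filter]
  refine h2.congr' ?_
  filter_upwards [hlim.eventually_ne one_ne_zero] with T hT
  have h3 : ∏ i ∈ T, (1 - h (p i)) ≠ 0 := Finset.prod_ne_zero_iff.2 fun i _ h0 => by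
    have := hlt i
    rw [← sub_eq_zero.1 h0, norm_one] at this
    exact lt_irrefl _ this
  rw [div_eq_iff hT, hS, Finset.prod_inv_distrib, inv_mul_cancel_left₀ h3]

open nonZeroDivisors NumberField

variable (K : Type*) [Field K] [NumberField K]

/-- The norm of a nonzero ideal to the power `-s`. -/
noncomputable def absNormCpow (s : ℂ) : (Ideal (𝓞 K))⁰ →* ℂ where
  toFun I := (Ideal.absNorm (I : Ideal (𝓞 K)) : ℂ) ^ (-s)
  map_one' := by simp
  map_mul' I J := by
    rw [Submonoid.coe_mul, map_mul, Nat.cast_mul, Complex.natCast_mul_natCast_cpow]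

theorem absNormCpow_apply (s : ℂ) (I : (Ideal (𝓞 K))⁰) :
    absNormCpow K s I = (Ideal.absNorm (I : Ideal (𝓞 K)) : ℂ) ^ (-s) := rfl

theorem absNorm_pos_of_nonZeroDivisors (I : (Ideal (𝓞 K))⁰) :
    0 < Ideal.absNorm (I : Ideal (𝓞 K)) :=
  Ideal.absNorm_pos_iff_mem_nonZeroDivisors.2 I.2

theorem norm_absNormCpow (s : ℂ) (I : (Ideal (𝓞 K))⁰) :
    ‖absNormCpow K s I‖ = (Ideal.absNorm (I : Ideal (𝓞 K)) : ℝ) ^ (-s.re) := by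
  rw [absNormCpow_apply, Complex.norm_natCast_cpow_of_pos (absNorm_pos_of_nonZeroDivisors K I),
    Complex.neg_re]

theorem hasProd_eulerFactor {s : ℂ} (hs : 0 < s.re)
    (hsum : Summable fun I : (Ideal (𝓞 K))⁰ => ‖absNormCpow K s I‖) :
    HasProd (eulerFactor (𝓞 K) s) (∑' I, absNormCpow K s I) := by
  have hbot (m : MaximalSpectrum (𝓞 K)) : m.asIdeal ≠ ⊥ := by
    have := m.isMaximal
    exact Ring.ne_bot_of_isMaximal_of_not_isField this (RingOfIntegers.not_isField K)
  let p (m : MaximalSpectrum (𝓞 K)) : (Ideal (𝓞 K))⁰ :=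
    ⟨m.asIdeal, mem_nonZeroDivisors_of_ne_zero (hbot m)⟩
  have hdvd (I J : (Ideal (𝓞 K))⁰) : I ∣ J ↔ (J : Ideal (𝓞 K)) ≤ I := by
    rw [← Ideal.dvd_iff_le]
    constructor
    · rintro ⟨L, rfl⟩
      exact ⟨L, rfl⟩
    · rintro ⟨L, hL⟩
      refine ⟨⟨L, mem_nonZeroDivisors_of_ne_zero fun h0 => ?_⟩, Subtype.ext hL⟩
      rw [h0, mul_zero] at hL
      exact nonZeroDivisors.coe_ne_zero J hL
  refine hasProd_one_sub_inv p ?_ ?_ ?_ ?_ (absNormCpow K s) hsum ?_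
  · intro m I J h
    simp only [hdvd] at h ⊢
    exact m.isMaximal.isPrime.mul_le.1 h
  · intro m n h
    rw [hdvd] at h
    exact MaximalSpectrum.ext (n.isMaximal.eq_of_le m.isMaximal.ne_top h).symm
  · intro m h
    rw [hdvd] at h
    exact m.isMaximal.ne_top (top_le_iff.1 (by simpa [Ideal.one_eq_top] using h))
  · intro I hI
    have : (I : Ideal (𝓞 K)) ≠ ⊤ := fun h => hI (Subtype.ext (by simpa [Ideal.one_eq_top] using h))
    obtain ⟨M, hM, hIM⟩ := Ideal.exists_le_maximal _ this
    exact ⟨⟨M, hM⟩, (hdvd _ _).2 hIM⟩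
  · intro m
    rw [norm_absNormCpow]
    refine Real.rpow_lt_one_of_one_lt_of_neg ?_ (by linarith)
    have h1 := absNorm_pos_of_nonZeroDivisors K (p m)
    have h2 : Ideal.absNorm (p m : Ideal (𝓞 K)) ≠ 1 := fun h =>
      m.isMaximal.ne_top (Ideal.absNorm_eq_one_iff.1 h)
    exact_mod_cast (by omega : 1 < Ideal.absNorm (p m : Ideal (𝓞 K)))

theorem dedekindZeta_eq_tsum {s : ℂ}
    (hsum : Summable fun I : (Ideal (𝓞 K))⁰ => ‖absNormCpow K s I‖) :
    dedekindZeta K s = ∑' I, absNormCpow K s I := by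
  let f (I : (Ideal (𝓞 K))⁰) : ℕ := Ideal.absNorm (I : Ideal (𝓞 K))
  have h1 := (Equiv.sigmaFiberEquiv f).tsum_eq (absNormCpow K s)
  have h2 : Summable fun x : Σ n, {I // f I = n} =>
      absNormCpow K s (Equiv.sigmaFiberEquiv f x) :=
    (Equiv.sigmaFiberEquiv f).summable_iff.2 hsum.of_norm
  rw [← h1, h2.tsum_sigma, dedekindZeta, LSeries]
  refine tsum_congr fun n => ?_
  have h3 : ∀ I : {I // f I = n}, absNormCpow K s (Equiv.sigmaFiberEquiv f ⟨n, I⟩) =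
      (n : ℂ) ^ (-s) := by
    rintro ⟨I, rfl⟩
    rfl
  rw [tsum_congr h3, tsum_const]
  -- The L-series has term `0` at `n = 0`, in accordance with the absence of nonzero ideals of norm
  -- `0`.
  rcases eq_or_ne n 0 with rfl | hn
  · have : IsEmpty {I // f I = 0} := ⟨fun I => (absNorm_pos_of_nonZeroDivisors K I.1).ne' I.2⟩
    simp
  · rw [LSeries.term_of_ne_zero hn, Complex.cpow_neg, nsmul_eq_mul, div_eq_mul_inv]
    congr 2
    refine Nat.card_congr ⟨fun I => ⟨⟨I.1, ?_⟩, I.2⟩, fun I => ⟨I.1.1, I.2⟩, fun _ => rfl,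
      fun _ => rfl⟩
    exact Ideal.absNorm_pos_iff_mem_nonZeroDivisors.1 (I.2.symm ▸ Nat.pos_of_ne_zero hn)

end EulerProduct

/-! ### Meromorphic continuation of homogeneous sums over lattices. -/

section HomogeneousSum

/-- Data for a Dirichlet series `∑ g x * ν x ^ (-s)` over a lattice of rank `n`, with `g`
homogeneous of degree `0`, and `ν` homogeneous of degree `n`. The function `q` measures the size,
and `e` lists representatives of the cosets of `2 Λ`. -/
structure HomogeneousData (Λ : Type*) [AddCommGroup Λ] (n : ℕ) (ι : Type*) [Fintype ι] where
  g : Λ → ℝ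
  ν : Λ → ℝ
  q : Λ → ℝ
  e : ι → Λ
  c : ℝ
  n_pos : 0 < n
  c_pos : 0 < c
  c_le_one : c ≤ 1
  g_nonneg : ∀ x, 0 ≤ g x
  g_le_one : ∀ x, g x ≤ 1
  g_zero : g 0 = 0
  g_two : ∀ x, g (2 • x) = g x
  ν_two : ∀ x, ν (2 • x) = 2 ^ n * ν x
  one_le_ν : ∀ x, x ≠ 0 → 1 ≤ ν x
  q_zero : q 0 = 0
  one_le_q : ∀ x, x ≠ 0 → 1 ≤ q x
  summable_q : ∀ r : ℝ, n < r → Summable fun x => q x ^ (-r)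
  le_ν : ∀ x, g x ≠ 0 → c * q x ^ n ≤ ν x
  -- The fixed shift `e i` has relative size of order `1 / q x`; this is the gain that makes the
  -- differences summable past `Re s = 1`.
  lipschitz : ∀ i, ∃ C R : ℝ, 0 ≤ C ∧ ∀ x, R ≤ q x → x ≠ 0 →
    |g (2 • x + e i) - g (2 • x)| ≤ C / q x ∧
    (g (2 • x + e i) ≠ 0 ∨ g (2 • x) ≠ 0 →
      2 • x + e i ≠ 0 ∧ c * q x ^ n ≤ ν (2 • x + e i) ∧ c * q x ^ n ≤ ν (2 • x) ∧
      |Real.log (ν (2 • x + e i)) - Real.log (ν (2 • x))| ≤ C / q x)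
  card_ι : Fintype.card ι = 2 ^ n
  bijective : Function.Bijective fun p : ι × Λ => 2 • p.2 + e p.1

namespace HomogeneousData

variable {Λ : Type*} [AddCommGroup Λ] {n : ℕ} {ι : Type*} [Fintype ι]
  (D : HomogeneousData Λ n ι)

/-- The general term of the Dirichlet series. -/
noncomputable def term (s : ℂ) (x : Λ) : ℂ := D.g x * (D.ν x : ℂ) ^ (-s)

/-- The difference of two neighbouring terms. -/
noncomputable def diff (i : ι) (s : ℂ) (x : Λ) : ℂ :=
  D.term s (2 • x + D.e i) - D.term s (2 • x)

theorem ne_zero_of_g_ne_zero {x : Λ} (hx : D.g x ≠ 0) : x ≠ 0 := by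
  rintro rfl
  exact hx D.g_zero

theorem norm_cpow {x : Λ} (hx : x ≠ 0) (s : ℂ) : ‖(D.ν x : ℂ) ^ (-s)‖ = D.ν x ^ (-s.re) := by
  rw [Complex.norm_cpow_eq_rpow_re_of_pos (by linarith [D.one_le_ν x hx]), Complex.neg_re]

theorem norm_term_le_one (s : ℂ) (hs : 0 ≤ s.re) (x : Λ) : ‖D.term s x‖ ≤ 1 := by
  by_cases hx : D.g x = 0
  · simp [term, hx]
  have hx0 := D.ne_zero_of_g_ne_zero hx
  rw [term, norm_mul, D.norm_cpow hx0, Complex.norm_real, Real.norm_of_nonneg (D.g_nonneg x)]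
  exact mul_le_one₀ (D.g_le_one x)
    (Real.rpow_nonneg (by linarith [D.one_le_ν x hx0]) _)
    (Real.rpow_le_one_of_one_le_of_nonpos (D.one_le_ν x hx0) (by linarith))

theorem rpow_ν_le {y x : Λ} (hx : x ≠ 0) {σ : ℝ} (hσ : 0 ≤ σ) (h : D.c * D.q x ^ n ≤ D.ν y) :
    D.ν y ^ (-σ) ≤ D.c ^ (-σ) * D.q x ^ (-(n * σ)) := by
  have hq := D.one_le_q x hx
  have hc := D.c_pos
  have h1 : (D.c * D.q x ^ n) ^ (-σ) = D.c ^ (-σ) * D.q x ^ (-(n * σ)) := by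
    rw [Real.mul_rpow hc.le (by positivity), ← Real.rpow_natCast, ← Real.rpow_mul (by linarith)]
    ring_nf
  rw [← h1]
  exact Real.rpow_le_rpow_of_nonpos (by positivity) h (by linarith)

theorem norm_term_le (s : ℂ) (hs : 0 ≤ s.re) (x : Λ) :
    ‖D.term s x‖ ≤ D.c ^ (-s.re) * D.q x ^ (-(n * s.re)) := by
  have hc := D.c_pos
  have hq : 0 ≤ D.q x := by
    by_cases hx : x = 0
    · rw [hx, D.q_zero]
    · linarith [D.one_le_q x hx]
  by_cases hx : D.g x = 0
  · simp only [term, hx, Complex.ofReal_zero, zero_mul, norm_zero]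
    positivity
  have hx0 := D.ne_zero_of_g_ne_zero hx
  rw [term, norm_mul, D.norm_cpow hx0, Complex.norm_real, Real.norm_of_nonneg (D.g_nonneg x)]
  exact (mul_le_of_le_one_left (Real.rpow_nonneg (by linarith [D.one_le_ν x hx0]) _)
    (D.g_le_one x)).trans (D.rpow_ν_le hx0 hs (D.le_ν x hx))

theorem summable_norm_term {s : ℂ} (hs : 1 < s.re) : Summable fun x => ‖D.term s x‖ := by
  refine Summable.of_nonneg_of_le (fun _ => norm_nonneg _)
    (fun x => D.norm_term_le s (by linarith) x) ((D.summable_q (n * s.re) ?_).mul_left _)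
  have : (0 : ℝ) < n := by exact_mod_cast D.n_pos
  nlinarith

theorem differentiable_term (x : Λ) : Differentiable ℂ fun s => D.term s x := by
  by_cases hx : D.g x = 0
  · simp only [term, hx, Complex.ofReal_zero, zero_mul]
    exact differentiable_const _
  have hx0 := D.ne_zero_of_g_ne_zero hx
  have : (D.ν x : ℂ) ≠ 0 := by
    exact_mod_cast (by linarith [D.one_le_ν x hx0] : (0 : ℝ) < D.ν x).ne'
  intro s
  exact (DifferentiableAt.const_cpow differentiableAt_id.neg (Or.inl this)).const_mul _

/-- The difference is split into a change of `g` and a change of `ν ^ (-s)`. Each is smaller by a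
factor `1 / q x` than the bound for a single term; for the second, `ν'` is `ν` times the exponential
of a number of size at most `C / q x`. -/
theorem norm_diff_le {i : ι} {C : ℝ} (hC : 0 ≤ C) {x : Λ} (hx : x ≠ 0)
    (h1 : |D.g (2 • x + D.e i) - D.g (2 • x)| ≤ C / D.q x)
    (h2 : D.g (2 • x + D.e i) ≠ 0 ∨ D.g (2 • x) ≠ 0 →
      2 • x + D.e i ≠ 0 ∧ D.c * D.q x ^ n ≤ D.ν (2 • x + D.e i) ∧
      D.c * D.q x ^ n ≤ D.ν (2 • x) ∧
      |Real.log (D.ν (2 • x + D.e i)) - Real.log (D.ν (2 • x))| ≤ C / D.q x)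
    {s : ℂ} (hs : 0 ≤ s.re) :
    ‖D.diff i s x‖ ≤ D.c ^ (-s.re) * (C + ‖s‖ * C * Real.exp (‖s‖ * C)) *
      D.q x ^ (-(n * s.re + 1)) := by
  have hq := D.one_le_q x hx
  have hc := D.c_pos
  by_cases hg : D.g (2 • x + D.e i) ≠ 0 ∨ D.g (2 • x) ≠ 0
  swap
  · push Not at hg
    rw [diff, term, term, hg.1, hg.2]
    simp only [Complex.ofReal_zero, zero_mul, sub_zero, norm_zero]
    positivity
  obtain ⟨hy', hν', hν, hlog⟩ := h2 hg
  have hpos : 0 < D.c * D.q x ^ n := by positivity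
  set ν' := D.ν (2 • x + D.e i)
  set ν := D.ν (2 • x)
  have hνp : 0 < ν := hpos.trans_le hν
  have hνp' : 0 < ν' := hpos.trans_le hν'
  set d := Real.log ν' - Real.log ν
  have key : D.diff i s x = ((D.g (2 • x + D.e i) - D.g (2 • x) : ℝ) : ℂ) * (ν' : ℂ) ^ (-s) +
      D.g (2 • x) * ((ν : ℂ) ^ (-s) * (Complex.exp (-s * d) - 1)) := by
    have : (ν' : ℂ) ^ (-s) = (ν : ℂ) ^ (-s) * Complex.exp (-s * d) := by
      rw [Complex.cpow_def_of_ne_zero (by exact_mod_cast hνp'.ne'),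
        Complex.cpow_def_of_ne_zero (by exact_mod_cast hνp.ne'), ← Complex.exp_add,
        ← Complex.ofReal_log hνp.le, ← Complex.ofReal_log hνp'.le]
      congr 1
      simp only [d]
      push_cast
      ring
    rw [diff, term, term, mul_sub, mul_sub, ← this]
    push_cast
    ring
  have hn1 : ‖(ν' : ℂ) ^ (-s)‖ ≤ D.c ^ (-s.re) * D.q x ^ (-(n * s.re)) := by
    rw [Complex.norm_cpow_eq_rpow_re_of_pos hνp', Complex.neg_re]
    exact D.rpow_ν_le hx hs hν'
  have hn2 : ‖(ν : ℂ) ^ (-s)‖ ≤ D.c ^ (-s.re) * D.q x ^ (-(n * s.re)) := by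
    rw [Complex.norm_cpow_eq_rpow_re_of_pos hνp, Complex.neg_re]
    exact D.rpow_ν_le hx hs hν
  have hn3 : ‖Complex.exp (-s * d) - 1‖ ≤ ‖s‖ * (C / D.q x) * Real.exp (‖s‖ * C) := by
    have h3 := Complex.norm_exp_sub_sum_le_norm_mul_exp (-s * d) 1
    simp only [Finset.range_one, Finset.sum_singleton, pow_zero, Nat.factorial_zero,
      Nat.cast_one, div_one, pow_one] at h3
    have h4 : ‖-s * (d : ℂ)‖ ≤ ‖s‖ * (C / D.q x) := by
      rw [norm_mul, norm_neg, Complex.norm_real, Real.norm_eq_abs]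
      gcongr
    have h5 : ‖s‖ * (C / D.q x) ≤ ‖s‖ * C := by
      gcongr
      exact div_le_self hC hq
    refine h3.trans ?_
    gcongr
    exact h4.trans h5
  have hq' : D.q x ^ (-(n * s.re + 1)) = D.q x ^ (-(n * s.re)) / D.q x := by
    rw [neg_add, Real.rpow_add (by linarith), Real.rpow_neg_one]
    rfl
  rw [key, hq']
  refine (norm_add_le _ _).trans ?_
  rw [norm_mul, norm_mul, norm_mul, Complex.norm_real, Complex.norm_real, Real.norm_eq_abs,
    Real.norm_of_nonneg (D.g_nonneg _)]
  have hA : (0 : ℝ) ≤ D.c ^ (-s.re) * D.q x ^ (-(n * s.re)) := by positivity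
  calc |D.g (2 • x + D.e i) - D.g (2 • x)| * ‖(ν' : ℂ) ^ (-s)‖ +
      D.g (2 • x) * (‖(ν : ℂ) ^ (-s)‖ * ‖Complex.exp (-s * d) - 1‖)
      ≤ C / D.q x * (D.c ^ (-s.re) * D.q x ^ (-(n * s.re))) +
        1 * ((D.c ^ (-s.re) * D.q x ^ (-(n * s.re))) *
          (‖s‖ * (C / D.q x) * Real.exp (‖s‖ * C))) := by
        have := D.g_le_one (2 • x)
        have := D.g_nonneg (2 • x)
        gcongr
    _ = _ := by ring

/-- The region in which the series of differences converges normally. -/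
def region (n : ℕ) : Set ℂ := {s | 1 - 1 / (2 * n) < s.re ∧ ‖s‖ < 2}

theorem isOpen_region (n : ℕ) : IsOpen (region n) :=
  (isOpen_lt continuous_const Complex.continuous_re).inter
    (isOpen_lt continuous_norm continuous_const)

theorem differentiableOn_tsum_diff (i : ι) :
    DifferentiableOn ℂ (fun s => ∑' x, D.diff i s x) (region n) := by
  obtain ⟨C, R, hC, hCR⟩ := D.lipschitz i
  have hn : (1 : ℝ) ≤ n := by exact_mod_cast D.n_pos
  have hc := D.c_pos
  -- Convergence of the sum of `q x ^ (-(n + 1))` leaves only finitely many `x` of bounded size.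
  have hfin : {x | D.q x < R}.Finite := by
    have h1 := (D.summable_q (n + 1) (by linarith)).tendsto_cofinite_zero
    have h2 : 0 < (max R 1) ^ (-(n + 1 : ℝ)) := by positivity
    have h3 := h1.eventually_lt_const h2
    rw [eventually_cofinite] at h3
    refine (h3.union (Set.finite_singleton 0)).subset fun x hx => ?_
    by_cases hx0 : x = 0
    · exact Or.inr hx0
    · refine Or.inl ?_
      simp only [Set.mem_ofPred_eq, not_lt] at hx ⊢
      exact Real.rpow_le_rpow_of_nonpos (by linarith [D.one_le_q x hx0])
        (hx.le.trans (le_max_left _ _)) (by linarith)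
  let B : Set Λ := {x | D.q x < R} ∪ {0}
  have hB : B.Finite := hfin.union (Set.finite_singleton 0)
  let C' : ℝ := D.c ^ (-2 : ℝ) * (C + 2 * C * Real.exp (2 * C))
  -- On `region n` the exponent `n * s.re + 1` exceeds `n + 1 / 2`, and `‖s‖ < 2` makes the constant
  -- uniform. On the finite set `B` the trivial bound `2` for two terms is used.
  let u (x : Λ) : ℝ := C' * D.q x ^ (-(n + 1 / 2 : ℝ)) + B.indicator (fun _ => 2) x
  have hu : Summable u := by
    refine ((D.summable_q _ (by linarith)).mul_left _).add ?_
    exact summable_of_hasFiniteSupport (hB.subset fun x hx => Set.mem_of_indicator_ne_zero hx)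
  have hσ0 : (1 : ℝ) / 2 ≤ 1 - 1 / (2 * n) := by
    have : (1 : ℝ) / (2 * n) ≤ 1 / 2 := by
      apply one_div_le_one_div_of_le <;> linarith
    linarith
  refine Complex.differentiableOn_tsum_of_summable_norm hu (fun x => ?_) (isOpen_region n) ?_
  · exact ((D.differentiable_term _).sub (D.differentiable_term _)).differentiableOn
  · rintro x s ⟨hs, hs2⟩
    have hs0 : 0 ≤ s.re := by linarith
    have hC' : 0 ≤ C' := by positivity
    by_cases hx : x ∈ B
    · have h1 : ‖D.diff i s x‖ ≤ 2 := by
        refine (norm_sub_le _ _).trans ?_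
        linarith [D.norm_term_le_one s hs0 (2 • x + D.e i), D.norm_term_le_one s hs0 (2 • x)]
      have h2 : 0 ≤ D.q x ^ (-(n + 1 / 2 : ℝ)) := by
        refine Real.rpow_nonneg ?_ _
        by_cases hx : x = 0
        · rw [hx, D.q_zero]
        · linarith [D.one_le_q x hx]
      simp only [u, Set.indicator_of_mem hx]
      nlinarith [mul_nonneg hC' h2]
    · have hx' : R ≤ D.q x ∧ x ≠ 0 := by
        simpa [B, and_comm] using hx
      obtain ⟨h1, h2⟩ := hCR x hx'.1 hx'.2
      have hq := D.one_le_q x hx'.2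
      simp only [u, Set.indicator_of_notMem hx, add_zero]
      refine (D.norm_diff_le hC hx'.2 h1 h2 hs0).trans ?_
      have h3 : D.c ^ (-s.re) ≤ D.c ^ (-2 : ℝ) :=
        Real.rpow_le_rpow_of_exponent_ge hc D.c_le_one
          (by linarith [(Complex.re_le_norm s).trans hs2.le])
      have h4 : D.q x ^ (-(n * s.re + 1)) ≤ D.q x ^ (-(n + 1 / 2 : ℝ)) := by
        refine Real.rpow_le_rpow_of_exponent_le hq ?_
        have : (n : ℝ) * (1 - 1 / (2 * n)) ≤ n * s.re := by gcongr
        have h5 : (n : ℝ) * (1 - 1 / (2 * n)) = n - 1 / 2 := by field_simp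
        linarith
      have h6 : ‖s‖ ≤ 2 := hs2.le
      simp only [C']
      gcongr

theorem term_two (s : ℂ) (x : Λ) : D.term s (2 • x) = (2 : ℂ) ^ (-(n * s)) * D.term s x := by
  by_cases hx : D.g x = 0
  · simp [term, D.g_two, hx]
  have hx0 := D.ne_zero_of_g_ne_zero hx
  have h0 : 0 ≤ D.ν x := by linarith [D.one_le_ν x hx0]
  rw [term, term, D.g_two, D.ν_two, Complex.ofReal_mul,
    Complex.mul_cpow_ofReal_nonneg (by positivity) h0]
  have : (((2 : ℝ) ^ n : ℝ) : ℂ) ^ (-s) = (2 : ℂ) ^ (-(n * s)) := by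
    rw [Complex.cpow_def_of_ne_zero (by simp), Complex.cpow_def_of_ne_zero two_ne_zero,
      ← Complex.ofReal_log (by positivity), Real.log_pow,
      show (2 : ℂ) = ((2 : ℝ) : ℂ) by norm_num, ← Complex.ofReal_log two_pos.le]
    push_cast
    ring_nf
  rw [this]
  ring

/-- Each of the `2 ^ n` cosets of `2 Λ` contributes its differences plus the sum of `term s (2 •
x)`, which is `2 ^ (-(n * s))` times the whole series. Solving for the series gives the factor on
the left. -/
theorem tsum_term_eq {s : ℂ} (hs : 1 < s.re) :
    (∑' x, D.term s x) * (1 - (2 : ℂ) ^ (n - n * s)) = ∑ i, ∑' x, D.diff i s x := by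
  have hsum : Summable (D.term s) := (D.summable_norm_term hs).of_norm
  obtain ⟨e, he⟩ : ∃ e : ι × Λ ≃ Λ, ∀ p, e p = 2 • p.2 + D.e p.1 :=
    ⟨Equiv.ofBijective _ D.bijective, fun _ => rfl⟩
  have h1 := e.tsum_eq (D.term s)
  have h2 : Summable fun p => D.term s (e p) := e.summable_iff.2 hsum
  simp_rw [he] at h1 h2
  have h3 : Summable fun x => D.term s (2 • x) := by
    simp_rw [D.term_two]
    exact hsum.mul_left _
  have h4 (i : ι) : Summable fun x => D.term s (2 • x + D.e i) :=
    h2.comp_injective (i := fun x => (i, x)) fun _ _ h => (Prod.mk.inj h).2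
  have h5 (i : ι) : ∑' x, D.diff i s x = ∑' x, D.term s (2 • x + D.e i) -
      (2 : ℂ) ^ (-(n * s)) * ∑' x, D.term s x := by
    rw [← tsum_mul_left]
    simp_rw [← D.term_two]
    exact (h4 i).tsum_sub h3
  have h6 : ∑' x, D.term s x = ∑ i, ∑' x, D.term s (2 • x + D.e i) := by
    rw [← h1, h2.tsum_prod, tsum_fintype]
  simp_rw [h5]
  rw [Finset.sum_sub_distrib, ← h6, Finset.sum_const, Finset.card_univ, D.card_ι, nsmul_eq_mul,
    mul_sub, mul_one, sub_eq_add_neg (n : ℂ), Complex.cpow_add _ _ two_ne_zero,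
    Complex.cpow_natCast]
  push_cast
  ring

theorem exists_meromorphicAt : ∃ Z : ℂ → ℂ, MeromorphicAt Z 1 ∧
    ∀ s : ℂ, 1 < s.re → Z s = ∑' x, D.term s x := by
  classical
  let G (s : ℂ) : ℂ := ∑ i, ∑' x, D.diff i s x
  let d (s : ℂ) : ℂ := 1 - (2 : ℂ) ^ (n - n * s)
  have hn : (1 : ℝ) ≤ n := by exact_mod_cast D.n_pos
  have h1 : (1 : ℂ) ∈ region n := by
    refine ⟨?_, by norm_num⟩
    rw [Complex.one_re, sub_lt_self_iff]
    positivity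
  have hU : region n ∈ 𝓝 (1 : ℂ) := (isOpen_region n).mem_nhds h1
  have hG : AnalyticAt ℂ G 1 := by
    refine DifferentiableOn.analyticAt (s := region n) ?_ hU
    exact DifferentiableOn.fun_sum fun i _ => D.differentiableOn_tsum_diff i
  have hd : AnalyticAt ℂ d 1 := by
    refine Differentiable.analyticAt (fun s => ?_) 1
    exact (differentiableAt_const _).sub (DifferentiableAt.const_cpow
      ((differentiableAt_const _).sub (differentiableAt_id.const_mul _)) (Or.inl two_ne_zero))
  -- The power of `2` has absolute value `2 ^ (n * (1 - s.re)) < 1`.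
  have hd0 (s : ℂ) (hs : 1 < s.re) : d s ≠ 0 := by
    intro h0
    have h2 : (2 : ℂ) ^ (n - n * s) = 1 := (sub_eq_zero.1 h0).symm
    have h3 := congrArg norm h2
    rw [norm_one, show (2 : ℂ) = ((2 : ℝ) : ℂ) by norm_num,
      Complex.norm_cpow_eq_rpow_re_of_pos two_pos] at h3
    have h4 : (2 : ℝ) ^ ((n - n * s : ℂ).re) < 1 := by
      refine Real.rpow_lt_one_of_one_lt_of_neg one_lt_two ?_
      simp only [Complex.sub_re, Complex.natCast_re, Complex.mul_re, Complex.natCast_im, zero_mul,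
        sub_zero]
      nlinarith
    exact h4.ne h3
  refine ⟨fun s => if 1 < s.re then ∑' x, D.term s x else G s / d s, ?_, fun s hs => if_pos hs⟩
  refine (hG.meromorphicAt.div hd.meromorphicAt).congr (Eventually.of_forall fun s => ?_)
  simp only [Pi.div_apply]
  split_ifs with hs
  · rw [div_eq_iff (hd0 s hs)]
    exact (D.tsum_term_eq hs).symm
  · rfl

end HomogeneousData

end HomogeneousSum

/-! ### A piecewise linear partition of unity. -/

section Tent

/-- The piecewise linear partition of unity on `ℝ`: the translates by `ℤ` sum to `1`. -/
noncomputable def tent (t : ℝ) : ℝ := max 0 (1 - |t|)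

theorem tent_nonneg (t : ℝ) : 0 ≤ tent t := le_max_left _ _

theorem tent_le_one (t : ℝ) : tent t ≤ 1 :=
  max_le zero_le_one (by linarith [abs_nonneg t])

theorem abs_lt_one_of_tent_ne_zero {t : ℝ} (h : tent t ≠ 0) : |t| < 1 := by
  by_contra! h1
  exact h (max_eq_left (by linarith))

theorem abs_tent_sub_le (a b : ℝ) : |tent a - tent b| ≤ |a - b| := by
  refine (abs_max_sub_max_le_max _ _ _ _).trans (max_le (by simp) ?_)
  rw [sub_sub_sub_cancel_left, abs_sub_comm]
  exact abs_abs_sub_abs_le _ _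

/-- The integers `k` for which `tent (t + k)` may be nonzero. -/
noncomputable def tentSupport (t : ℝ) : Finset ℤ := {⌊-t⌋, ⌊-t⌋ + 1}

theorem tent_eq_zero {t : ℝ} {k : ℤ} (hk : k ∉ tentSupport t) : tent (t + k) = 0 := by
  by_contra h
  have h1 := abs_lt.1 (abs_lt_one_of_tent_ne_zero h)
  refine hk ?_
  have h2 : ⌊-t⌋ < k + 1 := by
    rw [Int.floor_lt]
    push_cast
    linarith
  have h3 : k - 1 ≤ ⌊-t⌋ := by
    rw [Int.le_floor]
    push_cast
    linarith
  simp only [tentSupport, Finset.mem_insert, Finset.mem_singleton]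
  omega

theorem sum_tentSupport (t : ℝ) : ∑ k ∈ tentSupport t, tent (t + k) = 1 := by
  have h1 := Int.floor_le (-t)
  have h2 := Int.lt_floor_add_one (-t)
  rw [tentSupport, Finset.sum_pair (by omega), tent, tent]
  push_cast
  rw [abs_of_nonpos (by linarith : t + (⌊-t⌋ : ℝ) ≤ 0),
    abs_of_nonneg (by linarith : 0 ≤ t + ((⌊-t⌋ : ℝ) + 1)), max_eq_right (by linarith),
    max_eq_right (by linarith)]
  ring

variable {κ : Type*} [Fintype κ]

/-- The product of `tent` over all coordinates. -/
noncomputable def tentProd (t : κ → ℝ) : ℝ := ∏ i, tent (t i)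

theorem tentProd_nonneg (t : κ → ℝ) : 0 ≤ tentProd t :=
  Finset.prod_nonneg fun _ _ => tent_nonneg _

theorem tentProd_le_one (t : κ → ℝ) : tentProd t ≤ 1 :=
  Finset.prod_le_one (fun _ _ => tent_nonneg _) fun _ _ => tent_le_one _

theorem abs_lt_one_of_tentProd_ne_zero {t : κ → ℝ} (h : tentProd t ≠ 0) (i : κ) : |t i| < 1 :=
  abs_lt_one_of_tent_ne_zero (Finset.prod_ne_zero_iff.1 h i (Finset.mem_univ i))

theorem abs_tentProd_sub_le (a b : κ → ℝ) :
    |tentProd a - tentProd b| ≤ ∑ i, |a i - b i| := by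
  classical
  have key : ∀ s : Finset κ,
      |∏ i ∈ s, tent (a i) - ∏ i ∈ s, tent (b i)| ≤ ∑ i ∈ s, |a i - b i| := by
    intro s
    induction s using Finset.induction_on with
    | empty => simp
    | insert i s hi ih =>
      rw [Finset.prod_insert hi, Finset.prod_insert hi, Finset.sum_insert hi]
      have h1 : |∏ j ∈ s, tent (a j)| ≤ 1 := by
        rw [abs_of_nonneg (Finset.prod_nonneg fun _ _ => tent_nonneg _)]
        exact Finset.prod_le_one (fun _ _ => tent_nonneg _) fun _ _ => tent_le_one _
      have h2 : |tent (b i)| ≤ 1 := by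
        rw [abs_of_nonneg (tent_nonneg _)]
        exact tent_le_one _
      calc |tent (a i) * ∏ j ∈ s, tent (a j) - tent (b i) * ∏ j ∈ s, tent (b j)|
          = |(tent (a i) - tent (b i)) * ∏ j ∈ s, tent (a j) +
              tent (b i) * (∏ j ∈ s, tent (a j) - ∏ j ∈ s, tent (b j))| := by ring_nf
        _ ≤ |tent (a i) - tent (b i)| * |∏ j ∈ s, tent (a j)| +
              |tent (b i)| * |∏ j ∈ s, tent (a j) - ∏ j ∈ s, tent (b j)| := by
            rw [← abs_mul, ← abs_mul]
            exact abs_add_le _ _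
        _ ≤ |a i - b i| * 1 + 1 * ∑ j ∈ s, |a j - b j| := by
            exact add_le_add
              (mul_le_mul (abs_tent_sub_le _ _) h1 (abs_nonneg _) (abs_nonneg _))
              (mul_le_mul h2 ih (abs_nonneg _) zero_le_one)
        _ = _ := by ring
  exact key Finset.univ

/-- The translates of `tentProd` by the integral vectors form a partition of unity. -/
theorem hasSum_tentProd (μ : Type*) [Fintype μ] (t : κ → ℝ) :
    HasSum (fun p : μ × (κ → ℤ) => tentProd fun i => t i + p.2 i) (Fintype.card μ) := by
  classical
  -- Only finitely many translates matter, and their sum factors over the coordinates. The index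
  -- `μ`, on which nothing depends, will be the group of roots of unity.
  have h1 : ∑ p ∈ (Finset.univ : Finset μ) ×ˢ Fintype.piFinset (fun i => tentSupport (t i)),
      tentProd (fun i => t i + p.2 i) = (Fintype.card μ : ℝ) := by
    rw [Finset.sum_product]
    simp only [tentProd]
    simp_rw [← Finset.prod_univ_sum (fun i => tentSupport (t i)) fun i (k : ℤ) => tent (t i + k),
      sum_tentSupport]
    simp
  rw [← h1]
  refine hasSum_sum_of_ne_finset_zero fun p hp => ?_
  simp only [Finset.mem_product, Finset.mem_univ, true_and, Fintype.mem_piFinset, not_forall] at hp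
  obtain ⟨i, hi⟩ := hp
  exact Finset.prod_eq_zero (Finset.mem_univ i) (tent_eq_zero hi)

end Tent

/-! ### Logarithmic coordinates relative to the fundamental units. -/

section LogCoordinates

open NumberField NumberField.Units NumberField.Units.dirichletUnitTheorem

/-- The vector of the logarithms of the absolute values. -/
noncomputable def placeLogs {F : Type*} [Field F] (x : F) : InfinitePlace F → ℝ :=
  fun w => Real.log (w x)

theorem placeLogs_mul {F : Type*} [Field F] {x y : F} (hx : x ≠ 0) (hy : y ≠ 0) :
    placeLogs (x * y) = placeLogs x + placeLogs y := by
  ext w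
  rw [placeLogs, map_mul, Real.log_mul ((map_ne_zero w).2 hx) ((map_ne_zero w).2 hy)]
  rfl

variable (K : Type*) [Field K] [NumberField K]

/-- The weighted average over the infinite places. -/
noncomputable def placeAverage : (InfinitePlace K → ℝ) →ₗ[ℝ] ℝ :=
  (Module.finrank ℚ K : ℝ)⁻¹ • ∑ w : InfinitePlace K, (w.mult : ℝ) • LinearMap.proj w

theorem placeAverage_apply (L : InfinitePlace K → ℝ) :
    placeAverage K L = (∑ w, (w.mult : ℝ) * L w) / Module.finrank ℚ K := by
  simp [placeAverage, div_eq_inv_mul]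

theorem sum_mult_cast : ∑ w : InfinitePlace K, (w.mult : ℝ) = Module.finrank ℚ K := by
  exact_mod_cast InfinitePlace.sum_mult_eq (K := K)

theorem finrank_cast_ne_zero : (Module.finrank ℚ K : ℝ) ≠ 0 := by
  exact_mod_cast Module.finrank_pos.ne'

theorem sum_mult_mul_sub_placeAverage (L : InfinitePlace K → ℝ) :
    ∑ w : InfinitePlace K, (w.mult : ℝ) * (L w - placeAverage K L) = 0 := by
  simp_rw [mul_sub]
  rw [Finset.sum_sub_distrib, ← Finset.sum_mul, sum_mult_cast, placeAverage_apply,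
    mul_div_cancel₀ _ (finrank_cast_ne_zero K), sub_self]

/-- The projection of the space of logarithms to the space of the unit lattice, along the
diagonal. -/
noncomputable def logProjection : (InfinitePlace K → ℝ) →ₗ[ℝ] logSpace K :=
  LinearMap.pi fun w => (w.1.mult : ℝ) • (LinearMap.proj w.1 - placeAverage K)

theorem logProjection_apply (L : InfinitePlace K → ℝ) (w : {w : InfinitePlace K // w ≠ w₀}) :
    logProjection K L w = w.1.mult * (L w.1 - placeAverage K L) := rfl

open scoped Classical in
/-- The basis of the logarithmic space given by the fundamental units. -/
noncomputable def logBasis : Module.Basis (Fin (rank K)) ℝ (logSpace K) :=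
  (basisUnitLattice K).ofZLatticeBasis ℝ (NumberField.Units.unitLattice K)

open scoped Classical in
theorem logBasis_apply (i : Fin (rank K)) :
    logBasis K i = NumberField.Units.logEmbedding K (Additive.ofMul (fundSystem K i)) := by
  rw [logBasis, Module.Basis.ofZLatticeBasis_apply, logEmbedding_fundSystem]

/-- The coordinates of a vector of logarithms with respect to the fundamental units. -/
noncomputable def logCoord : (InfinitePlace K → ℝ) →ₗ[ℝ] (Fin (rank K) → ℝ) :=
  (logBasis K).equivFun.toLinearMap ∘ₗ logProjection K

variable {K}

theorem logCoord_const (c : ℝ) : logCoord K (fun _ => c) = 0 := by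
  have : logProjection K (fun _ => c) = 0 := by
    ext w
    rw [logProjection_apply, placeAverage_apply, ← Finset.sum_mul, sum_mult_cast,
      mul_div_cancel_left₀ _ (finrank_cast_ne_zero K)]
    simp
  rw [logCoord, LinearMap.comp_apply, this, map_zero]

theorem placeAverage_unit (u : (𝓞 K)ˣ) : placeAverage K (placeLogs (u : K)) = 0 := by
  rw [placeAverage_apply]
  simp only [placeLogs]
  rw [sum_mult_mul_log, zero_div]

theorem logProjection_unit (u : (𝓞 K)ˣ) :
    logProjection K (placeLogs (u : K)) =
      NumberField.Units.logEmbedding K (Additive.ofMul u) := by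
  ext w
  rw [logProjection_apply, placeAverage_unit, sub_zero, logEmbedding_component]
  rfl

/-- The fundamental units are the coordinate basis and roots of unity have zero logarithms. Units
thus act on the coordinates by integral translations. -/
theorem logCoord_unit (ζ : torsion K) (k : Fin (rank K) → ℤ) :
    logCoord K (placeLogs ((ζ * ∏ i, fundSystem K i ^ k i : (𝓞 K)ˣ) : K)) =
      fun i => (k i : ℝ) := by
  have h1 : NumberField.Units.logEmbedding K
      (Additive.ofMul (ζ * ∏ i, fundSystem K i ^ k i : (𝓞 K)ˣ)) =
      ∑ i, (k i : ℝ) • logBasis K i := by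
    rw [ofMul_mul, map_add, logEmbedding_eq_zero_iff.2 ζ.2, zero_add, ofMul_prod, map_sum]
    refine Finset.sum_congr rfl fun i _ => ?_
    rw [ofMul_zpow, map_zsmul, logBasis_apply, Int.cast_smul_eq_zsmul]
  rw [logCoord, LinearMap.comp_apply, logProjection_unit, h1]
  ext i
  simp [Finsupp.single_apply]

variable (K) in
theorem exists_abs_sub_placeAverage_le : ∃ B : ℝ, ∀ L : InfinitePlace K → ℝ,
    (∀ i, |logCoord K L i| ≤ 1) → ∀ w, |L w - placeAverage K L| ≤ B := by
  classical
  let b (w : {w : InfinitePlace K // w ≠ w₀}) : ℝ := ∑ i, |logBasis K i w|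
  have hb0 (w) : 0 ≤ b w := Finset.sum_nonneg fun _ _ => abs_nonneg _
  refine ⟨∑ w, b w, fun L hL => ?_⟩
  have h1 (w : {w : InfinitePlace K // w ≠ w₀}) :
      |(w.1.mult : ℝ) * (L w.1 - placeAverage K L)| ≤ b w := by
    have h2 : logProjection K L = ∑ i, logCoord K L i • logBasis K i :=
      ((logBasis K).sum_equivFun _).symm
    rw [← logProjection_apply, h2, Finset.sum_apply]
    refine (Finset.abs_sum_le_sum_abs _ _).trans (Finset.sum_le_sum fun i _ => ?_)
    rw [Pi.smul_apply, smul_eq_mul, abs_mul]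
    exact mul_le_of_le_one_left (abs_nonneg _) (hL i)
  have h3 (w : InfinitePlace K) : |(w.mult : ℝ) * (L w - placeAverage K L)| ≤ ∑ w, b w := by
    by_cases hw : w = w₀
    -- The place `w₀` has no coordinate of its own; its deviation is minus the weighted sum of the
    -- others.
    · have h4 := sum_mult_mul_sub_placeAverage K L
      rw [← Finset.add_sum_erase _ _ (Finset.mem_univ (w₀ : InfinitePlace K)),
        add_eq_zero_iff_eq_neg] at h4
      rw [hw, h4, abs_neg]
      refine (Finset.abs_sum_le_sum_abs _ _).trans ?_
      rw [Finset.sum_subtype (p := fun w => w ≠ w₀) _ (by simp)]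
      exact Finset.sum_le_sum fun w _ => h1 w
    · exact (h1 ⟨w, hw⟩).trans (Finset.single_le_sum (fun w _ => hb0 w) (Finset.mem_univ _))
  intro w
  refine le_trans ?_ (h3 w)
  rw [abs_mul]
  refine le_mul_of_one_le_left (abs_nonneg _) ?_
  rw [abs_of_nonneg (by positivity)]
  exact_mod_cast InfinitePlace.mult_pos

variable (K) in
theorem exists_abs_logCoord_le : ∃ A : ℝ, 0 ≤ A ∧ ∀ (L : InfinitePlace K → ℝ) (d : ℝ), 0 ≤ d →
    (∀ w, |L w| ≤ d) → ∀ i, |logCoord K L i| ≤ A * d := by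
  refine ⟨‖(logCoord K).toContinuousLinearMap‖, norm_nonneg _, fun L d hd hL i => ?_⟩
  calc |logCoord K L i| ≤ ‖logCoord K L‖ := norm_le_pi_norm (logCoord K L) i
    _ ≤ ‖(logCoord K).toContinuousLinearMap‖ * ‖L‖ :=
      (logCoord K).toContinuousLinearMap.le_opNorm L
    _ ≤ _ := by
      gcongr
      exact (pi_norm_le_iff_of_nonneg hd).2 hL

end LogCoordinates

/-! ### Weight, size and norm of elements of a number field. -/

section PlaceFunctions

open NumberField NumberField.Units NumberField.Units.dirichletUnitTheorem
open scoped Classical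

theorem place_pos {F : Type*} [Field F] {x : F} (hx : x ≠ 0) (w : InfinitePlace F) : 0 < w x :=
  InfinitePlace.pos_iff.2 hx

theorem place_two {F : Type*} [Field F] (w : InfinitePlace F) : w (2 : F) = 2 := by
  have := w.norm_embedding_eq 2
  rw [← this, map_ofNat]
  simp

variable {K : Type*} [Field K] [NumberField K]

/-- A weight function on `K` of degree `0`, whose sum over each orbit of the units is the
number of roots of unity. -/
noncomputable def placeWeight (x : K) : ℝ :=
  if x = 0 then 0 else tentProd (logCoord K (placeLogs x))

/-- The largest absolute value of `x` at the infinite places. -/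
noncomputable def placeSup (x : K) : ℝ := ‖mixedEmbedding K x‖

/-- The absolute value of the norm of `x`, as a product over the infinite places. -/
noncomputable def placeNorm (x : K) : ℝ := ∏ w : InfinitePlace K, w x ^ w.mult

theorem placeWeight_zero : placeWeight (0 : K) = 0 := if_pos rfl

theorem placeWeight_of_ne_zero {x : K} (hx : x ≠ 0) :
    placeWeight x = tentProd (logCoord K (placeLogs x)) := if_neg hx

theorem placeWeight_nonneg (x : K) : 0 ≤ placeWeight x := by
  rw [placeWeight]
  split_ifs
  exacts [le_rfl, tentProd_nonneg _]

theorem placeWeight_le_one (x : K) : placeWeight x ≤ 1 := by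
  rw [placeWeight]
  split_ifs
  exacts [zero_le_one, tentProd_le_one _]

theorem placeSup_zero : placeSup (0 : K) = 0 := by simp [placeSup]

theorem placeSup_nonneg (x : K) : 0 ≤ placeSup x := norm_nonneg _

theorem placeSup_le_add (x y : K) : placeSup x ≤ placeSup y + placeSup (y - x) := by
  have := norm_sub_le (mixedEmbedding K y) (mixedEmbedding K (y - x))
  rwa [← map_sub, sub_sub_cancel] at this

theorem placeSup_two_nsmul (x : K) : placeSup (2 • x) = 2 * placeSup x := by
  rw [placeSup, map_nsmul, ← Nat.cast_smul_eq_nsmul ℝ, norm_smul, placeSup]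
  norm_num

theorem apply_le_placeSup (w : InfinitePlace K) (x : K) : w x ≤ placeSup x := by
  rw [placeSup, mixedEmbedding.norm_eq_sup'_normAtPlace, ← mixedEmbedding.normAtPlace_apply]
  exact Finset.le_sup' (fun w => mixedEmbedding.normAtPlace w _) (Finset.mem_univ w)

theorem exists_apply_eq_placeSup (x : K) : ∃ w : InfinitePlace K, w x = placeSup x := by
  obtain ⟨w, -, hw⟩ := Finset.exists_mem_eq_sup' (Finset.univ_nonempty)
    (fun w : InfinitePlace K => mixedEmbedding.normAtPlace w (mixedEmbedding K x))
  refine ⟨w, ?_⟩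
  rw [placeSup, mixedEmbedding.norm_eq_sup'_normAtPlace, hw, mixedEmbedding.normAtPlace_apply]

theorem placeSup_pos {x : K} (hx : x ≠ 0) : 0 < placeSup x :=
  (place_pos hx Classical.ofNonempty).trans_le (apply_le_placeSup _ x)

theorem placeNorm_two_nsmul (x : K) :
    placeNorm (2 • x) = 2 ^ Module.finrank ℚ K * placeNorm x := by
  simp only [placeNorm, two_nsmul, ← two_mul, map_mul, place_two, mul_pow]
  rw [Finset.prod_mul_distrib, Finset.prod_pow_eq_pow_sum, InfinitePlace.sum_mult_eq]

theorem placeWeight_two_nsmul (x : K) : placeWeight (2 • x) = placeWeight x := by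
  by_cases hx : x = 0
  · simp [hx]
  have h2 : (2 : K) ≠ 0 := two_ne_zero
  rw [two_nsmul, ← two_mul, placeWeight_of_ne_zero (mul_ne_zero h2 hx), placeWeight_of_ne_zero hx,
    placeLogs_mul h2 hx, map_add]
  have : placeLogs (2 : K) = fun _ => Real.log 2 := by
    ext w
    rw [placeLogs, place_two]
  rw [this, logCoord_const, zero_add]

theorem pow_le_placeNorm {x : K} {a : ℝ} (ha : 0 ≤ a) (h : ∀ w : InfinitePlace K, a ≤ w x) :
    a ^ Module.finrank ℚ K ≤ placeNorm x := by
  rw [← InfinitePlace.sum_mult_eq, ← Finset.prod_pow_eq_pow_sum, placeNorm]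
  exact Finset.prod_le_prod (fun _ _ => by positivity) fun w _ => pow_le_pow_left₀ ha (h w) _

theorem placeNorm_le_pow (x : K) : placeNorm x ≤ placeSup x ^ Module.finrank ℚ K := by
  rw [← InfinitePlace.sum_mult_eq, ← Finset.prod_pow_eq_pow_sum, placeNorm]
  exact Finset.prod_le_prod (fun w _ => pow_nonneg (apply_nonneg w x) _)
    fun w _ => pow_le_pow_left₀ (apply_nonneg w x) (apply_le_placeSup w x) _

theorem log_placeNorm {x : K} (hx : x ≠ 0) :
    Real.log (placeNorm x) = ∑ w : InfinitePlace K, (w.mult : ℝ) * placeLogs x w := by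
  rw [placeNorm, Real.log_prod fun w _ => pow_ne_zero _ (place_pos hx w).ne']
  exact Finset.sum_congr rfl fun w _ => Real.log_pow _ _

variable (K) in
/-- On the support of the weight all the absolute values have the same order of magnitude. -/
theorem exists_mul_placeSup_le : ∃ c : ℝ, 0 < c ∧ c ≤ 1 ∧ ∀ x : K, placeWeight x ≠ 0 →
    ∀ w : InfinitePlace K, c * placeSup x ≤ w x := by
  obtain ⟨B, hB⟩ := exists_abs_sub_placeAverage_le K
  -- On the support all logarithms are within `B` of their average, so any two differ by at most `2
  -- * B`.
  refine ⟨min 1 (Real.exp (-(2 * B))), by positivity, min_le_left _ _, fun x hx w => ?_⟩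
  have hx0 : x ≠ 0 := by
    rintro rfl
    exact hx placeWeight_zero
  rw [placeWeight_of_ne_zero hx0] at hx
  have h1 := hB (placeLogs x) fun i => (abs_lt_one_of_tentProd_ne_zero hx i).le
  obtain ⟨v, hv⟩ := exists_apply_eq_placeSup x
  have h2 := abs_le.1 (h1 w)
  have h3 := abs_le.1 (h1 v)
  have h4 : placeSup x = Real.exp (placeLogs x v) := by
    rw [← hv, placeLogs, Real.exp_log (place_pos hx0 v)]
  have h5 : w x = Real.exp (placeLogs x w) := by
    rw [placeLogs, Real.exp_log (place_pos hx0 w)]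
  refine (mul_le_mul_of_nonneg_right (min_le_right _ _) (placeSup_nonneg x)).trans ?_
  rw [h4, h5, ← Real.exp_add]
  exact Real.exp_le_exp.2 (by linarith)

/-- From `log t ≤ t - 1` at `t = a / b` and at `t = b / a`. -/
theorem abs_log_sub_log_le {a b m : ℝ} (hm : 0 < m) (ha : m ≤ a) (hb : m ≤ b) :
    |Real.log a - Real.log b| ≤ |a - b| / m := by
  have key : ∀ {a b : ℝ}, m ≤ a → m ≤ b → Real.log a - Real.log b ≤ |a - b| / m := by
    intro a b ha hb
    have ha0 : 0 < a := hm.trans_le ha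
    have hb0 : 0 < b := hm.trans_le hb
    rw [← Real.log_div ha0.ne' hb0.ne']
    refine (Real.log_le_sub_one_of_pos (div_pos ha0 hb0)).trans ?_
    rw [div_sub_one hb0.ne']
    calc (a - b) / b ≤ |a - b| / b := by
          gcongr
          exact le_abs_self _
      _ ≤ |a - b| / m := by gcongr
  refine abs_le.2 ⟨?_, key ha hb⟩
  have := key hb ha
  rw [abs_sub_comm] at this
  linarith

variable (K) in
/-- The weight and the norm vary slowly in the direction of any fixed vector. -/
theorem exists_placeWeight_lipschitz : ∃ c : ℝ, 0 < c ∧ c ≤ 1 ∧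
    (∀ x : K, placeWeight x ≠ 0 →
      c * placeSup x ^ Module.finrank ℚ K ≤ placeNorm x) ∧
    ∀ e : K, ∃ C R : ℝ, 0 ≤ C ∧ ∀ x : K, R ≤ placeSup x → x ≠ 0 →
      |placeWeight (2 • x + e) - placeWeight (2 • x)| ≤ C / placeSup x ∧
      (placeWeight (2 • x + e) ≠ 0 ∨ placeWeight (2 • x) ≠ 0 →
        2 • x + e ≠ 0 ∧ c * placeSup x ^ Module.finrank ℚ K ≤ placeNorm (2 • x + e) ∧
        c * placeSup x ^ Module.finrank ℚ K ≤ placeNorm (2 • x) ∧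
        |Real.log (placeNorm (2 • x + e)) - Real.log (placeNorm (2 • x))| ≤ C / placeSup x) := by
  obtain ⟨c, hc0, hc1, hc⟩ := exists_mul_placeSup_le K
  obtain ⟨A, hA, hAL⟩ := exists_abs_logCoord_le K
  set n := Module.finrank ℚ K
  refine ⟨c ^ n, by positivity, pow_le_one₀ hc0.le hc1, fun x hx => ?_, fun e => ?_⟩
  · rw [← mul_pow]
    exact pow_le_placeNorm (mul_nonneg hc0.le (placeSup_nonneg x)) (hc x hx)
  set E := placeSup e
  have hE : 0 ≤ E := placeSup_nonneg e
  -- Every logarithm changes by at most `E / c / q`. The weight has `rank K` coordinates with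
  -- constant `A`, and the log-norm has total multiplicity `n`; the sum of the two constants serves
  -- both.
  refine ⟨(rank K * A + n) * (E / c), 2 * E / c, by positivity, fun x hR hx => ?_⟩
  have hq : 0 < placeSup x := placeSup_pos hx
  rw [div_le_iff₀ hc0] at hR
  set q := placeSup x
  set y := 2 • x with hy
  have hyq : placeSup y = 2 * q := placeSup_two_nsmul x
  have hy0 : y ≠ 0 := by
    intro h
    rw [h, placeSup_zero] at hyq
    linarith
  have htri (w : InfinitePlace K) : |w (y + e) - w y| ≤ E := by
    have h1 := w.1.abs_abv_sub_le_abv_sub (y + e) y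
    rw [add_sub_cancel_left] at h1
    exact h1.trans (apply_le_placeSup w e)
  by_cases hg : placeWeight (y + e) ≠ 0 ∨ placeWeight y ≠ 0
  swap
  · push Not at hg
    refine ⟨?_, fun h => absurd h (by simp [hg])⟩
    rw [hg.1, hg.2, sub_zero, abs_zero]
    positivity
  -- If one of `y`, `y + e` is in the support, its absolute values are at least `2 * c * q - E`,
  -- those of the other at least `2 * c * q - 2 * E`; and `2 * E ≤ c * q`.
  have hlow : (∀ w : InfinitePlace K, c * q ≤ w (y + e)) ∧
      ∀ w : InfinitePlace K, c * q ≤ w y := by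
    rcases hg with hg | hg
    · have h1 := placeSup_le_add y (y + e)
      rw [add_sub_cancel_left, hyq] at h1
      have h2 (w : InfinitePlace K) : 2 * (c * q) - E ≤ w (y + e) := by
        refine le_trans ?_ (hc _ hg w)
        nlinarith [placeSup_nonneg (y + e)]
      refine ⟨fun w => ?_, fun w => ?_⟩
      · linarith [h2 w]
      · linarith [h2 w, (abs_le.1 (htri w)).2]
    · have h2 (w : InfinitePlace K) : 2 * (c * q) ≤ w y := by
        refine le_trans ?_ (hc _ hg w)
        rw [hyq]
        linarith
      refine ⟨fun w => ?_, fun w => ?_⟩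
      · linarith [h2 w, (abs_le.1 (htri w)).1]
      · linarith [h2 w, mul_pos hc0 hq]
  obtain ⟨hl1, hl2⟩ := hlow
  have hcq : 0 < c * q := mul_pos hc0 hq
  have hye : y + e ≠ 0 := by
    intro h
    have h1 := hl1 Classical.ofNonempty
    rw [h, map_zero] at h1
    linarith
  have hlog (w : InfinitePlace K) : |placeLogs (y + e) w - placeLogs y w| ≤ E / c / q := by
    refine (abs_log_sub_log_le hcq (hl1 w) (hl2 w)).trans ?_
    rw [div_div]
    gcongr
    exact htri w
  have hEcq : 0 ≤ E / c / q := by positivity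
  refine ⟨?_, fun _ => ⟨hye, ?_, ?_, ?_⟩⟩
  · rw [placeWeight_of_ne_zero hye, placeWeight_of_ne_zero hy0]
    refine (abs_tentProd_sub_le _ _).trans ?_
    have h1 (i : Fin (rank K)) : |logCoord K (placeLogs (y + e)) i - logCoord K (placeLogs y) i| ≤
        A * (E / c / q) := by
      rw [← Pi.sub_apply, ← map_sub]
      exact hAL _ _ hEcq hlog i
    refine (Finset.sum_le_sum fun i _ => h1 i).trans ?_
    rw [Finset.sum_const, Finset.card_univ, Fintype.card_fin, nsmul_eq_mul, mul_div_assoc,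
      ← mul_assoc]
    exact mul_le_mul_of_nonneg_right (le_add_of_nonneg_right (Nat.cast_nonneg _)) hEcq
  · rw [← mul_pow]
    exact pow_le_placeNorm hcq.le hl1
  · rw [← mul_pow]
    exact pow_le_placeNorm hcq.le hl2
  · rw [log_placeNorm hye, log_placeNorm hy0, ← Finset.sum_sub_distrib]
    refine (Finset.abs_sum_le_sum_abs _ _).trans ?_
    have h1 (w : InfinitePlace K) : |(w.mult : ℝ) * placeLogs (y + e) w - w.mult * placeLogs y w| ≤
        w.mult * (E / c / q) := by
      rw [← mul_sub, abs_mul, Nat.abs_cast]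
      exact mul_le_mul_of_nonneg_left (hlog w) (Nat.cast_nonneg _)
    refine (Finset.sum_le_sum fun w _ => h1 w).trans ?_
    rw [← Finset.sum_mul, sum_mult_cast, mul_div_assoc]
    exact mul_le_mul_of_nonneg_right (le_add_of_nonneg_left (by positivity)) hEcq

end PlaceFunctions

/-! ### Sums over the elements of an ideal. -/

section IdealData

open NumberField NumberField.Units NumberField.Units.dirichletUnitTheorem
open scoped Classical

variable {K : Type*} [Field K] [NumberField K]

theorem placeNorm_eq_absNorm (x : 𝓞 K) :
    placeNorm (x : K) = Ideal.absNorm (Ideal.span {x}) := by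
  rw [placeNorm, InfinitePlace.prod_eq_abs_norm, Ideal.absNorm_span_singleton,
    ← Algebra.coe_norm_int, ← Int.cast_abs, Int.abs_eq_natAbs]
  simp

theorem one_le_placeNorm {x : 𝓞 K} (hx : x ≠ 0) : 1 ≤ placeNorm (x : K) := by
  rw [placeNorm_eq_absNorm, Nat.one_le_cast, Nat.one_le_iff_ne_zero, Ne,
    Ideal.absNorm_eq_zero_iff, Ideal.span_singleton_eq_bot]
  exact hx

/-- The norm is a positive integer bounded by a power of the largest absolute value. -/
theorem one_le_placeSup {x : 𝓞 K} (hx : x ≠ 0) : 1 ≤ placeSup (x : K) := by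
  by_contra! h
  have h1 := (one_le_placeNorm hx).trans (placeNorm_le_pow (x : K))
  exact h1.not_gt (pow_lt_one₀ (placeSup_nonneg _) h Module.finrank_pos.ne')

variable (K) in
theorem finrank_integerLattice :
    Module.finrank ℤ (mixedEmbedding.integerLattice K) = Module.finrank ℚ K := by
  rw [ZLattice.rank ℝ, mixedEmbedding.finrank]

variable (K) in
theorem summable_integerLattice_rpow {r : ℝ} (hr : Module.finrank ℚ K < r) :
    Summable fun x : mixedEmbedding.integerLattice K =>
      ‖(x : mixedEmbedding.mixedSpace K)‖ ^ (-r) := by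
  refine ZLattice.summable_norm_rpow (mixedEmbedding.integerLattice K) (-r) ?_
  rw [finrank_integerLattice]
  exact neg_lt_neg hr

/-- The canonical map to the integer lattice of the mixed space. -/
noncomputable def toIntegerLattice (x : 𝓞 K) : mixedEmbedding.integerLattice K :=
  ⟨mixedEmbedding K x, x, rfl⟩

theorem coe_toIntegerLattice (x : 𝓞 K) :
    (toIntegerLattice x : mixedEmbedding.mixedSpace K) = mixedEmbedding K x := rfl

theorem toIntegerLattice_injective : Function.Injective (toIntegerLattice (K := K)) :=
  fun _ _ h => RingOfIntegers.ext (mixedEmbedding_injective K (congrArg Subtype.val h))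

variable (K) in
theorem summable_placeSup_rpow {r : ℝ} (hr : Module.finrank ℚ K < r) :
    Summable fun x : 𝓞 K => placeSup (x : K) ^ (-r) := by
  have h1 := (summable_integerLattice_rpow K hr).comp_injective toIntegerLattice_injective
  refine h1.congr fun x => ?_
  rw [Function.comp_apply, coe_toIntegerLattice, placeSup]

theorem exists_nsmul_representatives (Λ : Type*) [AddCommGroup Λ] [Module.Free ℤ Λ]
    [Module.Finite ℤ Λ] :
    ∃ (ι : Type) (_ : Fintype ι) (e : ι → Λ), Fintype.card ι = 2 ^ Module.finrank ℤ Λ ∧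
      Function.Bijective fun p : ι × Λ => 2 • p.2 + e p.1 := by
  have hinj : Function.Injective fun x : Λ => 2 • x := by
    have : Module.IsTorsionFree ℤ Λ := inferInstance
    intro x y h
    have h2 : (2 : ℤ) • x = (2 : ℤ) • y := by
      simpa only [two_zsmul, two_nsmul] using h
    exact smul_right_injective Λ (two_ne_zero (α := ℤ)) h2
  let H := (nsmulAddMonoidHom 2 : Λ →+ Λ).range
  have hH : H.index = 2 ^ Module.finrank ℤ Λ := AddSubgroup.index_range_nsmul Λ 2
  have hfin : Finite (Λ ⧸ H) := by
    have : H.FiniteIndex := ⟨by rw [hH]; positivity⟩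
    exact AddSubgroup.finite_quotient_of_finiteIndex
  have f : Fin (2 ^ Module.finrank ℤ Λ) ≃ Λ ⧸ H := by
    rw [← hH]
    exact (Finite.equivFin (Λ ⧸ H)).symm
  refine ⟨Fin (2 ^ Module.finrank ℤ Λ), inferInstance, fun i => (f i).out, by simp, ?_, ?_⟩
  · rintro ⟨i, x⟩ ⟨j, y⟩ h
    simp only at h
    have hmk (i : Fin (2 ^ Module.finrank ℤ Λ)) (x : Λ) :
        (QuotientAddGroup.mk (2 • x + (f i).out) : Λ ⧸ H) = f i := by
      have : (QuotientAddGroup.mk (2 • x) : Λ ⧸ H) = 0 :=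
        (QuotientAddGroup.eq_zero_iff _).2 ⟨x, rfl⟩
      rw [QuotientAddGroup.mk_add, this, zero_add, QuotientAddGroup.out_eq']
    have hij : i = j := f.injective (by rw [← hmk i x, h, hmk])
    subst hij
    rw [add_left_inj] at h
    rw [hinj h]
  · intro z
    have h1 : z - (QuotientAddGroup.mk z : Λ ⧸ H).out ∈ H := by
      rw [← QuotientAddGroup.eq_zero_iff, QuotientAddGroup.mk_sub, QuotientAddGroup.out_eq',
        sub_self]
    obtain ⟨x, hx⟩ := h1
    refine ⟨(f.symm z, x), ?_⟩
    simp only [Equiv.apply_symm_apply]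
    have hx' : 2 • x = z - (QuotientAddGroup.mk z : Λ ⧸ H).out := hx
    rw [hx', sub_add_cancel]

/-- The Dirichlet series over the elements of a nonzero ideal fits the general framework. -/
theorem exists_homogeneousData {J : Ideal (𝓞 K)} (hJ : J ≠ ⊥) :
    ∃ (n : ℕ) (ι : Type) (_ : Fintype ι) (D : HomogeneousData J n ι),
      (∀ x, D.g x = placeWeight ((x : 𝓞 K) : K)) ∧ ∀ x, D.ν x = placeNorm ((x : 𝓞 K) : K) := by
  have hrank : Module.finrank ℤ J = Module.finrank ℚ K :=
    (Ideal.finrank_eq_finrank (RingOfIntegers.basis K) J hJ).trans (RingOfIntegers.rank K)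
  have hfin : Module.Finite ℤ J := Module.IsNoetherian.finite ℤ (J.restrictScalars ℤ)
  have hfree : Module.Free ℤ J := inferInstance
  obtain ⟨ι, _, e, hcard, hbij⟩ := exists_nsmul_representatives J
  obtain ⟨c, hc0, hc1, hc, hlip⟩ := exists_placeWeight_lipschitz K
  have hne {x : J} (hx : x ≠ 0) : (x : 𝓞 K) ≠ 0 := fun h => hx (Subtype.ext h)
  have hne' {x : J} (hx : x ≠ 0) : ((x : 𝓞 K) : K) ≠ 0 := RingOfIntegers.coe_ne_zero_iff.2 (hne hx)
  have htwo (x : J) : (((2 • x : J) : 𝓞 K) : K) = 2 • ((x : 𝓞 K) : K) :=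
    map_nsmul (algebraMap (𝓞 K) K) 2 (x : 𝓞 K)
  have hadd (x y : J) : (((2 • x + y : J) : 𝓞 K) : K) = 2 • ((x : 𝓞 K) : K) + ((y : 𝓞 K) : K) := by
    rw [← htwo]
    exact map_add (algebraMap (𝓞 K) K) ((2 • x : J) : 𝓞 K) y
  refine ⟨Module.finrank ℚ K, ι, inferInstance,
    { g := fun x => placeWeight ((x : 𝓞 K) : K)
      ν := fun x => placeNorm ((x : 𝓞 K) : K)
      q := fun x => placeSup ((x : 𝓞 K) : K)
      e := e
      c := c
      n_pos := Module.finrank_pos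
      c_pos := hc0
      c_le_one := hc1
      g_nonneg := fun x => placeWeight_nonneg _
      g_le_one := fun x => placeWeight_le_one _
      g_zero := placeWeight_zero
      g_two := fun x => by rw [htwo, placeWeight_two_nsmul]
      ν_two := fun x => by rw [htwo, placeNorm_two_nsmul]
      one_le_ν := fun x hx => one_le_placeNorm (hne hx)
      q_zero := placeSup_zero
      one_le_q := fun x hx => one_le_placeSup (hne hx)
      summable_q := fun r hr =>
        (summable_placeSup_rpow K hr).comp_injective Subtype.val_injective
      le_ν := fun x hx => hc _ hx
      lipschitz := fun i => ?_
      card_ι := by rw [hcard, hrank]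
      bijective := hbij }, fun _ => rfl, fun _ => rfl⟩
  obtain ⟨C, R, hC, h⟩ := hlip ((e i : 𝓞 K) : K)
  refine ⟨C, R, hC, fun x hR hx => ?_⟩
  obtain ⟨h1, h2⟩ := h _ hR (hne' hx)
  simp only [hadd, htwo]
  refine ⟨h1, fun h3 => ?_⟩
  obtain ⟨h4, h5⟩ := h2 h3
  refine ⟨fun h0 => h4 ?_, h5⟩
  rw [← hadd, h0]
  rfl

end IdealData

/-! ### Partial zeta functions and the Dedekind zeta function near `1`. -/

section UnitOrbits

open NumberField NumberField.Units NumberField.Units.dirichletUnitTheorem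
open scoped nonZeroDivisors

variable {K : Type*} [Field K] [NumberField K]

variable (K) in
theorem bijective_torsion_mul_fundSystem : Function.Bijective
    fun p : torsion K × (Fin (rank K) → ℤ) => (p.1 * ∏ i, fundSystem K i ^ p.2 i : (𝓞 K)ˣ) :=
  Function.bijective_iff_existsUnique _ |>.2 fun u => by
    obtain ⟨p, hp, huniq⟩ := exist_unique_eq_mul_prod K u
    exact ⟨p, hp.symm, fun q hq => huniq q hq.symm⟩

theorem coe_unit_ne_zero {F : Type*} [Field F] (u : (𝓞 F)ˣ) : (u : F) ≠ 0 :=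
  RingOfIntegers.coe_ne_zero_iff.2 u.ne_zero

/-- The sum of the weights over an orbit of the units is the number of roots of unity. -/
theorem hasSum_placeWeight_units {x : K} (hx : x ≠ 0) :
    HasSum (fun u : (𝓞 K)ˣ => placeWeight ((u : K) * x)) (Units.torsionOrder K) := by
  have := Fintype.ofFinite (torsion K)
  have h0 := hasSum_tentProd (torsion K) (logCoord K (placeLogs x))
  rw [← Nat.card_eq_fintype_card] at h0
  -- A unit is a root of unity times a monomial in the fundamental units with exponent vector `k`;
  -- it translates the coordinates by `k`, which turns the orbit sum into the partition of unity.
  rw [← (Equiv.ofBijective _ (bijective_torsion_mul_fundSystem K)).hasSum_iff]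
  refine h0.congr_fun ?_
  rintro ⟨ζ, k⟩
  rw [Function.comp_apply, Equiv.ofBijective_apply,
    placeWeight_of_ne_zero (mul_ne_zero (coe_unit_ne_zero _) hx),
    placeLogs_mul (coe_unit_ne_zero _) hx, map_add, logCoord_unit, add_comm]
  rfl

variable {J : (Ideal (𝓞 K))⁰} {C : ClassGroup (𝓞 K)}

theorem exists_generator (hJ : ClassGroup.mk0 J = C⁻¹)
    (I : {I : (Ideal (𝓞 K))⁰ // ClassGroup.mk0 I = C}) :
    ∃ x : 𝓞 K, x ≠ 0 ∧ Ideal.span {x} = (I.1 : Ideal (𝓞 K)) * J := by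
  have h1 : ClassGroup.mk0 (I.1 * J) = 1 := by
    rw [map_mul, I.2, hJ, mul_inv_cancel]
  have h2 := (ClassGroup.mk0_eq_one_iff (I.1 * J).2).1 h1
  obtain ⟨x, hx⟩ := h2.principal
  rw [Submonoid.coe_mul] at hx
  refine ⟨x, ?_, hx.symm⟩
  rintro rfl
  have h3 := nonZeroDivisors.coe_ne_zero (I.1 * J)
  rw [Submonoid.coe_mul, hx] at h3
  exact h3 (by simp)

/-- The nonzero elements of `J` are the generators of the ideals `I * J`, with `I` in the class
inverse to that of `J`. -/
theorem bijective_units_mul_generator (hJ : ClassGroup.mk0 J = C⁻¹)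
    (γ : {I : (Ideal (𝓞 K))⁰ // ClassGroup.mk0 I = C} → 𝓞 K)
    (hγ0 : ∀ I, γ I ≠ 0) (hγ : ∀ I, Ideal.span {γ I} = (I.1 : Ideal (𝓞 K)) * J)
    (hmem : ∀ p : {I : (Ideal (𝓞 K))⁰ // ClassGroup.mk0 I = C} × (𝓞 K)ˣ,
      (p.2 : 𝓞 K) * γ p.1 ∈ (J : Ideal (𝓞 K))) :
    Function.Bijective fun p : {I : (Ideal (𝓞 K))⁰ // ClassGroup.mk0 I = C} × (𝓞 K)ˣ =>
      (⟨⟨(p.2 : 𝓞 K) * γ p.1, hmem p⟩, fun h => mul_ne_zero p.2.ne_zero (hγ0 p.1)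
        (congrArg Subtype.val h)⟩ : {x : (J : Ideal (𝓞 K)) // x ≠ 0}) := by
  constructor
  · rintro ⟨I, u⟩ ⟨I', u'⟩ h
    have h1 : (u : 𝓞 K) * γ I = u' * γ I' := congrArg (fun x => x.1.1) h
    have h2 : Ideal.span {γ I} = Ideal.span {γ I'} := by
      rw [← Ideal.span_singleton_mul_left_unit u.isUnit, h1,
        Ideal.span_singleton_mul_left_unit u'.isUnit]
    rw [hγ, hγ] at h2
    have h3 : I = I' := Subtype.ext (Subtype.ext
      (mul_right_cancel₀ (nonZeroDivisors.coe_ne_zero J) h2))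
    subst h3
    have h4 : u = u' := Units.ext (mul_right_cancel₀ (hγ0 I) h1)
    rw [h4]
  · rintro ⟨⟨x, hxJ⟩, hx⟩
    have hx0 : x ≠ 0 := fun h => hx (Subtype.ext h)
    obtain ⟨I, hI⟩ := Ideal.dvd_iff_le.2 ((Ideal.span_singleton_le_iff_mem _).2 hxJ)
    have hI0 : I ∈ (Ideal (𝓞 K))⁰ := by
      refine mem_nonZeroDivisors_of_ne_zero ?_
      rintro rfl
      rw [Submodule.zero_eq_bot, Ideal.mul_bot, Ideal.span_singleton_eq_bot] at hI
      exact hx0 hI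
    have hclass : ClassGroup.mk0 ⟨I, hI0⟩ = C := by
      have h1 : ClassGroup.mk0 (J * ⟨I, hI0⟩) = 1 := by
        rw [ClassGroup.mk0_eq_one_iff (J * ⟨I, hI0⟩).2]
        exact ⟨x, hI.symm⟩
      rw [map_mul, hJ, inv_mul_eq_one] at h1
      exact h1.symm
    have h2 : Associated (γ ⟨⟨I, hI0⟩, hclass⟩) x := by
      rw [← Ideal.span_singleton_eq_span_singleton, hγ, hI, mul_comm]
    obtain ⟨u, hu⟩ := h2
    refine ⟨(⟨⟨I, hI0⟩, hclass⟩, u), Subtype.ext (Subtype.ext ?_)⟩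
    exact (mul_comm _ _).trans hu

theorem hasSum_subtype_ne_zero {Λ E : Type*} [Zero Λ] [AddCommGroup E] [TopologicalSpace E]
    {f : Λ → E} {a : E} (h0 : f 0 = 0) (hf : HasSum f a) :
    HasSum (fun x : {x : Λ // x ≠ 0} => f x) a := by
  refine (hasSum_subtype_iff_of_support_subset (s := {x | x ≠ 0}) ?_).2 hf
  rintro x hx rfl
  exact hx h0

/-- Decomposition of a sum over a nonzero ideal into orbits of the units. -/
theorem hasSum_class {E : Type*} [AddCommGroup E] [TopologicalSpace E] [ContinuousAdd E]
    [RegularSpace E] (hJ : ClassGroup.mk0 J = C⁻¹)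
    {f : ↥(J : Ideal (𝓞 K)) → E} {a : E} (h0 : f 0 = 0) (hf : HasSum f a)
    (g : {I : (Ideal (𝓞 K))⁰ // ClassGroup.mk0 I = C} → E)
    (hg : ∀ I (γ : 𝓞 K), γ ≠ 0 → Ideal.span {γ} = (I.1 : Ideal (𝓞 K)) * J →
      ∀ hmem : ∀ u : (𝓞 K)ˣ, (u : 𝓞 K) * γ ∈ (J : Ideal (𝓞 K)),
        HasSum (fun u : (𝓞 K)ˣ => f ⟨(u : 𝓞 K) * γ, hmem u⟩) (g I)) :
    HasSum g a := by
  choose γ hγ0 hγ using exists_generator (J := J) (C := C) hJ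
  have hmem (p : {I : (Ideal (𝓞 K))⁰ // ClassGroup.mk0 I = C} × (𝓞 K)ˣ) :
      (p.2 : 𝓞 K) * γ p.1 ∈ (J : Ideal (𝓞 K)) := by
    have h2 : γ p.1 ∈ (p.1.1 : Ideal (𝓞 K)) * J := by
      rw [← hγ]
      exact Ideal.mem_span_singleton_self _
    exact Ideal.mul_mem_left (J : Ideal (𝓞 K)) _ (Ideal.mul_le_right h2)
  have h1 : HasSum (fun x : {x : (J : Ideal (𝓞 K)) // x ≠ 0} => f x) a :=
    hasSum_subtype_ne_zero h0 hf
  rw [← (Equiv.ofBijective _ (bijective_units_mul_generator hJ γ hγ0 hγ hmem)).hasSum_iff] at h1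
  have h2 : HasSum (fun p : {I : (Ideal (𝓞 K))⁰ // ClassGroup.mk0 I = C} × (𝓞 K)ˣ =>
      f ⟨(p.2 : 𝓞 K) * γ p.1, hmem p⟩) a := h1.congr_fun fun p => rfl
  exact h2.prod_fiberwise fun I => hg I (γ I) (hγ0 I) (hγ I) fun u => hmem (I, u)

theorem placeNorm_unit_mul_generator {I : (Ideal (𝓞 K))⁰} {γ : 𝓞 K}
    (hγ : Ideal.span {γ} = (I : Ideal (𝓞 K)) * J) (u : (𝓞 K)ˣ) :
    placeNorm (((u : 𝓞 K) * γ : 𝓞 K) : K) =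
      (Ideal.absNorm (I : Ideal (𝓞 K)) : ℝ) * Ideal.absNorm (J : Ideal (𝓞 K)) := by
  rw [placeNorm_eq_absNorm, Ideal.span_singleton_mul_left_unit u.isUnit, hγ, map_mul, Nat.cast_mul]

/-- The partial zeta function of an ideal class continues meromorphically to a neighbourhood
of `1`. -/
theorem exists_meromorphicAt_class (C : ClassGroup (𝓞 K)) : ∃ Z : ℂ → ℂ, MeromorphicAt Z 1 ∧
    ∀ s : ℂ, 1 < s.re →
      Summable (fun I : {I : (Ideal (𝓞 K))⁰ // ClassGroup.mk0 I = C} => ‖absNormCpow K s I‖) ∧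
      Z s = ∑' I : {I : (Ideal (𝓞 K))⁰ // ClassGroup.mk0 I = C}, absNormCpow K s I := by
  obtain ⟨J, hJ⟩ := ClassGroup.mk0_surjective C⁻¹
  obtain ⟨n, ι, _, D, hg, hν⟩ := exists_homogeneousData (nonZeroDivisors.coe_ne_zero J)
  obtain ⟨Z, hZ, hZs⟩ := D.exists_meromorphicAt
  have hw : (Units.torsionOrder K : ℂ) ≠ 0 := Nat.cast_ne_zero.2 (Units.torsionOrder_ne_zero K)
  have hN : (Ideal.absNorm (J : Ideal (𝓞 K)) : ℂ) ≠ 0 :=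
    Nat.cast_ne_zero.2 (absNorm_pos_of_nonZeroDivisors K J).ne'
  -- The norm is constant on the orbit, equal to the product of the norms of `I` and `J`; only the
  -- weights are summed.
  have horbit (I : {I : (Ideal (𝓞 K))⁰ // ClassGroup.mk0 I = C}) (γ : 𝓞 K) (hγ0 : γ ≠ 0)
      (hγ : Ideal.span {γ} = (I.1 : Ideal (𝓞 K)) * J)
      (hmem : ∀ u : (𝓞 K)ˣ, (u : 𝓞 K) * γ ∈ (J : Ideal (𝓞 K))) (s : ℂ) :
      HasSum (fun u : (𝓞 K)ˣ => D.term s ⟨(u : 𝓞 K) * γ, hmem u⟩)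
        (Units.torsionOrder K * (absNormCpow K s I * absNormCpow K s J)) := by
    have h1 := (Complex.hasSum_ofReal.2
      (hasSum_placeWeight_units (RingOfIntegers.coe_ne_zero_iff.2 hγ0))).mul_right
      (absNormCpow K s I * absNormCpow K s J)
    rw [Complex.ofReal_natCast] at h1
    refine h1.congr_fun fun u => ?_
    rw [HomogeneousData.term, hg, hν, placeNorm_unit_mul_generator hγ, absNormCpow_apply,
      absNormCpow_apply, Complex.ofReal_mul, Complex.ofReal_natCast, Complex.ofReal_natCast,
      Complex.natCast_mul_natCast_cpow]
    exact congrArg (fun y : K => (placeWeight y : ℂ) * _) (map_mul (algebraMap (𝓞 K) K) _ _)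
  have hterm (s : ℂ) : D.term s 0 = 0 := by rw [HomogeneousData.term, D.g_zero]; simp
  have hnorm (s : ℂ) (hs : 1 < s.re) :
      Summable (fun I : {I : (Ideal (𝓞 K))⁰ // ClassGroup.mk0 I = C} => ‖absNormCpow K s I‖) := by
    -- The norms of the terms depend only on `s.re`, so absolute convergence is read off at that
    -- real point.
    have hσ : 1 < ((s.re : ℂ)).re := hs
    have h1 := hasSum_class hJ (hterm (s.re : ℂ)) (D.summable_norm_term hσ).of_norm.hasSum _
      fun I γ hγ0 hγ hmem => horbit I γ hγ0 hγ hmem (s.re : ℂ)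
    have h2 := h1.summable.norm.mul_left ((Units.torsionOrder K : ℝ)⁻¹ * ‖absNormCpow K s J‖⁻¹)
    refine h2.congr fun I => ?_
    rw [norm_mul, norm_mul, Complex.norm_natCast, norm_absNormCpow, norm_absNormCpow,
      norm_absNormCpow, norm_absNormCpow, Complex.ofReal_re]
    have h3 : (0 : ℝ) < Ideal.absNorm (J : Ideal (𝓞 K)) :=
      Nat.cast_pos.2 (absNorm_pos_of_nonZeroDivisors K J)
    have h4 : (Units.torsionOrder K : ℝ) ≠ 0 := Nat.cast_ne_zero.2 (Units.torsionOrder_ne_zero K)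
    have h5 := (Real.rpow_pos_of_pos h3 (-s.re)).ne'
    field_simp
  refine ⟨fun s => (Units.torsionOrder K : ℂ)⁻¹ *
    (Ideal.absNorm (J : Ideal (𝓞 K)) : ℂ) ^ s * Z s, ?_, fun s hs => ⟨hnorm s hs, ?_⟩⟩
  · refine MeromorphicAt.fun_mul (AnalyticAt.meromorphicAt ?_) hZ
    refine Differentiable.analyticAt (fun s => ?_) 1
    exact (DifferentiableAt.const_cpow differentiableAt_id (Or.inl hN)).const_mul _
  · have h1 := hasSum_class hJ (hterm s) (D.summable_norm_term hs).of_norm.hasSum _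
      fun I γ hγ0 hγ hmem => horbit I γ hγ0 hγ hmem s
    beta_reduce
    rw [hZs s hs, ← h1.tsum_eq, tsum_mul_left, tsum_mul_right, absNormCpow_apply K s J,
      Complex.cpow_neg]
    have h5 : (Ideal.absNorm (J : Ideal (𝓞 K)) : ℂ) ^ s ≠ 0 := by
      rw [Complex.cpow_ne_zero_iff]
      exact Or.inl hN
    field_simp

variable (K) in
/-- The Dedekind zeta function converges absolutely for `Re s > 1`, and it continues
meromorphically to a neighbourhood of `1`. -/
theorem exists_meromorphicAt_dedekindZeta :
    (∀ s : ℂ, 1 < s.re → Summable fun I : (Ideal (𝓞 K))⁰ => ‖absNormCpow K s I‖) ∧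
    ∃ Z : ℂ → ℂ, MeromorphicAt Z 1 ∧ ∀ s : ℂ, 1 < s.re → Z s = dedekindZeta K s := by
  choose Z hZ hZs using exists_meromorphicAt_class (K := K)
  let e := Equiv.sigmaFiberEquiv (ClassGroup.mk0 : (Ideal (𝓞 K))⁰ → ClassGroup (𝓞 K))
  have hsum (s : ℂ) (hs : 1 < s.re) :
      Summable fun I : (Ideal (𝓞 K))⁰ => ‖absNormCpow K s I‖ := by
    rw [← e.summable_iff]
    exact (summable_sigma_of_nonneg fun _ => norm_nonneg _).2
      ⟨fun C => (hZs C s hs).1, Summable.of_finite⟩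
  refine ⟨hsum, fun s => ∑ C, Z C s, ?_, fun s hs => ?_⟩
  · exact MeromorphicAt.fun_sum fun C _ => hZ C
  · rw [dedekindZeta_eq_tsum K (hsum s hs), ← e.tsum_eq]
    have h1 : Summable fun p => absNormCpow K s (e p) := e.summable_iff.2 (hsum s hs).of_norm
    rw [h1.tsum_sigma, tsum_fintype]
    exact Finset.sum_congr rfl fun C _ => (hZs C s hs).2

/-- A meromorphic function that has a limit along the real axis from the right has that limit. -/
theorem tendsto_of_meromorphicAt_of_tendsto_ofReal {f : ℂ → ℂ} {x : ℝ} {a : ℂ}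
    (hf : MeromorphicAt f x) (h : Tendsto (fun t : ℝ => f t) (𝓝[>] x) (𝓝 a)) :
    Tendsto f (𝓝[≠] (x : ℂ)) (𝓝 a) := by
  have hmap : Tendsto (fun t : ℝ => (t : ℂ)) (𝓝[>] x) (𝓝[≠] (x : ℂ)) := by
    refine tendsto_nhdsWithin_iff.2 ⟨(Complex.continuous_ofReal.tendsto x).mono_left
      nhdsWithin_le_nhds, ?_⟩
    filter_upwards [self_mem_nhdsWithin] with t ht
    simpa using (Set.mem_Ioi.1 ht).ne'
  -- With nonnegative order a limit exists and must be `a`; with a pole the function would be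
  -- unbounded along the real axis.
  by_cases hord : 0 ≤ meromorphicOrderAt f x
  · obtain ⟨c, hc⟩ := tendsto_nhds_of_meromorphicOrderAt_nonneg hf hord
    rwa [tendsto_nhds_unique h (hc.comp hmap)]
  · have h1 := (tendsto_cobounded_of_meromorphicOrderAt_neg (not_le.1 hord)).comp hmap
    exact absurd h1 (h.not_tendsto (Metric.disjoint_nhds_cobounded a))

-- Meromorphy upgrades the class number formula for `K`, a limit along real `s > 1`, to a limit
-- through all complex `s ≠ 1`.
variable (K) in
theorem tendsto_sub_one_mul_of_eq_dedekindZeta {Z : ℂ → ℂ} (hZ : MeromorphicAt Z 1)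
    (hZs : ∀ s : ℂ, 1 < s.re → Z s = dedekindZeta K s) :
    Tendsto (fun s => (s - 1) * Z s) (𝓝[≠] 1) (𝓝 (dedekindZeta_residue K : ℂ)) := by
  have h1 : MeromorphicAt (fun s : ℂ => (s - 1) * Z s) ((1 : ℝ) : ℂ) := by
    rw [Complex.ofReal_one]
    exact ((MeromorphicAt.id 1).fun_sub (MeromorphicAt.const 1 1)).fun_mul hZ
  have h2 := tendsto_of_meromorphicAt_of_tendsto_ofReal h1 (a := (dedekindZeta_residue K : ℂ)) <| by
    refine (tendsto_sub_one_mul_dedekindZeta_nhdsGT K).congr' ?_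
    filter_upwards [self_mem_nhdsWithin] with t ht
    rw [hZs]
    simpa using ht
  rwa [Complex.ofReal_one] at h2

end UnitOrbits

/-! ### Real and complex embeddings of a product. -/

section RingHomsOfProducts

open NumberField

variable {ι : Type*} [Finite ι] {R : ι → Type*} [∀ i, CommRing (R i)]
  {F : Type*} [CommRing F] [IsDomain F]

/-- A ring homomorphism from a finite product to a domain factors through exactly one of the
projections. -/
theorem bijective_comp_evalRingHom : Function.Bijective
    fun p : Σ i, R i →+* F => p.2.comp (Pi.evalRingHom R p.1) := by
  classical
  constructor
  · rintro ⟨i, g⟩ ⟨j, g'⟩ h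
    have h1 (x : ∀ i, R i) : g (x i) = g' (x j) := congrArg (fun f : (∀ i, R i) →+* F => f x) h
    have hij : i = j := by
      by_contra hij
      have h2 := h1 (Pi.single i 1)
      rw [Pi.single_eq_same, Pi.single_eq_of_ne (Ne.symm hij), map_one, map_zero] at h2
      exact one_ne_zero h2
    subst hij
    have h3 : g = g' := by
      ext y
      simpa using h1 (Pi.single i y)
    rw [h3]
  · intro f
    have := Fintype.ofFinite ι
    -- The idempotents sum to `1`, so one survives. Elements vanishing at `i` are annihilated by it,
    -- hence die in the domain.
    obtain ⟨i, hi⟩ : ∃ i, f (Pi.single i 1) ≠ 0 := by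
      by_contra! h
      have h1 : (∑ i, Pi.single i (1 : R i)) = 1 := Finset.univ_sum_single 1
      have h2 := congrArg f h1
      rw [map_sum, map_one, Finset.sum_eq_zero fun i _ => h i] at h2
      exact zero_ne_one h2
    have hker : RingHom.ker (Pi.evalRingHom R i) ≤ RingHom.ker f := by
      intro x hx
      rw [RingHom.mem_ker, Pi.evalRingHom_apply] at hx
      rw [RingHom.mem_ker]
      have h1 : x * Pi.single i 1 = 0 := by
        rw [← Pi.single_mul_right, hx, zero_mul, Pi.single_zero]
      have h2 := congrArg f h1
      rw [map_mul, map_zero] at h2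
      exact (mul_eq_zero.1 h2).resolve_right hi
    have hsurj : Function.Surjective (Pi.evalRingHom R i) := Function.surjective_eval i
    exact ⟨⟨i, RingHom.liftOfSurjective _ hsurj ⟨f, hker⟩⟩,
      RingHom.liftOfRightInverse_comp _ _ (Function.rightInverse_surjInv hsurj) ⟨f, hker⟩⟩

theorem isReal_iff_range_subset {K : Type*} [Field K] (φ : K →+* ℂ) :
    ComplexEmbedding.IsReal φ ↔ Set.range φ ⊆ Set.range ((↑) : ℝ → ℂ) := by
  rw [ComplexEmbedding.isReal_iff]
  constructor
  · rintro h _ ⟨x, rfl⟩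
    exact ⟨_, ComplexEmbedding.IsReal.coe_embedding_apply (ComplexEmbedding.isReal_iff.2 h) x⟩
  · intro h
    ext x
    obtain ⟨t, ht⟩ := h ⟨x, rfl⟩
    rw [ComplexEmbedding.conjugate_coe_eq, ← ht, Complex.conj_ofReal]

theorem card_ringHom_real (K : Type*) [Field K] [NumberField K] :
    Nat.card (K →+* ℝ) = InfinitePlace.nrRealPlaces K := by
  classical
  rw [← InfinitePlace.card_real_embeddings, ← Nat.card_eq_fintype_card]
  refine Nat.card_eq_of_bijective
    (fun f => ⟨Complex.ofRealHom.comp f, (isReal_iff_range_subset _).2 ?_⟩) ⟨?_, ?_⟩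
  · rintro _ ⟨x, rfl⟩
    exact ⟨f x, rfl⟩
  · intro f g h
    ext x
    exact Complex.ofReal_injective (congrArg (fun φ => φ.1 x) h)
  · rintro ⟨φ, hφ⟩
    refine ⟨hφ.embedding, Subtype.ext (RingHom.ext fun x => ?_)⟩
    exact hφ.coe_embedding_apply x

theorem finite_ringHom_real (K : Type*) [Field K] [NumberField K] : Finite (K →+* ℝ) :=
  Finite.of_injective (fun f : K →+* ℝ => Complex.ofRealHom.comp f) fun f g h => by
    ext x
    exact Complex.ofReal_injective (congrArg (fun φ : K →+* ℂ => φ x) h)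

variable {m : ℕ} (K : Fin m → Type*) [∀ i, Field (K i)] [∀ i, NumberField (K i)]

theorem r₁_pi : r₁ (∀ i, K i) = ∑ i, InfinitePlace.nrRealPlaces (K i) := by
  have := fun i => finite_ringHom_real (K i)
  rw [r₁, ← Nat.card_eq_of_bijective _ (bijective_comp_evalRingHom (R := K) (F := ℝ)),
    Nat.card_sigma]
  exact Finset.sum_congr rfl fun i _ => card_ringHom_real (K i)

theorem r₂_pi : r₂ (∀ i, K i) = ∑ i, InfinitePlace.nrComplexPlaces (K i) := by
  classical
  let e := Equiv.ofBijective _ (bijective_comp_evalRingHom (R := K) (F := ℂ))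
  have hrange (p : Σ i, K i →+* ℂ) : Set.range (e p) = Set.range p.2 := by
    have : ⇑(e p) = p.2 ∘ Function.eval p.1 := rfl
    rw [this, (Function.surjective_eval p.1).range_comp]
  have e1 : {p : Σ i, K i →+* ℂ // ¬ ComplexEmbedding.IsReal p.2} ≃
      {f : (∀ i, K i) →+* ℂ // ¬ Set.range f ⊆ Set.range ((↑) : ℝ → ℂ)} :=
    e.subtypeEquiv fun p => by rw [hrange, isReal_iff_range_subset]
  have e2 : {p : Σ i, K i →+* ℂ // ¬ ComplexEmbedding.IsReal p.2} ≃
      Σ i, {φ : K i →+* ℂ // ¬ ComplexEmbedding.IsReal φ} :=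
    { toFun := fun p => ⟨p.1.1, p.1.2, p.2⟩
      invFun := fun p => ⟨⟨p.1, p.2.1⟩, p.2.2⟩
      left_inv := fun _ => rfl
      right_inv := fun _ => rfl }
  rw [r₂, ← Nat.card_congr e1, Nat.card_congr e2, Nat.card_sigma]
  have h (i : Fin m) : Nat.card {φ : K i →+* ℂ // ¬ ComplexEmbedding.IsReal φ} =
      2 * InfinitePlace.nrComplexPlaces (K i) := by
    rw [← InfinitePlace.card_complex_embeddings, Nat.card_eq_fintype_card]
  simp_rw [h]
  rw [← Finset.mul_sum, Nat.mul_div_cancel_left _ two_pos]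

end RingHomsOfProducts

/-! ### Comparison of Euler products. -/

section EulerProducts

open scoped Classical in
theorem hasProd_ite_one {Z : Type*} {T T' : Z → Prop} [Fintype {z // T' z}]
    (hT : ∀ z, T z ↔ ¬ T' z) (k : Z → ℂ) :
    HasProd (fun z => if T z then 1 else k z) (∏ z : {z // T' z}, k z) := by
  have h1 : HasProd (fun z : {z // T' z} => k z) (∏ z : {z // T' z}, k z) := hasProd_fintype _
  refine (Subtype.val_injective.hasProd_iff fun z hz => if_pos ((hT z).2 fun h => ?_)).1
    (h1.congr_fun fun z => if_neg fun h => (hT _).1 h z.2)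
  exact hz ⟨⟨z, h⟩, rfl⟩

/-- Two Euler products that agree up to finitely many factors. -/
theorem hasProd_of_equiv {X Y : Type*} {P P' : X → Prop} {Q Q' : Y → Prop}
    [Fintype {x // P' x}] [Fintype {y // Q' y}] (hP : ∀ x, P x ↔ ¬ P' x) (hQ : ∀ y, Q y ↔ ¬ Q' y)
    (e : {x // P x} ≃ {y // Q y}) {f : X → ℂ} {g : Y → ℂ} (hfg : ∀ x, g (e x) = f x)
    (hf : ∀ x, f x ≠ 0) {a : ℂ} (h : HasProd f a) :
    HasProd g (a * (∏ x : {x // P' x}, (f x)⁻¹) * ∏ y : {y // Q' y}, g y) := by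
  classical
  -- Multiplying by the inverses of the finitely many exceptional factors makes them `1`, so the
  -- product restricts to the indices with `P`.
  have h1 := h.mul (hasProd_ite_one hP fun x => (f x)⁻¹)
  have h2 : HasProd (fun x : {x // P x} => f x) (a * ∏ x : {x // P' x}, (f x)⁻¹) := by
    rw [← Subtype.val_injective.hasProd_iff (g := (Subtype.val : {x // P x} → X))] at h1
    · refine h1.congr_fun fun x => ?_
      rw [Function.comp_apply, if_pos x.2, mul_one]
    · intro x hx
      rw [if_neg fun h => hx ⟨⟨x, h⟩, rfl⟩, mul_inv_cancel₀ (hf x)]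
  have h3 : HasProd (fun y : {y // Q y} => g y) (a * ∏ x : {x // P' x}, (f x)⁻¹) := by
    rw [← e.hasProd_iff]
    exact h2.congr_fun fun x => hfg x
  have h4 : HasProd (fun y => if Q y then g y else 1) (a * ∏ x : {x // P' x}, (f x)⁻¹) := by
    refine (Subtype.val_injective.hasProd_iff fun y hy => if_neg fun h => ?_).1
      (h3.congr_fun (g := _) fun y => if_pos y.2)
    exact hy ⟨⟨y, h⟩, rfl⟩
  refine (h4.mul (hasProd_ite_one hQ g)).congr_fun fun y => ?_
  split_ifs <;> simp

/-- The Euler product of a finite product of rings. -/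
theorem hasProd_eulerFactor_pi {ι : Type*} [Fintype ι] (R : ι → Type*) [∀ i, CommRing (R i)]
    {s : ℂ} {z : ι → ℂ} (h : ∀ i, HasProd (eulerFactor (R i) s) (z i)) :
    HasProd (eulerFactor (∀ i, R i) s) (∏ i, z i) := by
  classical
  rw [← (maximalSpectrumPi R).hasProd_iff]
  have h1 (i : ι) : HasProd (fun p : Σ i, MaximalSpectrum (R i) =>
      if p.1 = i then eulerFactor (R p.1) s p.2 else 1) (z i) := by
    rw [← (sigma_mk_injective (i := i)).hasProd_iff]
    · exact (h i).congr_fun fun p => if_pos rfl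
    · rintro ⟨j, p⟩ hp
      refine if_neg fun hij => hp ?_
      subst hij
      exact ⟨p, rfl⟩
  refine (hasProd_prod fun i (_ : i ∈ Finset.univ) => h1 i).congr_fun fun p => ?_
  rw [Finset.prod_ite_eq Finset.univ p.1, if_pos (Finset.mem_univ _), Function.comp_apply,
    eulerFactor, eulerFactor, card_quotient_maximalSpectrumPi]

theorem eulerFactor_inv (R : Type*) [CommRing R] (s : ℂ) (p : MaximalSpectrum R) :
    (eulerFactor R s p)⁻¹ = 1 - (Nat.card (R ⧸ p.asIdeal) : ℂ) ^ (-s) := inv_inv _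

theorem one_lt_card_quotient {R : Type*} [CommRing R] (p : MaximalSpectrum R)
    [Finite (R ⧸ p.asIdeal)] : 1 < Nat.card (R ⧸ p.asIdeal) := by
  have := Ideal.Quotient.nontrivial_iff.2 p.isMaximal.ne_top
  exact Finite.one_lt_card

theorem eulerFactor_ne_zero {R : Type*} [CommRing R] {s : ℂ} (hs : 0 < s.re)
    (p : MaximalSpectrum R) : eulerFactor R s p ≠ 0 := by
  refine inv_ne_zero ?_
  rcases finite_or_infinite (R ⧸ p.asIdeal) with hp | hp
  · have h1 := one_lt_card_quotient p
    intro h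
    have h2 := congrArg norm (sub_eq_zero.1 h)
    rw [norm_one, Complex.norm_natCast_cpow_of_pos (by omega)] at h2
    refine (Real.rpow_lt_one_of_one_lt_of_neg (by exact_mod_cast h1) ?_).ne h2.symm
    rw [Complex.neg_re]
    linarith
  -- For an infinite residue field `Nat.card` is `0`, and the Euler factor is `1`.
  · rw [Nat.card_eq_zero_of_infinite, Nat.cast_zero, Complex.zero_cpow, sub_zero]
    · exact one_ne_zero
    · intro h
      rw [neg_eq_zero.1 h] at hs
      simp at hs

theorem analyticAt_inv_eulerFactor {R : Type*} [CommRing R] (p : MaximalSpectrum R)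
    [Finite (R ⧸ p.asIdeal)] :
    AnalyticAt ℂ (fun s => (eulerFactor R s p)⁻¹) 1 := by
  have h1 : (Nat.card (R ⧸ p.asIdeal) : ℂ) ≠ 0 := Nat.cast_ne_zero.2 Nat.card_pos.ne'
  simp_rw [eulerFactor_inv]
  refine Differentiable.analyticAt (fun s => ?_) 1
  exact (differentiableAt_const _).sub
    (DifferentiableAt.const_cpow differentiableAt_id.neg (Or.inl h1))

theorem analyticAt_eulerFactor {R : Type*} [CommRing R] (p : MaximalSpectrum R)
    [Finite (R ⧸ p.asIdeal)] : AnalyticAt ℂ (fun s => eulerFactor R s p) 1 := by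
  have h1 := (analyticAt_inv_eulerFactor p).fun_inv
    (inv_ne_zero (eulerFactor_ne_zero (by simp) p))
  simpa only [inv_inv] using h1

theorem finite_quotient_of_le {R : Type*} [CommRing R] {I J : Ideal R} (h : I ≤ J)
    [Finite (R ⧸ I)] : Finite (R ⧸ J) :=
  Finite.of_surjective _ (Ideal.Quotient.factor_surjective h)

/-- Comparison of the Euler products of a ring and an integral extension of finite index. -/
theorem exists_comparison_factor {R S : Type*} [CommRing R] [CommRing S] [Algebra R S]
    [FaithfulSMul R S] [Algebra.IsIntegral R S] {N : ℕ}
    (hN : ∀ x : S, (N : S) * x ∈ (algebraMap R S).range) [Finite (S ⧸ Ideal.span {(N : S)})] :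
    ∃ C : ℂ → ℂ, AnalyticAt ℂ C 1 ∧
      C 1 = (Nat.card (S ⧸ Ideal.span {(N : S)})ˣ : ℂ) /
        (Nat.card (R ⧸ (Ideal.span {(N : S)}).comap (algebraMap R S))ˣ *
          (algebraMap R S).range.toAddSubgroup.index) ∧
      ∀ (s z : ℂ), 0 < s.re → HasProd (eulerFactor S s) z →
        HasProd (eulerFactor R s) (z * C s) := by
  set f : Ideal S := Ideal.span {(N : S)}
  set f' : Ideal R := f.comap (algebraMap R S)
  have hf : ∀ x ∈ f, x ∈ (algebraMap R S).range := by
    intro x hx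
    obtain ⟨y, rfl⟩ := Ideal.mem_span_singleton'.1 hx
    rw [mul_comm]
    exact hN y
  have hcard : Nat.card (S ⧸ f) = Nat.card (R ⧸ f') * (algebraMap R S).range.toAddSubgroup.index :=
    card_quotient_eq_mul_index f hf
  have hf' : Finite (R ⧸ f') := Finite.of_injective _ (Ideal.quotientMap_injective (I := f))
  have hS0 : (Nat.card (S ⧸ f) : ℂ) ≠ 0 := Nat.cast_ne_zero.2 Nat.card_pos.ne'
  have := finite_maximalSpectrum_ge f
  have := finite_maximalSpectrum_ge f'
  have := Fintype.ofFinite {m : MaximalSpectrum S // f ≤ m.asIdeal}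
  have := Fintype.ofFinite {m : MaximalSpectrum R // f' ≤ m.asIdeal}
  have hfinS (m : {m : MaximalSpectrum S // f ≤ m.asIdeal}) : Finite (S ⧸ m.1.asIdeal) :=
    finite_quotient_of_le m.2
  have hfinR (m : {m : MaximalSpectrum R // f' ≤ m.asIdeal}) : Finite (R ⧸ m.1.asIdeal) :=
    finite_quotient_of_le m.2
  -- The factors of `S` above `N` are removed and those of `R` inserted. At `s = 1` each product is
  -- a ratio of the number of units to the order of a finite quotient, and the two orders differ by
  -- the index of `R`.
  refine ⟨fun s => (∏ m : {m : MaximalSpectrum S // f ≤ m.asIdeal}, (eulerFactor S s m)⁻¹) *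
    ∏ m : {m : MaximalSpectrum R // f' ≤ m.asIdeal}, eulerFactor R s m, ?_, ?_, ?_⟩
  · exact (Finset.analyticAt_fun_prod _ fun m _ => analyticAt_inv_eulerFactor m.1).fun_mul
      (Finset.analyticAt_fun_prod _ fun m _ => analyticAt_eulerFactor m.1)
  · have hS := card_units_quotient f
    have hR := card_units_quotient f'
    have hRprod : ∏ m : {m : MaximalSpectrum R // f' ≤ m.asIdeal}, eulerFactor R 1 m =
        (∏ m : {m : MaximalSpectrum R // f' ≤ m.asIdeal},
          (1 - (Nat.card (R ⧸ m.1.asIdeal) : ℂ)⁻¹))⁻¹ := by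
      rw [← Finset.prod_inv_distrib]
      simp only [eulerFactor, Complex.cpow_neg_one]
    have hSprod : ∏ m : {m : MaximalSpectrum S // f ≤ m.asIdeal}, (eulerFactor S 1 m)⁻¹ =
        ∏ m : {m : MaximalSpectrum S // f ≤ m.asIdeal},
          (1 - (Nat.card (S ⧸ m.1.asIdeal) : ℂ)⁻¹) := by
      simp only [eulerFactor_inv, Complex.cpow_neg_one]
    have hR0 : (Nat.card (R ⧸ f')ˣ : ℂ) ≠ 0 := Nat.cast_ne_zero.2 Nat.card_pos.ne'
    beta_reduce
    rw [hRprod, hSprod, hS]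
    rw [hR] at hR0 ⊢
    rw [hcard, Nat.cast_mul] at hS0 ⊢
    have h1 := left_ne_zero_of_mul hS0
    have h2 := right_ne_zero_of_mul hS0
    have h3 := right_ne_zero_of_mul hR0
    generalize ∏ m : {m : MaximalSpectrum S // f ≤ m.asIdeal},
      (1 - (Nat.card (S ⧸ m.1.asIdeal) : ℂ)⁻¹) = a
    generalize ∏ m : {m : MaximalSpectrum R // f' ≤ m.asIdeal},
      (1 - (Nat.card (R ⧸ m.1.asIdeal) : ℂ)⁻¹) = b at h3 ⊢
    field_simp
  · intro s z hs hz
    rw [← mul_assoc]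
    refine hasProd_of_equiv (P := fun m : MaximalSpectrum S => (N : S) ∉ m.asIdeal)
      (Q := fun m : MaximalSpectrum R => (N : R) ∉ m.asIdeal) (fun m => ?_) (fun m => ?_)
      (maximalSpectrumAway hN) (fun m => ?_) (fun m => eulerFactor_ne_zero hs m) hz
    · rw [span_natCast_le_iff]
    · have := m.isMaximal.isPrime
      rw [comap_span_natCast_le_iff hN]
    · rw [eulerFactor, eulerFactor, card_quotient_maximalSpectrumAway]

end EulerProducts

/-! ### Invariants of an order against those of the fields. -/

section ClassNumberFormula

open NumberField

variable {m : ℕ} {K : Fin m → Type*} [∀ i, Field (K i)] [∀ i, NumberField (K i)]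

variable (K) in
theorem card_pic_pi_ringOfIntegers :
    Nat.card (CommRing.Pic (∀ i, 𝓞 (K i))) = ∏ i, NumberField.classNumber (K i) := by
  rw [card_pic_pi (fun i => 𝓞 (K i)) K]
  refine Finset.prod_congr rfl fun i _ => ?_
  rw [← Nat.card_congr (ClassGroup.equivPic (𝓞 (K i))).toEquiv, NumberField.classNumber,
    Nat.card_eq_fintype_card]

variable (K) in
theorem finite_quotient_span_natCast {N : ℕ} (hN : 0 < N) :
    Finite ((∀ i, 𝓞 (K i)) ⧸ Ideal.span {(N : ∀ i, 𝓞 (K i))}) := by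
  have h1 : Module.Finite ℤ ((∀ i, 𝓞 (K i)) ⧸ Ideal.span {(N : ∀ i, 𝓞 (K i))}) :=
    Module.Finite.of_surjective
      (Ideal.Quotient.mk (Ideal.span {(N : ∀ i, 𝓞 (K i))})).toIntAlgHom.toLinearMap
      Ideal.Quotient.mk_surjective
  have h2 : Module.IsTorsion ℤ ((∀ i, 𝓞 (K i)) ⧸ Ideal.span {(N : ∀ i, 𝓞 (K i))}) := by
    intro x
    obtain ⟨x, rfl⟩ := Ideal.Quotient.mk_surjective x
    refine ⟨⟨N, mem_nonZeroDivisors_of_ne_zero (by exact_mod_cast hN.ne')⟩, ?_⟩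
    rw [Submonoid.smul_def, zsmul_eq_mul, Int.cast_natCast, ← map_natCast
      (Ideal.Quotient.mk (Ideal.span {(N : ∀ i, 𝓞 (K i))})), ← map_mul,
      Ideal.Quotient.eq_zero_iff_mem]
    exact Ideal.mul_mem_right _ _ (Ideal.mem_span_singleton_self _)
  exact Module.finite_of_fg_torsion _ h2

variable (O : Subring (∀ i, K i)) [IsOrder O]

/-- The class number of an order in terms of those of the number fields. -/
theorem classNumber_mul_index_mul_card_units {N : ℕ} (hN0 : 0 < N)
    (hN : ∀ x : ∀ i, 𝓞 (K i), (N : ∀ i, 𝓞 (K i)) * x ∈ (algebraMap O (∀ i, 𝓞 (K i))).range) :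
    OrderCNF.classNumber O * (orderUnits O).index *
      Nat.card (O ⧸ (Ideal.span {(N : ∀ i, 𝓞 (K i))}).comap (algebraMap O (∀ i, 𝓞 (K i))))ˣ =
    (∏ i, NumberField.classNumber (K i)) *
      Nat.card ((∀ i, 𝓞 (K i)) ⧸ Ideal.span {(N : ∀ i, 𝓞 (K i))})ˣ := by
  have := finite_quotient_span_natCast K hN0
  have : FaithfulSMul O (∀ i, K i) :=
    (faithfulSMul_iff_algebraMap_injective O (∀ i, K i)).2 Subtype.val_injective
  rw [← card_pic_pi_ringOfIntegers]
  refine card_pic_mul_index_mul_card_units (A := ∀ i, K i) _ fun x hx => ?_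
  obtain ⟨y, rfl⟩ := Ideal.mem_span_singleton'.1 hx
  rw [mul_comm]
  exact hN y

/-- Componentwise, torsion units embed in the product of the finite groups of roots of unity of the
`K i`. -/
theorem finite_torsion_units : Finite (CommGroup.torsion Oˣ) := by
  let g (i : Fin m) : Oˣ →* (𝓞 (K i))ˣ :=
    Units.map ((Pi.evalRingHom (fun i => 𝓞 (K i)) i).comp (algebraMap O (∀ i, 𝓞 (K i))) :
      O →* 𝓞 (K i))
  let f (u : CommGroup.torsion Oˣ) (i : Fin m) : Units.torsion (K i) :=
    ⟨g i u, (g i).isOfFinOrder u.2⟩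
  refine Finite.of_injective f fun u v h => Subtype.ext (Units.ext ?_)
  refine FaithfulSMul.algebraMap_injective O (∀ i, 𝓞 (K i)) (funext fun i => ?_)
  exact congrArg (fun w => ((w i : (𝓞 (K i))ˣ) : 𝓞 (K i))) h

theorem sqrt_abs_disc : Real.sqrt |(disc O : ℝ)| =
    (algebraMap O (∀ i, 𝓞 (K i))).range.toAddSubgroup.index *
      ∏ i, Real.sqrt |(discr (K i) : ℝ)| := by
  have h := congrArg (fun q : ℚ => (q : ℝ)) (abs_disc_eq O)
  push_cast at h
  rw [h, Real.sqrt_mul (by positivity), Real.sqrt_sq (by positivity),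
    Real.sqrt_prod Finset.univ fun _ _ => abs_nonneg _]

theorem prod_dedekindZeta_residue :
    ∏ i, dedekindZeta_residue (K i) = 2 ^ r₁ (∀ i, K i) * (2 * Real.pi) ^ r₂ (∀ i, K i) *
      (∏ i, Units.regulator (K i)) * (∏ i, (NumberField.classNumber (K i) : ℝ)) /
      ((∏ i, (Units.torsionOrder (K i) : ℝ)) * ∏ i, Real.sqrt |(discr (K i) : ℝ)|) := by
  simp_rw [dedekindZeta_residue_def, Finset.prod_div_distrib, Finset.prod_mul_distrib,
    Finset.prod_pow_eq_pow_sum]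
  rw [r₁_pi, r₂_pi]

/-- The residue of the zeta function of an order in terms of those of the number fields. -/
theorem prod_dedekindZeta_residue_mul {N : ℕ} (hN0 : 0 < N)
    (hN : ∀ x : ∀ i, 𝓞 (K i), (N : ∀ i, 𝓞 (K i)) * x ∈ (algebraMap O (∀ i, 𝓞 (K i))).range) :
    (∏ i, dedekindZeta_residue (K i)) *
      ((Nat.card ((∀ i, 𝓞 (K i)) ⧸ Ideal.span {(N : ∀ i, 𝓞 (K i))})ˣ : ℝ) /
        (Nat.card (O ⧸ (Ideal.span {(N : ∀ i, 𝓞 (K i))}).comap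
          (algebraMap O (∀ i, 𝓞 (K i))))ˣ *
          (algebraMap O (∀ i, 𝓞 (K i))).range.toAddSubgroup.index)) =
      2 ^ r₁ (∀ i, K i) * (2 * Real.pi) ^ r₂ (∀ i, K i) /
        (torsionOrder O * Real.sqrt |(disc O : ℝ)|) * OrderCNF.classNumber O * regulator O := by
  have hfin := finite_quotient_span_natCast K hN0
  have hclass := classNumber_mul_index_mul_card_units O hN0 hN
  have h0 : (∏ i, NumberField.classNumber (K i)) *
      Nat.card ((∀ i, 𝓞 (K i)) ⧸ Ideal.span {(N : ∀ i, 𝓞 (K i))})ˣ ≠ 0 :=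
    mul_ne_zero (Finset.prod_ne_zero_iff.2 fun i _ => (NumberField.classNumber_pos (K i)).ne')
      Nat.card_pos.ne'
  -- Finiteness of the unit index comes for free: it is a factor of a number already known to be
  -- nonzero.
  have hidx : (orderUnits O).index ≠ 0 := by
    rw [← hclass] at h0
    exact right_ne_zero_of_mul (left_ne_zero_of_mul h0)
  have hR0 : Nat.card (O ⧸ (Ideal.span {(N : ∀ i, 𝓞 (K i))}).comap
      (algebraMap O (∀ i, 𝓞 (K i))))ˣ ≠ 0 := by
    rw [← hclass] at h0
    exact right_ne_zero_of_mul h0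
  have hreg := regulator_mul_torsionOrder O hidx
  have hw : (∏ i, (Units.torsionOrder (K i) : ℝ)) ≠ 0 :=
    Finset.prod_ne_zero_iff.2 fun i _ => Nat.cast_ne_zero.2 (Units.torsionOrder_ne_zero (K i))
  have hw' : (torsionOrder O : ℝ) ≠ 0 := by
    have := finite_torsion_units O
    exact Nat.cast_ne_zero.2 Nat.card_pos.ne'
  have hclass' := congrArg (fun n : ℕ => (n : ℝ)) hclass
  push_cast at hclass'
  have hidx' : ((orderUnits O).index : ℝ) ≠ 0 := Nat.cast_ne_zero.2 hidx
  have hR0' := Nat.cast_ne_zero (R := ℝ).2 hR0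
  rw [prod_dedekindZeta_residue, sqrt_abs_disc]
  have hh : (OrderCNF.classNumber O : ℝ) = (∏ i, (NumberField.classNumber (K i) : ℝ)) *
      Nat.card ((∀ i, 𝓞 (K i)) ⧸ Ideal.span {(N : ∀ i, 𝓞 (K i))})ˣ /
      ((orderUnits O).index * Nat.card (O ⧸ (Ideal.span {(N : ∀ i, 𝓞 (K i))}).comap
        (algebraMap O (∀ i, 𝓞 (K i))))ˣ) := by
    rw [eq_div_iff (mul_ne_zero hidx' hR0'), ← hclass', mul_assoc]
  have hr : regulator O = (∏ i, Units.regulator (K i)) * (orderUnits O).index *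
      torsionOrder O / ∏ i, (Units.torsionOrder (K i) : ℝ) := by
    rw [eq_div_iff hw, hreg]
  rw [hh, hr]
  generalize (∏ i, (Units.torsionOrder (K i) : ℝ)) = w at *
  generalize (∏ i, (NumberField.classNumber (K i) : ℝ)) = h
  generalize (∏ i, Units.regulator (K i)) = r
  generalize (∏ i, Real.sqrt |(discr (K i) : ℝ)|) = d
  field_simp

end ClassNumberFormula

end OrderCNF

/-! ### The class number formula for orders. -/

theorem theorem3p1 {m : ℕ} (K : Fin m → Type*) [∀ i, Field (K i)] [∀ i, NumberField (K i)]
    (O : Subring (∀ i, K i)) [OrderCNF.IsOrder O] :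
    (∀ s : ℂ, 1 < s.re → Multipliable (OrderCNF.eulerFactor O s)) ∧
    ∃ Z : ℂ → ℂ, MeromorphicAt Z 1 ∧ (∀ s : ℂ, 1 < s.re → Z s = OrderCNF.zeta O s) ∧
      Tendsto (fun s : ℂ => (s - 1) ^ m * Z s) (𝓝[≠] 1)
        (𝓝 ((2 ^ OrderCNF.r₁ (∀ i, K i) * (2 * Real.pi) ^ OrderCNF.r₂ (∀ i, K i) /
          (OrderCNF.torsionOrder O * Real.sqrt |(OrderCNF.disc O : ℝ)|) *
          OrderCNF.classNumber O * OrderCNF.regulator O : ℝ) : ℂ)) := by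
  classical
  obtain ⟨N, hN0, hN⟩ := OrderCNF.exists_conductor O
  have hfin := OrderCNF.finite_quotient_span_natCast K hN0
  obtain ⟨C, hC, hC1, hprod⟩ := OrderCNF.exists_comparison_factor hN
  have hsum := fun i => (OrderCNF.exists_meromorphicAt_dedekindZeta (K i)).1
  choose Z hZ hZs using fun i => (OrderCNF.exists_meromorphicAt_dedekindZeta (K i)).2
  have key (s : ℂ) (hs : 1 < s.re) :
      HasProd (OrderCNF.eulerFactor O s) ((∏ i, Z i s) * C s) := by
    have hs0 : 0 < s.re := by linarith
    refine hprod s _ hs0 (OrderCNF.hasProd_eulerFactor_pi _ fun i => ?_)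
    rw [hZs i s hs, OrderCNF.dedekindZeta_eq_tsum (K i) (hsum i s hs)]
    exact OrderCNF.hasProd_eulerFactor (K i) hs0 (hsum i s hs)
  refine ⟨fun s hs => (key s hs).multipliable, fun s => (∏ i, Z i s) * C s, ?_,
    fun s hs => (key s hs).tprod_eq.symm, ?_⟩
  · exact (MeromorphicAt.fun_prod fun i _ => hZ i).fun_mul hC.meromorphicAt
  -- One factor `s - 1` goes to each of the `m` fields, and `C` contributes its value at `1` by
  -- continuity.
  · have h1 := tendsto_finsetProd Finset.univ fun i (_ : i ∈ Finset.univ) =>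
      OrderCNF.tendsto_sub_one_mul_of_eq_dedekindZeta (K i) (hZ i) (hZs i)
    have h2 := h1.mul (hC.continuousAt.tendsto.mono_left nhdsWithin_le_nhds)
    rw [← OrderCNF.prod_dedekindZeta_residue_mul O hN0 hN]
    rw [hC1] at h2
    push_cast
    refine h2.congr fun s => ?_
    rw [Finset.prod_mul_distrib, Finset.prod_const, Finset.card_univ, Fintype.card_fin, mul_assoc]
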